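/- Let $T^4=\mathbb R^4/\mathbb Z^4$ with its standard $1$-forms $\theta_1,\dots,\theta_4$, let $\Lambda=\mathbb Z+i\mathbb Z\subset\mathbb C$, and let $z=x+iy$ be the coordinate on $\mathbb C$. Let $\lambda:\Lambda\to\mathrm{Aut}(T^4)$ be the homomorphism with $\lambda(i)=\mathrm{Id}$ and $\lambda(1)(t_1,t_2,t_3,t_4)=(t_1,t_2-t_3,t_3,t_4)$ (so $\lambda(1)^*$ takes $\theta_2$ to $\theta_2-\theta_3$ and fixes $\theta_1,\theta_3,\theta_4$). Let $\tilde X=(T^4\times\mathbb C)/\Lambda$, where $\ell\in\Lambda$ acts by $(t,z)\mapsto(\lambda(\ell)t,\,z+\ell)$, with its projection $\pi$ to the complex torus $B=\mathbb C/\Lambda$ (a real $2$-torus). Then the $2$-form $$\omega=\theta_1\wedge\theta_2+\theta_3\wedge\theta_4+x\,\theta_1\wedge\theta_3$$ on $T^4\times\mathbb C$ descends to a $2$-form $\tilde\omega$ on $\tilde X$, and the following hold. 1. $\tilde X$ is a compact connected manifold and $\pi:\tilde X\to B$ is a smooth fibre bundle with fibre $T^4$. The restriction of $\tilde\omega$ to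 $S=\ker d\pi$ is closed and nondegenerate on every fibre. Thus $(\pi,\tilde\omega)$ is a smooth symplectic family over a complex manifold: the fibres are the symplectic leaves of a regular Poisson structure, and $B$ induces a transverse complex structure. 2. The family is generalized complex: there are a closed real $3$-form $H$ and an $H$-integrable generalized complex structure on $\tilde X$ inducing this Poisson structure and this transverse complex structure, that is, its canonical line bundle is at each point of the form $e^{b+iw}\wedge\pi^*(\Lambda^{1,0}T^*B)$ with $b,w$ real $2$-covectors and $w|_S=\tilde\omega|_S$. Indeed, for some closed real $3$-form $H$, the line bundle $e^{i\tilde\omega}\wedge\pi^*(\Lambda^{1,0}T^*B)$ is such a structure, and it is generalized Calabi–Yau: it is generated by a global spinor $\rho$ with $d_H\rho=d\rho+H\wedge\rho=0$. 3. The class $[\tilde\omega]_{d_S}$ of $\tilde\omega|_S$ in the fibrewise second cohomology, a section of the bundle over $B$ with fibres $H^2_{dR}(\pi^{-1}(b))$, is not flat under the Gauss–Manin connection. 4. $(\tilde X,\tilde\omega)$ is not a symplectic fibre bundle: it does not admit, around every point of $B$, smooth local trivializations that identify all the fibres symplectically with one symplectic form on $T^4$. -/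

import Mathlib

open scoped Manifold ContDiff TensorProduct

noncomputable section

namespace GenCplx

/-! ## Pointwise algebra: spinors on a real vector space `T` (a tangent space) -/

section Pointwise

variable {T : Type*} [AddCommGroup T] [Module ℝ T]

/-- Complex mixed-degree covectors on `T`: an element of `⋀^• T^*_ℂ` is given by its components in
each degree `k`, the `ℝ`-multilinear alternating maps `T^k → ℂ`. -/
abbrev SpinorAt (T : Type*) [AddCommGroup T] [Module ℝ T] : Type _ :=
  ∀ k : ℕ, T [⋀^Fin k]→ₗ[ℝ] ℂ

/-- Exterior product of homogeneous complex covectors (sum over shuffles, no factorials). -/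
def wedge {k l : ℕ} (α : T [⋀^Fin k]→ₗ[ℝ] ℂ) (β : T [⋀^Fin l]→ₗ[ℝ] ℂ) :
    T [⋀^Fin (k + l)]→ₗ[ℝ] ℂ :=
  ((LinearMap.mul' ℝ ℂ).compAlternatingMap (α.domCoprod β)).domDomCongr finSumFinEquiv

/-- Exterior product of mixed-degree covectors. -/
def spinorWedge (ρ τ : SpinorAt T) : SpinorAt T := fun n =>
  ∑ p : Finset.HasAntidiagonal.antidiagonal n,
    (wedge (ρ p.1.1) (τ p.1.2)).domDomCongr (finCongr (Finset.HasAntidiagonal.mem_antidiagonal.1 p.2))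

/-- A homogeneous covector of degree `k`, as a mixed-degree covector. -/
def homogeneous {k : ℕ} (α : T [⋀^Fin k]→ₗ[ℝ] ℂ) : SpinorAt T := Pi.single k α

/-- Exterior powers `c ∧ ⋯ ∧ c` (`j` factors). -/
def wedgePow (c : SpinorAt T) : ℕ → SpinorAt T
  | 0 => homogeneous (AlternatingMap.constOfIsEmpty ℝ T (Fin 0) (1 : ℂ))
  | j + 1 => spinorWedge c (wedgePow c j)

/-- The exponential `e^c = 1 + c + c ∧ c / 2 + ⋯` of a complex `2`-covector; in degree `n`
only the powers `j ≤ n` can contribute. -/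
def expTwo (c : T [⋀^Fin 2]→ₗ[ℝ] ℂ) : SpinorAt T := fun n =>
  ∑ j ∈ Finset.range (n + 1), ((j.factorial : ℂ)⁻¹) • wedgePow (homogeneous c) j n

/-- `T_ℂ ⊕ T^*_ℂ`; a complex covector is an `ℝ`-linear map `T → ℂ`. -/
abbrev GenVec (T : Type*) [AddCommGroup T] [Module ℝ T] : Type _ :=
  (ℂ ⊗[ℝ] T) × (T →ₗ[ℝ] ℂ)

/-- Contraction `ι_X ρ` with a complex vector. -/
def contract (X : ℂ ⊗[ℝ] T) (ρ : SpinorAt T) : SpinorAt T := fun k =>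
  LinearMap.liftBaseChange ℂ (ρ (k + 1)).curryLeft X

/-- The Clifford action `(X, ξ) · ρ = ι_X ρ + ξ ∧ ρ`. -/
def clifford (v : GenVec T) (ρ : SpinorAt T) : SpinorAt T :=
  contract v.1 ρ +
    spinorWedge (homogeneous (AlternatingMap.ofSubsingleton ℝ T ℂ (0 : Fin 1) v.2)) ρ

/-- The standard symmetric pairing `⟨(X, ξ), (Y, η)⟩ = (ξ(Y) + η(X)) / 2` on `T_ℂ ⊕ T^*_ℂ`. -/
def pairing (v w : GenVec T) : ℂ :=
  (LinearMap.liftBaseChange ℂ v.2 w.1 + LinearMap.liftBaseChange ℂ w.2 v.1) / 2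

/-- Complex conjugation on `T_ℂ ⊕ T^*_ℂ`. -/
def conjGen (v : GenVec T) : GenVec T :=
  (LinearMap.rTensor T Complex.conjAe.toLinearMap v.1, Complex.conjAe.toLinearMap ∘ₗ v.2)

/-- Isotropic complex subspaces of `T_ℂ ⊕ T^*_ℂ`. -/
def IsIsotropic (L : Submodule ℂ (GenVec T)) : Prop := ∀ v ∈ L, ∀ w ∈ L, pairing v w = 0

/-- A spinor is pure when its null space (its annihilator under the Clifford action) is
a maximal isotropic subspace. -/
def IsPure (ρ : SpinorAt T) : Prop :=
  ∃ L : Submodule ℂ (GenVec T), (∀ v, v ∈ L ↔ clifford v ρ = 0) ∧ IsIsotropic L ∧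
    ∀ L' : Submodule ℂ (GenVec T), IsIsotropic L' → L ≤ L' → L' = L

/-- Real rank zero: the null space `L` of the spinor satisfies `L ∩ conj L = 0`. -/
def HasRealRankZero (ρ : SpinorAt T) : Prop :=
  ∀ v : GenVec T, clifford v ρ = 0 → clifford (conjGen v) ρ = 0 → v = 0

/-- A real covector regarded as a complex one. -/
def complexify {k : ℕ} (α : T [⋀^Fin k]→ₗ[ℝ] ℝ) : T [⋀^Fin k]→ₗ[ℝ] ℂ :=
  Complex.ofRealCLM.toLinearMap.compAlternatingMap α

end Pointwise

/-! ## Differential forms on manifolds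

Manifolds are modelled on a real normed space `E`. As everywhere in Mathlib, the tangent space at
`x` is (definitionally) `E`, through the preferred chart at `x`. -/

section Forms

variable {E E' : Type*} [NormedAddCommGroup E] [NormedSpace ℝ E]
  [NormedAddCommGroup E'] [NormedSpace ℝ E']
  {M M' : Type*} [TopologicalSpace M] [ChartedSpace E M] [TopologicalSpace M'] [ChartedSpace E' M']
  {F : Type*} [NormedAddCommGroup F] [NormedSpace ℝ F] {k : ℕ}

/-- (Not necessarily smooth) `F`-valued differential forms of degree `k` on `M`. -/
abbrev Form (E M F : Type*) [NormedAddCommGroup E] [NormedSpace ℝ E] [NormedAddCommGroup F]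
    [NormedSpace ℝ F] (k : ℕ) : Type _ := M → E [⋀^Fin k]→L[ℝ] F

/-- The differential of a map at a point, `T_x M → T_{f x} M'`. -/
def diffAt (E E' : Type*) [NormedAddCommGroup E] [NormedSpace ℝ E]
    [NormedAddCommGroup E'] [NormedSpace ℝ E'] {M M' : Type*} [TopologicalSpace M]
    [ChartedSpace E M] [TopologicalSpace M'] [ChartedSpace E' M'] (f : M → M') (x : M) :
    E →L[ℝ] E' :=
  mfderiv 𝓘(ℝ, E) 𝓘(ℝ, E') f x

/-- Pullback `f^* α`. -/
def pullback (f : M → M') (α : Form E' M' F k) : Form E M F k := fun x =>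
  (α (f x)).compContinuousLinearMap (diffAt E E' f x)

/-- The expression of a form in the preferred chart at `c`. -/
def inChart (α : Form E M F k) (c : M) : E → E [⋀^Fin k]→L[ℝ] F :=
  pullback (chartAt E c).symm α

/-- Smoothness of a form on a subset `U` (used for open `U`). -/
def SmoothFormOn (α : Form E M F k) (U : Set M) : Prop :=
  ∀ c : M, ContDiffOn ℝ ∞ (inChart α c)
    ((chartAt E c).target ∩ (chartAt E c).symm ⁻¹' U)

/-- The exterior derivative, computed at `x` in the preferred chart at `x`. -/
def extD (α : Form E M F k) : Form E M F (k + 1) := fun x =>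
  (extDeriv (inChart α x) (chartAt E x x)).compContinuousLinearMap
    (diffAt E E (chartAt E x) x)

/-- Smoothness of a vector field on a subset `U` (used for open `U`). -/
def SmoothVectorFieldOn (u : M → E) (U : Set M) : Prop :=
  ∀ c : M, ContDiffOn ℝ ∞
    (fun y => diffAt E E (chartAt E c) ((chartAt E c).symm y) (u ((chartAt E c).symm y)))
    ((chartAt E c).target ∩ (chartAt E c).symm ⁻¹' U)

/-- A symplectic form. -/
structure IsSymplecticForm (σ : Form E M ℝ 2) : Prop where
  smooth : SmoothFormOn σ Set.univ
  closed : ∀ x, extD σ x = 0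
  nondegenerate : ∀ x (v : E), (∀ w : E, σ x ![v, w] = 0) → v = 0

/-! ## Generalized complex structures through pure spinors -/

/-- Complex mixed-degree differential forms. -/
abbrev SpinorField (E M : Type*) [NormedAddCommGroup E] [NormedSpace ℝ E] : Type _ :=
  ∀ k : ℕ, Form E M ℂ k

/-- The value of a mixed-degree form at a point. -/
def SpinorField.val (ρ : SpinorField E M) (x : M) : SpinorAt E := fun k =>
  (ρ k x).toAlternatingMap

/-- Smoothness of a mixed-degree form on a subset. -/
def SpinorField.SmoothOn (ρ : SpinorField E M) (U : Set M) : Prop :=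
  ∀ k, SmoothFormOn (ρ k) U

/-- The exterior derivative of a mixed-degree form. -/
def SpinorField.d (ρ : SpinorField E M) : SpinorField E M
  | 0 => 0
  | k + 1 => extD (ρ k)

/-- The value at `x` of `d_H ρ = dρ + H ∧ ρ`. -/
def twistedD (H : Form E M ℝ 3) (ρ : SpinorField E M) (x : M) : SpinorAt E :=
  ρ.d.val x + spinorWedge (homogeneous (complexify (H x).toAlternatingMap)) (ρ.val x)

/-- `ρ` is a smooth nowhere-vanishing generator over `U` of the family of lines `κ`. -/
def IsGeneratorOn (κ : M → Submodule ℂ (SpinorAt E)) (ρ : SpinorField E M) (U : Set M) : Prop :=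
  ρ.SmoothOn U ∧ ∀ x ∈ U, ρ.val x ≠ 0 ∧ κ x = Submodule.span ℂ {ρ.val x}

/-- An almost generalized complex structure, given by its canonical line bundle: a smooth complex
line subbundle of `⋀^• T^*_ℂ M` whose nonzero elements are pure spinors of real rank zero. -/
structure IsAlmostGeneralizedComplex (κ : M → Submodule ℂ (SpinorAt E)) : Prop where
  locally_generated : ∀ x, ∃ U : Set M, IsOpen U ∧ x ∈ U ∧ ∃ ρ, IsGeneratorOn κ ρ U
  pure : ∀ x, ∀ ρ ∈ κ x, ρ ≠ 0 → IsPure ρ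
  real_rank_zero : ∀ x, ∀ ρ ∈ κ x, ρ ≠ 0 → HasRealRankZero ρ

/-- A generalized complex structure with curvature the closed real `3`-form `H`: every local
(nowhere-vanishing, i.e. pure) section `ρ` of the canonical bundle satisfies
`d_H ρ = (X, ξ) · ρ` for some smooth local section `(X, ξ)` of `T_ℂ M ⊕ T^*_ℂ M`, `X = u + i w`. -/
structure IsGeneralizedComplex (H : Form E M ℝ 3) (κ : M → Submodule ℂ (SpinorAt E)) : Prop where
  almost : IsAlmostGeneralizedComplex κ
  smooth_curvature : SmoothFormOn H Set.univ
  closed_curvature : ∀ x, extD H x = 0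
  integrable : ∀ U : Set M, IsOpen U → ∀ ρ : SpinorField E M, IsGeneratorOn κ ρ U →
    ∃ (u w : M → E) (ξ : Form E M ℂ 1),
      SmoothVectorFieldOn u U ∧ SmoothVectorFieldOn w U ∧ SmoothFormOn ξ U ∧
      ∀ x ∈ U, twistedD H ρ x =
        clifford ((1 : ℂ) ⊗ₜ[ℝ] u x + Complex.I ⊗ₜ[ℝ] w x,
          (AlternatingMap.ofSubsingleton ℝ E ℂ (0 : Fin 1)).symm (ξ x).toAlternatingMap)
          (ρ.val x)

/-- A generalized Calabi–Yau structure: a generalized complex structure whose canonical bundle is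
generated by a global `d_H`-closed spinor. -/
def IsGeneralizedCalabiYau (H : Form E M ℝ 3) (κ : M → Submodule ℂ (SpinorAt E)) : Prop :=
  IsGeneralizedComplex H κ ∧
    ∃ ρ : SpinorField E M, IsGeneratorOn κ ρ Set.univ ∧ ∀ x, twistedD H ρ x = 0

end Forms

/-! ## Smooth symplectic families over a complex manifold -/

section Families

variable {E G : Type*} (V : Type*) [NormedAddCommGroup E] [NormedSpace ℝ E]
  [NormedAddCommGroup G] [NormedSpace ℝ G] [NormedAddCommGroup V] [NormedSpace ℂ V]
  {X F B : Type*} [TopologicalSpace X] [ChartedSpace E X] [TopologicalSpace F] [ChartedSpace G F]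
  [TopologicalSpace B] [ChartedSpace V B]

/-- A vector tangent to the fibres of `π`. -/
def IsVertical (π : X → B) (x : X) (v : E) : Prop := diffAt E V π x v = 0

/-- A local trivialization that is a diffeomorphism. -/
def IsSmoothTrivialization (π : X → B) (e : Bundle.Trivialization F π) : Prop :=
  ContMDiffOn 𝓘(ℝ, E) (𝓘(ℝ, V).prod 𝓘(ℝ, G)) ∞ e e.source ∧
    ContMDiffOn (𝓘(ℝ, V).prod 𝓘(ℝ, G)) 𝓘(ℝ, E) ∞ e.toOpenPartialHomeomorph.symm e.target

/-- A smooth fibre bundle `π : X → B` with fibre `F`. -/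
def IsSmoothFibreBundle (F : Type*) [TopologicalSpace F] [ChartedSpace G F] (π : X → B) : Prop :=
  ContMDiff 𝓘(ℝ, E) 𝓘(ℝ, V) ∞ π ∧
    ∀ b : B, ∃ e : Bundle.Trivialization F π, b ∈ e.baseSet ∧
      IsSmoothTrivialization (E := E) (G := G) V π e

/-- The filtration `F_n` of the forms of degree `m` on the total space: the forms with at least `n`
degrees along the base, i.e. those which vanish as soon as more than `m - n` of
the arguments are vertical. -/
def InFiltration (π : X → B) (n : ℕ) {m : ℕ} (α : Form E X ℝ m) : Prop :=
  ∀ (x : X) (v : Fin m → E),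
    (∃ s : Finset (Fin m), m < s.card + n ∧ ∀ i ∈ s, IsVertical V π x (v i)) → α x v = 0

/-- A smooth symplectic family with fibre `F`. The Poisson structure whose symplectic leaves are
the fibres is given by its leafwise symplectic form, a section of `⋀² S^*`, `S = ker dπ`.
It is represented by a `2`-form `Ω` on `X` extending it: `Γ(⋀² S^*)` is the quotient of the
`2`-forms by those in `F_1`, and the conditions below only involve the restriction to `S`. -/
structure IsSmoothSymplecticFamily (F : Type*) [TopologicalSpace F] [ChartedSpace G F]
    (π : X → B) (Ω : Form E X ℝ 2) : Prop where
  bundle : IsSmoothFibreBundle (E := E) (G := G) V F π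
  smooth : SmoothFormOn Ω Set.univ
  leafwise_closed : InFiltration V π 1 (extD Ω)
  leafwise_nondegenerate : ∀ x (v : E), IsVertical V π x v →
    (∀ w : E, IsVertical V π x w → Ω x ![v, w] = 0) → v = 0

/-- The line `e^c ∧ κ_I` at `x`. Here `κ_I` is the canonical line of the transverse complex
structure pulled back from `B`: the pullbacks of the complex-multilinear alternating forms of top
degree on the tangent space of `B` at `π x`. -/
def twistedCanonicalLine (π : X → B) (x : X) (c : E [⋀^Fin 2]→ₗ[ℝ] ℂ) :
    Submodule ℂ (SpinorAt E) :=
  Submodule.span ℂ (Set.range fun γ : V [⋀^Fin (Module.finrank ℂ V)]→L[ℂ] ℂ =>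
    spinorWedge (expTwo c)
      (homogeneous ((γ.restrictScalars ℝ).compContinuousLinearMap (diffAt E V π x)).toAlternatingMap))

/-- The generalized complex structure with canonical bundle `κ` induces the Poisson structure and
the transverse complex structure of the family: at each point
`κ = e^{b + i w} ∧ κ_I` with `b`, `w` real and `w` restricting to the leafwise symplectic form. -/
def Induces (κ : X → Submodule ℂ (SpinorAt E)) (π : X → B) (Ω : Form E X ℝ 2) : Prop :=
  ∀ x, ∃ b w : E [⋀^Fin 2]→ₗ[ℝ] ℝ,
    (∀ v : Fin 2 → E, (∀ i, IsVertical V π x (v i)) → w v = Ω x v) ∧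
      κ x = twistedCanonicalLine V π x (complexify b + Complex.I • complexify w)

/-- The family is generalized complex. -/
def IsGeneralizedComplexFamily (π : X → B) (Ω : Form E X ℝ 2) : Prop :=
  ∃ (H : Form E X ℝ 3) (κ : X → Submodule ℂ (SpinorAt E)),
    IsGeneralizedComplex H κ ∧ Induces V κ π Ω

/-- The canonical bundle `e^{iΩ} ∧ κ_I` determined by the chosen extension `Ω` of the leafwise
symplectic form. -/
def standardLine (π : X → B) (Ω : Form E X ℝ 2) (x : X) : Submodule ℂ (SpinorAt E) :=
  twistedCanonicalLine V π x (Complex.I • complexify (Ω x).toAlternatingMap)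

/-- For a form `α` of degree `m + 1` in `F_n`, vanishing of its class in the fibrewise cohomology
`H^{n; m + 1 - n}_{d_S}`, i.e. of its class in `F_n / F_{n+1}` modulo
`d_S (F_n / F_{n+1})`. -/
def FibrewiseExact (π : X → B) (n : ℕ) {m : ℕ} (α : Form E X ℝ (m + 1)) : Prop :=
  ∃ τ : Form E X ℝ m, SmoothFormOn τ Set.univ ∧ InFiltration V π n τ ∧
    InFiltration V π (n + 1) (α - extD τ)

/-- Flatness, under the Gauss–Manin connection, of the class in `H^{n; m - n}_{d_S}` of
a `d_S`-closed form `σ` of degree `m` in `F_n`. The connection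
is the connecting homomorphism of `0 → F_{n+1}/F_{n+2} → F_n/F_{n+2} → F_n/F_{n+1} → 0`, so that
`∇[σ]` is the class of `dσ` in `H^{n + 1; m - n}_{d_S}`. -/
def IsGaussManinFlat (π : X → B) (n : ℕ) {m : ℕ} (σ : Form E X ℝ m) : Prop :=
  FibrewiseExact V π (n + 1) (extD σ)

/-- The family is a symplectic fibre bundle: around each point of `B` there is a smooth
local trivialization under which the form on every fibre is one and the same symplectic form on
`F`. -/
def IsSymplecticFibreBundle (F : Type*) [TopologicalSpace F] [ChartedSpace G F]
    (π : X → B) (Ω : Form E X ℝ 2) : Prop :=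
  ∀ b : B, ∃ (e : Bundle.Trivialization F π) (σ : Form G F ℝ 2),
    b ∈ e.baseSet ∧ IsSmoothTrivialization (E := E) (G := G) V π e ∧ IsSymplecticForm σ ∧
      ∀ b' ∈ e.baseSet,
        pullback (E := G) (fun f : F => e.toOpenPartialHomeomorph.symm (b', f)) Ω = σ

end Families

/-- `q : M → N` presents the manifold `N` as the quotient of `M` by the relation `r`: it is
a surjective local diffeomorphism whose fibres are the classes of `r`. -/
structure IsManifoldQuotient {𝕜 : Type*} [NontriviallyNormedField 𝕜]
    {E E' H H' : Type*} [NormedAddCommGroup E] [NormedSpace 𝕜 E]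
    [NormedAddCommGroup E'] [NormedSpace 𝕜 E'] [TopologicalSpace H] [TopologicalSpace H']
    (I : ModelWithCorners 𝕜 E H) (J : ModelWithCorners 𝕜 E' H')
    {M N : Type*} [TopologicalSpace M] [ChartedSpace H M] [TopologicalSpace N] [ChartedSpace H' N]
    (q : M → N) (r : M → M → Prop) : Prop where
  surjective : Function.Surjective q
  isLocalDiffeomorph : IsLocalDiffeomorph I J ∞ q
  eq_iff : ∀ a b, q a = q b ↔ r a b

end GenCplx

end

/-!
The three manifolds `T = ℝ⁴ / ℤ⁴`, `B = ℂ / (ℤ + iℤ)` and `X` are quotients of a vector space by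
a group of affine maps; `X` is the quotient of `ℝ⁴ × ℂ` by the maps
`(t, z) ↦ (λ(ℓ) t + n, z + ℓ)`. Such a quotient carries the charts inverse to the quotient map
(`IsAffineCover`). Forms on it are the same as invariant forms upstairs, and smoothness and the
exterior derivative can be computed there (`IsAffineCover.pullback_descend`,
`IsAffineCover.extD_apply`, `IsAffineCover.smoothFormOn_of_pullback`).

The form `ω = θ₁ ∧ θ₂ + θ₃ ∧ θ₄ + x θ₁ ∧ θ₃` is invariant (`liftForm_deck`), and
`dω = dx ∧ θ₁ ∧ θ₃` vanishes on the fibres, where `ω` is symplectic.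

**Generalized Calabi–Yau structure.** The spinor `e^{iω} ∧ dz` is invariant as well. As
`θ₁ ∧ θ₃` has square zero, the spinor is affine in `x` (`liftSpinor_eq`), with
`d(e^{iω} ∧ dz) = i dx ∧ θ₁ ∧ θ₃ ∧ e^{iω} ∧ dz`. For `H = -dy ∧ θ₁ ∧ θ₃` the sum with
`H ∧ e^{iω} ∧ dz` is `i dz ∧ θ₁ ∧ θ₃ ∧ e^{iω} ∧ dz = 0` (`twistedD_totalSpinor`). Conjugating the
Clifford action by `e^c` reduces the null space of `e^c ∧ γ` to that of the `1`-covector `γ`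
(`clifford_expOp_oneForm_eq_zero_iff`), which gives purity and, from the nondegeneracy of `ω` on
the fibres, real rank zero. Every other local section is `f` times the global spinor, and
`d_H` of it is `(df / f) ∧` itself, which is integrability (`twistedD_generator`).

**Non-flatness.** A `2`-form `β` on a neighbourhood of `ℝ⁴ × {0}`, periodic in the fibre
directions, with `β(∂₁, ∂₃) = x` near `z = 0` cannot satisfy `dβ(∂_x, ∂₁, ∂₃) = 0`: otherwise the
constant `1 = ∂_x β(∂₁, ∂₃)` would be the divergence of a periodic vector field on the
`(t₁, t₃)`-torus (`not_closed_of_periodic`). Flatness would provide `β = ω - τ` with `τ` vanishing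
on the fibres. A symplectic trivialization would provide the pullback of the closed symplectic
form of the model fibre, which agrees with `ω` on the fibres.
-/

noncomputable section

namespace GenCplx

/-! ### Exterior products of complex covectors -/

section Algebra
variable {T : Type*} [AddCommGroup T] [Module ℝ T]

/-- The product `ξ₀ ∧ ⋯ ∧ ξₖ₋₁` of complex `1`-covectors: the alternating map with value
`det (ξ i (v j))`. -/
def decomposable {k : ℕ} (ξ : Fin k → T →ₗ[ℝ] ℂ) : T [⋀^Fin k]→ₗ[ℝ] ℂ :=
  MultilinearMap.alternatization ((MultilinearMap.mkPiAlgebra ℝ (Fin k) ℂ).compLinearMap ξ)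

theorem decomposable_apply {k : ℕ} (ξ : Fin k → T →ₗ[ℝ] ℂ) (v : Fin k → T) :
    decomposable ξ v = (Matrix.of fun i j => ξ i (v j)).det := by
  rw [decomposable, MultilinearMap.alternatization_apply, ← Matrix.det_transpose,
    Matrix.det_apply]
  rfl

theorem decomposable_domDomCongr {k l : ℕ} (h : k = l) (ξ : Fin k → T →ₗ[ℝ] ℂ) :
    (decomposable ξ).domDomCongr (finCongr h) = decomposable (ξ ∘ Fin.cast h.symm) := by
  subst h; rfl

theorem wedge_decomposable {k l : ℕ} (ξ : Fin k → T →ₗ[ℝ] ℂ) (η : Fin l → T →ₗ[ℝ] ℂ) :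
    wedge (decomposable ξ) (decomposable η) = decomposable (Fin.append ξ η) := by
  rw [wedge, decomposable, decomposable, ← MultilinearMap.domCoprod_alternization]
  ext v
  simp only [AlternatingMap.domDomCongr_apply, LinearMap.compAlternatingMap_apply,
    MultilinearMap.alternatization_apply, map_sum, decomposable]
  rw [← finSumFinEquiv.permCongr.sum_comp]
  refine Finset.sum_congr rfl fun σ _ => ?_
  rw [Equiv.Perm.sign_permCongr]
  simp only [Units.smul_def, map_zsmul]
  congr 1
  simp [MultilinearMap.domCoprod_apply, Fin.prod_univ_add, finSumFinEquiv]

/-- Expanding in a basis, every covector is a combination of products of `1`-covectors. -/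
theorem span_decomposable [FiniteDimensional ℝ T] (k : ℕ) :
    Submodule.span ℂ (Set.range (decomposable : (Fin k → T →ₗ[ℝ] ℂ) → _)) = ⊤ := by
  rw [eq_top_iff]
  rintro α -
  let b := Module.finBasis ℝ T
  -- alternatizing the expansion of `α` in a basis multiplies `α` by `k!`
  have key : α = (k.factorial : ℂ)⁻¹ • ∑ f : Fin k → Fin (Module.finrank ℝ T),
      α (fun i => b (f i)) •
        decomposable (fun i => Complex.ofRealCLM.toLinearMap ∘ₗ b.coord (f i)) := by
    have h2 : (α : MultilinearMap ℝ (fun _ : Fin k => T) ℂ) =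
        ∑ f : Fin k → Fin (Module.finrank ℝ T), α (fun i => b (f i)) •
          (MultilinearMap.mkPiAlgebra ℝ (Fin k) ℂ).compLinearMap
            (fun i => Complex.ofRealCLM.toLinearMap ∘ₗ b.coord (f i)) := by
      refine Module.Basis.ext_multilinear (fun _ => b) fun f => ?_
      simp only [AlternatingMap.coe_multilinearMap, sum_apply]
      rw [Finset.sum_eq_single f]
      · simp
      · intro g _ hg
        obtain ⟨i, hi⟩ := Function.ne_iff.1 hg
        have : ∏ i, ((b.coord (g i) (b (f i)) : ℝ) : ℂ) = 0 :=
          Finset.prod_eq_zero (Finset.mem_univ i) (by simp [Ne.symm hi])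
        simpa using Or.inr this
      · simp
    have h3 := congrArg MultilinearMap.alternatization h2
    rw [AlternatingMap.coe_alternatization, map_sum, Fintype.card_fin] at h3
    have h4 : ∀ (c : ℂ) (m : MultilinearMap ℝ (fun _ : Fin k => T) ℂ),
        MultilinearMap.alternatization (c • m) = c • MultilinearMap.alternatization m := by
      intro c m
      ext v
      simp [MultilinearMap.alternatization_apply, Finset.mul_sum, Units.smul_def,
        mul_left_comm]
    simp only [h4] at h3
    simp only [decomposable]
    rw [← h3, ← Nat.cast_smul_eq_nsmul ℂ, smul_smul, inv_mul_cancel₀, one_smul]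
    exact_mod_cast k.factorial_ne_zero
  rw [key]
  exact Submodule.smul_mem _ _ (Submodule.sum_mem _ fun f _ =>
    Submodule.smul_mem _ _ (Submodule.subset_span ⟨_, rfl⟩))

theorem decomposable_cons {k : ℕ} (ξ : T →ₗ[ℝ] ℂ) (η : Fin k → T →ₗ[ℝ] ℂ) (v : Fin (k + 1) → T) :
    decomposable (Fin.cons ξ η : Fin (k + 1) → T →ₗ[ℝ] ℂ) v =
      ∑ i : Fin (k + 1), (-1) ^ (i : ℕ) * ξ (v i) * decomposable η (i.removeNth v) := by
  rw [decomposable_apply, Matrix.det_succ_row_zero]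
  refine Finset.sum_congr rfl fun i _ => ?_
  rw [decomposable_apply]
  rfl

/-- The exterior product as a bilinear map. -/
def wedgeL (T : Type*) [AddCommGroup T] [Module ℝ T] (k l : ℕ) :
    (T [⋀^Fin k]→ₗ[ℝ] ℂ) →ₗ[ℂ] (T [⋀^Fin l]→ₗ[ℝ] ℂ) →ₗ[ℂ] T [⋀^Fin (k + l)]→ₗ[ℝ] ℂ :=
  LinearMap.mk₂ ℂ wedge
    (fun α α' β => by
      simp only [wedge, ← AlternatingMap.domCoprod'_apply, TensorProduct.add_tmul, map_add]
      ext; simp)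
    (fun c α β => by
      ext v
      simp only [wedge, AlternatingMap.domDomCongr_apply, LinearMap.compAlternatingMap_apply,
        AlternatingMap.domCoprod_apply, AlternatingMap.smul_apply, sum_apply, map_sum,
        Finset.smul_sum]
      refine Finset.sum_congr rfl fun σ _ => ?_
      induction σ using Quotient.inductionOn' with | _ σ
      rcases Int.units_eq_one_or (Equiv.Perm.sign σ) with h | h <;>
        simp [AlternatingMap.domCoprod.summand, h, mul_assoc])
    (fun α β β' => by
      simp only [wedge, ← AlternatingMap.domCoprod'_apply, TensorProduct.tmul_add, map_add]
      ext; simp)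
    (fun c α β => by
      ext v
      simp only [wedge, AlternatingMap.domDomCongr_apply, LinearMap.compAlternatingMap_apply,
        AlternatingMap.domCoprod_apply, AlternatingMap.smul_apply, sum_apply, map_sum,
        Finset.smul_sum]
      refine Finset.sum_congr rfl fun σ _ => ?_
      induction σ using Quotient.inductionOn' with | _ σ
      rcases Int.units_eq_one_or (Equiv.Perm.sign σ) with h | h <;>
        simp [AlternatingMap.domCoprod.summand, h, mul_left_comm])


@[simp] theorem wedgeL_apply {k l : ℕ} (α : T [⋀^Fin k]→ₗ[ℝ] ℂ) (β : T [⋀^Fin l]→ₗ[ℝ] ℂ) :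
    wedgeL T k l α β = wedge α β := rfl

theorem homogeneous_domDomCongr {k l : ℕ} (h : k = l) (α : T [⋀^Fin k]→ₗ[ℝ] ℂ) :
    homogeneous (α.domDomCongr (finCongr h)) = homogeneous α := by
  subst h; rfl

theorem homogeneous_apply_self {k : ℕ} (α : T [⋀^Fin k]→ₗ[ℝ] ℂ) : homogeneous α k = α :=
  Pi.single_eq_same _ _

theorem homogeneous_apply_ne {k n : ℕ} (h : n ≠ k) (α : T [⋀^Fin k]→ₗ[ℝ] ℂ) :
    homogeneous α n = 0 :=
  Pi.single_eq_of_ne h _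

/-- `homogeneous` as a linear map. -/
def homogeneousL (T : Type*) [AddCommGroup T] [Module ℝ T] (k : ℕ) :
    (T [⋀^Fin k]→ₗ[ℝ] ℂ) →ₗ[ℂ] SpinorAt T :=
  LinearMap.single ℂ (fun k => T [⋀^Fin k]→ₗ[ℝ] ℂ) k

theorem homogeneousL_apply {k : ℕ} (α : T [⋀^Fin k]→ₗ[ℝ] ℂ) :
    homogeneousL T k α = homogeneous α := rfl

/-- The exterior product of mixed-degree covectors as a bilinear map. -/
def spinorWedgeL (T : Type*) [AddCommGroup T] [Module ℝ T] :
    SpinorAt T →ₗ[ℂ] SpinorAt T →ₗ[ℂ] SpinorAt T :=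
  LinearMap.mk₂ ℂ spinorWedge
    (fun ρ ρ' τ => by
      funext n
      simp only [spinorWedge, Pi.add_apply, ← wedgeL_apply, map_add, LinearMap.add_apply]
      rw [← Finset.sum_add_distrib]
      rfl)
    (fun c ρ τ => by
      funext n
      simp only [spinorWedge, Pi.smul_apply, ← wedgeL_apply, map_smul, LinearMap.smul_apply]
      rw [Finset.smul_sum]
      rfl)
    (fun ρ τ τ' => by
      funext n
      simp only [spinorWedge, Pi.add_apply, ← wedgeL_apply, map_add]
      rw [← Finset.sum_add_distrib]
      rfl)
    (fun c ρ τ => by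
      funext n
      simp only [spinorWedge, Pi.smul_apply, ← wedgeL_apply, map_smul]
      rw [Finset.smul_sum]
      rfl)

theorem spinorWedgeL_apply (ρ τ : SpinorAt T) : spinorWedgeL T ρ τ = spinorWedge ρ τ := rfl

/-- Degreewise formula for the product with a homogeneous covector on the left. -/
theorem spinorWedge_homogeneous_left {k : ℕ} (α : T [⋀^Fin k]→ₗ[ℝ] ℂ) (τ : SpinorAt T) (l : ℕ) :
    spinorWedge (homogeneous α) τ (k + l) = wedge α (τ l) := by
  have hm : (k, l) ∈ Finset.HasAntidiagonal.antidiagonal (k + l) := by simp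
  rw [spinorWedge, Finset.sum_eq_single ⟨(k, l), hm⟩]
  · simp only [homogeneous_apply_self]
    rfl
  · rintro ⟨⟨a, b⟩, hab⟩ - hne
    have ha : a ≠ k := by
      rintro rfl
      apply hne
      simp only [Finset.HasAntidiagonal.mem_antidiagonal] at hab
      have : b = l := by omega
      subst this; rfl
    simp only [homogeneous_apply_ne ha]
    rw [← wedgeL_apply, map_zero]
    rfl
  · simp

theorem spinorWedge_homogeneous_left_of_lt {k n : ℕ} (h : n < k) (α : T [⋀^Fin k]→ₗ[ℝ] ℂ)
    (τ : SpinorAt T) : spinorWedge (homogeneous α) τ n = 0 := by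
  rw [spinorWedge]
  refine Finset.sum_eq_zero ?_
  rintro ⟨⟨a, b⟩, hab⟩ -
  have ha : a ≠ k := by
    rintro rfl
    simp only [Finset.HasAntidiagonal.mem_antidiagonal] at hab
    omega
  simp only [homogeneous_apply_ne ha]
  rw [← wedgeL_apply, map_zero]
  rfl

theorem spinorWedge_homogeneous {k l : ℕ} (α : T [⋀^Fin k]→ₗ[ℝ] ℂ) (β : T [⋀^Fin l]→ₗ[ℝ] ℂ) :
    spinorWedge (homogeneous α) (homogeneous β) = homogeneous (wedge α β) := by
  funext n
  rcases lt_or_ge n k with h | h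
  · rw [spinorWedge_homogeneous_left_of_lt h, homogeneous_apply_ne (by omega)]
  obtain ⟨m, rfl⟩ := Nat.exists_eq_add_of_le h
  rw [spinorWedge_homogeneous_left]
  by_cases hm : m = l
  · subst hm
    rw [homogeneous_apply_self, homogeneous_apply_self]
  · rw [homogeneous_apply_ne hm, homogeneous_apply_ne (by omega), ← wedgeL_apply, map_zero]

/-- A `1`-covector, as a mixed-degree covector. -/
abbrev oneForm (ξ : T →ₗ[ℝ] ℂ) : SpinorAt T :=
  homogeneous (AlternatingMap.ofSubsingleton ℝ T ℂ (0 : Fin 1) ξ)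

theorem ofSubsingleton_eq_decomposable (ξ : T →ₗ[ℝ] ℂ) :
    AlternatingMap.ofSubsingleton ℝ T ℂ (0 : Fin 1) ξ = decomposable fun _ => ξ := by
  ext v
  simp [decomposable_apply]

theorem oneForm_wedge_zero (ξ : T →ₗ[ℝ] ℂ) (ρ : SpinorAt T) :
    spinorWedge (oneForm ξ) ρ 0 = 0 :=
  spinorWedge_homogeneous_left_of_lt zero_lt_one _ _

theorem contract_tmul_apply (c : ℂ) (u : T) (ρ : SpinorAt T) (k : ℕ) (v : Fin k → T) :
    contract (c ⊗ₜ[ℝ] u) ρ k v = c * ρ (k + 1) (Matrix.vecCons u v) := by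
  simp [contract]

/-- Contraction as a bilinear map. -/
def contractL (T : Type*) [AddCommGroup T] [Module ℝ T] :
    (ℂ ⊗[ℝ] T) →ₗ[ℂ] SpinorAt T →ₗ[ℂ] SpinorAt T :=
  LinearMap.mk₂ ℂ contract
    (fun X X' ρ => by funext k; simp [contract])
    (fun c X ρ => by funext k; simp [contract])
    (fun X ρ ρ' => by
      induction X using TensorProduct.induction_on with
      | zero => funext k; simp [contract]
      | add X Y hX hY =>
        have h : ∀ τ : SpinorAt T, contract (X + Y) τ = contract X τ + contract Y τ :=
          fun τ => by funext k; simp [contract]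
        rw [h, h, h, hX, hY]; abel
      | tmul c u =>
        funext k; ext v
        simp [contract_tmul_apply, mul_add])
    (fun a X ρ => by
      induction X using TensorProduct.induction_on with
      | zero => funext k; simp [contract]
      | add X Y hX hY =>
        have h : ∀ τ : SpinorAt T, contract (X + Y) τ = contract X τ + contract Y τ :=
          fun τ => by funext k; simp [contract]
        rw [h, h, hX, hY, smul_add]
      | tmul c u =>
        funext k; ext v
        simp [contract_tmul_apply, mul_left_comm])

theorem contractL_apply (X : ℂ ⊗[ℝ] T) (ρ : SpinorAt T) : contractL T X ρ = contract X ρ := rfl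

/-- Value of a `1`-covector on a complex vector. -/
abbrev evalC (ξ : T →ₗ[ℝ] ℂ) (X : ℂ ⊗[ℝ] T) : ℂ := LinearMap.liftBaseChange ℂ ξ X

variable [FiniteDimensional ℝ T]

/-- A mixed-degree covector is the sum of its components, of which only finitely many are
nonzero. -/
theorem sum_homogeneous (ρ : SpinorAt T) :
    ∑ k ∈ Finset.range (Module.finrank ℝ T + 1), homogeneous (ρ k) = ρ := by
  funext n
  rw [Finset.sum_apply]
  by_cases hn : n < Module.finrank ℝ T + 1
  · rw [Finset.sum_eq_single n, homogeneous_apply_self]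
    · intro b _ hb
      exact homogeneous_apply_ne hb.symm _
    · simp [hn]
  · rw [Finset.sum_eq_zero]
    · ext v
      refine (AlternatingMap.map_linearDependent (ρ n) v fun h => hn ?_).symm
      have := h.fintype_card_le_finrank
      rw [Fintype.card_fin] at this
      omega
    · intro k hk
      rw [homogeneous_apply_ne]
      rintro rfl
      exact hn (Finset.mem_range.1 hk)

/-- A linear property of mixed-degree covectors only has to be checked on products of
`1`-covectors. -/
theorem spinor_induction {P : SpinorAt T → Prop} (ρ : SpinorAt T) (zero : P 0)
    (add : ∀ ρ τ, P ρ → P τ → P (ρ + τ)) (smul : ∀ (c : ℂ) ρ, P ρ → P (c • ρ))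
    (mem : ∀ {k : ℕ} (ξ : Fin k → T →ₗ[ℝ] ℂ), P (homogeneous (decomposable ξ))) : P ρ := by
  have hom : ∀ {k : ℕ} (α : T [⋀^Fin k]→ₗ[ℝ] ℂ), P (homogeneous α) := by
    intro k α
    have hα : α ∈ Submodule.span ℂ (Set.range (decomposable : (Fin k → T →ₗ[ℝ] ℂ) → _)) := by
      rw [span_decomposable]; trivial
    induction hα using Submodule.span_induction with
    | mem α hα =>
      obtain ⟨ξ, rfl⟩ := hα
      exact mem ξ
    | zero => rwa [← homogeneousL_apply, map_zero]
    | add α β _ _ hα hβ =>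
      rw [← homogeneousL_apply, map_add]
      exact add _ _ hα hβ
    | smul c α _ hα =>
      rw [← homogeneousL_apply, map_smul]
      exact smul _ _ hα
  rw [← sum_homogeneous ρ]
  exact Finset.sum_induction _ P add zero fun k _ => hom (ρ k)

theorem spinorWedge_assoc (ρ σ τ : SpinorAt T) :
    spinorWedge (spinorWedge ρ σ) τ = spinorWedge ρ (spinorWedge σ τ) := by
  simp only [← spinorWedgeL_apply]
  induction ρ using spinor_induction with
  | zero => simp
  | add ρ ρ' h h' => simp [h, h']
  | smul c ρ h => simp [h]
  | mem ξ =>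
  induction σ using spinor_induction with
  | zero => simp
  | add ρ ρ' h h' => simp [h, h']
  | smul c ρ h => simp [h]
  | mem η =>
  induction τ using spinor_induction with
  | zero => simp
  | add ρ ρ' h h' => simp [h, h']
  | smul c ρ h => simp [h]
  | mem ζ =>
  simp only [spinorWedgeL_apply, spinorWedge_homogeneous, wedge_decomposable]
  rw [Fin.append_assoc, ← decomposable_domDomCongr (Nat.add_assoc _ _ _).symm,
    homogeneous_domDomCongr]

/-- Product with a `1`-covector, by Laplace expansion of a determinant along its first row. -/
theorem oneForm_wedge_apply (ξ : T →ₗ[ℝ] ℂ) (ρ : SpinorAt T) (k : ℕ) (v : Fin (k + 1) → T) :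
    spinorWedge (oneForm ξ) ρ (k + 1) v =
      ∑ i : Fin (k + 1), (-1) ^ (i : ℕ) * ξ (v i) * ρ k (i.removeNth v) := by
  rw [← spinorWedgeL_apply]
  induction ρ using spinor_induction with
  | zero => simp
  | add ρ ρ' h h' => simp [h, h', mul_add, Finset.sum_add_distrib]
  | smul c ρ h => simp [h, mul_left_comm, Finset.mul_sum]
  | @mem l η =>
  rw [spinorWedgeL_apply, oneForm, ofSubsingleton_eq_decomposable, spinorWedge_homogeneous,
    wedge_decomposable]
  have : Fin.append (fun _ : Fin 1 => ξ) η =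
      (Fin.cons ξ η : Fin (l + 1) → T →ₗ[ℝ] ℂ) ∘ Fin.cast (Nat.add_comm 1 l) := by
    rw [Fin.append_left_eq_cons]
  rw [this, ← decomposable_domDomCongr (Nat.add_comm l 1), homogeneous_domDomCongr]
  by_cases hk : k = l
  · subst hk
    rw [homogeneous_apply_self, homogeneous_apply_self, decomposable_cons]
  · rw [homogeneous_apply_ne (by omega)]
    simp [homogeneous_apply_ne hk]

/-- The canonical anticommutation relation between contractions and `1`-covectors. -/
theorem contract_oneForm_wedge (X : ℂ ⊗[ℝ] T) (ξ : T →ₗ[ℝ] ℂ) (ρ : SpinorAt T) :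
    contract X (spinorWedge (oneForm ξ) ρ) =
      evalC ξ X • ρ - spinorWedge (oneForm ξ) (contract X ρ) := by
  simp only [← contractL_apply, ← spinorWedgeL_apply]
  induction X using TensorProduct.induction_on with
  | zero => simp
  | add X Y hX hY =>
    simp only [map_add, LinearMap.add_apply, hX, hY, add_smul]
    abel
  | tmul c u =>
    simp only [contractL_apply, spinorWedgeL_apply]
    funext k
    ext v
    rw [contract_tmul_apply, oneForm_wedge_apply, Fin.sum_univ_succ]
    cases k with
    | zero =>
      simp [oneForm_wedge_zero, evalC, mul_assoc]
    | succ k =>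
      simp only [Pi.sub_apply, AlternatingMap.sub_apply, oneForm_wedge_apply, contract_tmul_apply]
      have h : ∀ i : Fin (k + 1), i.succ.removeNth (Matrix.vecCons u v) =
          Matrix.vecCons u (i.removeNth v) := by
        intro i
        ext j
        cases j using Fin.cases <;> simp [Fin.removeNth]
      simp only [h, Fin.val_succ, Fin.val_zero, pow_zero, one_mul, Matrix.cons_val_zero,
        Matrix.cons_val_succ, Fin.removeNth_zero, mul_add, Finset.mul_sum, pow_succ]
      rw [sub_eq_add_neg, ← Finset.sum_neg_distrib]
      congr 1
      · simp [evalC, mul_assoc]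
      · exact Finset.sum_congr rfl fun i _ => by ring

end Algebra

/-! ### The exponential of a two-covector as an operator -/

section Exponential
variable {T : Type*} [AddCommGroup T] [Module ℝ T]

/-- The unit `1 ∈ ⋀⁰`. -/
abbrev unitSpinor (T : Type*) [AddCommGroup T] [Module ℝ T] : SpinorAt T :=
  homogeneous (AlternatingMap.constOfIsEmpty ℝ T (Fin 0) (1 : ℂ))

theorem unitSpinor_eq :
    unitSpinor T = homogeneous (decomposable (Fin.elim0 : Fin 0 → T →ₗ[ℝ] ℂ)) := by
  rw [unitSpinor]
  congr 1
  ext v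
  simp [decomposable_apply]

theorem contract_unitSpinor (X : ℂ ⊗[ℝ] T) : contract X (unitSpinor T) = 0 := by
  rw [← contractL_apply]
  induction X using TensorProduct.induction_on with
  | zero => simp
  | add X Y hX hY => rw [map_add, LinearMap.add_apply, hX, hY, add_zero]
  | tmul c u =>
    funext k
    ext v
    rw [contractL_apply, contract_tmul_apply, unitSpinor, homogeneous_apply_ne (by omega)]
    simp

/-- The bilinear form of a `2`-covector. -/
def toBilin (c : T [⋀^Fin 2]→ₗ[ℝ] ℂ) : T →ₗ[ℝ] T →ₗ[ℝ] ℂ :=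
  LinearMap.mk₂ ℝ (fun u v => c ![u, v])
    (fun u u' v => c.map_vecCons_add ![v] u u')
    (fun a u v => c.map_vecCons_smul ![v] a u)
    (fun u v v' => by
      have h : ∀ w, Function.update ![u, 0] 1 w = ![u, w] := fun w => by ext i; fin_cases i <;> rfl
      simpa only [h] using c.map_update_add ![u, 0] 1 v v')
    (fun a u v => by
      have h : ∀ w, Function.update ![u, 0] 1 w = ![u, w] := fun w => by ext i; fin_cases i <;> rfl
      simpa only [h] using c.map_update_smul ![u, 0] 1 a v)

/-- The contraction `ι_X c` of a `2`-covector, as a `1`-covector. -/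
def interior (c : T [⋀^Fin 2]→ₗ[ℝ] ℂ) : (ℂ ⊗[ℝ] T) →ₗ[ℂ] (T →ₗ[ℝ] ℂ) :=
  LinearMap.liftBaseChange ℂ (toBilin c)

theorem interior_tmul (c : T [⋀^Fin 2]→ₗ[ℝ] ℂ) (a : ℂ) (u v : T) :
    interior c (a ⊗ₜ[ℝ] u) v = a * c ![u, v] := by
  simp [interior, toBilin]

theorem oneForm_add (ξ η : T →ₗ[ℝ] ℂ) : oneForm (ξ + η) = oneForm ξ + oneForm η := by
  simp only [oneForm, ← homogeneousL_apply, ← map_add]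
  rfl

theorem contract_homogeneous_two (c : T [⋀^Fin 2]→ₗ[ℝ] ℂ) (X : ℂ ⊗[ℝ] T) :
    contract X (homogeneous c) = oneForm (interior c X) := by
  rw [← contractL_apply]
  induction X using TensorProduct.induction_on with
  | zero =>
    simp only [map_zero, LinearMap.zero_apply, oneForm, ← homogeneousL_apply]
    exact (map_zero (homogeneousL T 1)).symm
  | add X Y hX hY => rw [map_add, LinearMap.add_apply, hX, hY, map_add, oneForm_add]
  | tmul a u =>
    funext k
    ext v
    rw [contractL_apply, contract_tmul_apply]
    by_cases hk : k = 1
    · subst hk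
      rw [oneForm, homogeneous_apply_self, homogeneous_apply_self]
      have : v = ![v 0] := by ext i; fin_cases i; rfl
      rw [AlternatingMap.ofSubsingleton_apply_apply, interior_tmul, this]
      rfl
    · rw [oneForm, homogeneous_apply_ne (by omega), homogeneous_apply_ne hk]
      simp

theorem evalC_add (ξ η : T →ₗ[ℝ] ℂ) (X : ℂ ⊗[ℝ] T) :
    evalC (ξ + η) X = evalC ξ X + evalC η X := by
  induction X using TensorProduct.induction_on with
  | zero => simp
  | add X Y hX hY => simp only [evalC, map_add] at *; rw [hX, hY]; ring
  | tmul a u => simp [evalC]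

theorem evalC_smul (a : ℂ) (ξ : T →ₗ[ℝ] ℂ) (X : ℂ ⊗[ℝ] T) :
    evalC (a • ξ) X = a * evalC ξ X := by
  induction X using TensorProduct.induction_on with
  | zero => simp
  | add X Y hX hY => simp only [evalC, map_add] at *; rw [hX, hY]; ring
  | tmul b u => simp [evalC]

theorem evalC_zero (X : ℂ ⊗[ℝ] T) : evalC (0 : T →ₗ[ℝ] ℂ) X = 0 := by
  rw [← zero_smul ℂ (0 : T →ₗ[ℝ] ℂ), evalC_smul, zero_mul]

theorem evalC_interior_swap (c : T [⋀^Fin 2]→ₗ[ℝ] ℂ) (X Y : ℂ ⊗[ℝ] T) :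
    evalC (interior c X) Y = - evalC (interior c Y) X := by
  induction X using TensorProduct.induction_on with
  | zero => rw [map_zero, evalC_zero, evalC, map_zero, neg_zero]
  | add X X' hX hX' => rw [map_add, evalC_add, hX, hX']; simp only [evalC, map_add]; ring
  | tmul a u =>
    induction Y using TensorProduct.induction_on with
    | zero => rw [map_zero, evalC_zero, neg_zero, evalC, map_zero]
    | add Y Y' hY hY' =>
      rw [map_add (interior c), evalC_add, neg_add, ← hY, ← hY']; simp only [evalC, map_add]
    | tmul b v =>
      have h : c ![u, v] = - c ![v, u] := by
        have := c.map_swap ![v, u] (i := 0) (j := 1) (by decide)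
        rw [← this]
        congr 1
        ext i; fin_cases i <;> rfl
      simp only [evalC, LinearMap.liftBaseChange_tmul, interior_tmul, h, smul_eq_mul]
      ring

theorem oneForm_wedge_oneForm (ξ η : T →ₗ[ℝ] ℂ) :
    spinorWedge (oneForm ξ) (oneForm η) = homogeneous (decomposable ![ξ, η]) := by
  rw [oneForm, oneForm, spinorWedge_homogeneous, ofSubsingleton_eq_decomposable,
    ofSubsingleton_eq_decomposable, wedge_decomposable]
  congr 2
  ext i
  fin_cases i <;> rfl

theorem oneForm_wedge_oneForm_comm (ξ η : T →ₗ[ℝ] ℂ) :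
    spinorWedge (oneForm ξ) (oneForm η) = - spinorWedge (oneForm η) (oneForm ξ) := by
  rw [oneForm_wedge_oneForm, oneForm_wedge_oneForm, ← homogeneousL_apply, ← homogeneousL_apply,
    ← map_neg]
  congr 1
  ext v
  simp [decomposable_apply, Matrix.det_fin_two]
  ring

/-- Exterior product with a `2`-covector. -/
abbrev twoOp (c : T [⋀^Fin 2]→ₗ[ℝ] ℂ) : Module.End ℂ (SpinorAt T) := spinorWedgeL T (homogeneous c)

/-- Exterior product with a `1`-covector. -/
abbrev oneOp (ξ : T →ₗ[ℝ] ℂ) : Module.End ℂ (SpinorAt T) := spinorWedgeL T (oneForm ξ)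

theorem twoOp_apply_eq_zero {c : T [⋀^Fin 2]→ₗ[ℝ] ℂ} {ρ : SpinorAt T} {n : ℕ}
    (h : ∀ m, m + 2 ≤ n → ρ m = 0) : twoOp c ρ n = 0 := by
  rcases lt_or_ge n 2 with hn | hn
  · exact spinorWedge_homogeneous_left_of_lt hn _ _
  · obtain ⟨m, rfl⟩ := Nat.exists_eq_add_of_le hn
    rw [spinorWedgeL_apply, spinorWedge_homogeneous_left, h m (by omega), ← wedgeL_apply, map_zero]

theorem twoOp_pow_apply_eq_zero {c : T [⋀^Fin 2]→ₗ[ℝ] ℂ} {ρ : SpinorAt T} {n : ℕ} (j : ℕ)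
    (h : ∀ m, m + 2 * j ≤ n → ρ m = 0) : (twoOp c ^ j) ρ n = 0 := by
  induction j generalizing n with
  | zero => exact h n (by omega)
  | succ j ih =>
    rw [pow_succ', Module.End.mul_apply]
    exact twoOp_apply_eq_zero fun m hm => ih fun l hl => h l (by omega)

/-- The operator `e^c ∧`. As `c ^ j` vanishes for `2 j > dim T`, the sum contains every nonzero
term of the exponential series; the bound is generous so that one term can be split off. -/
def expOp (c : T [⋀^Fin 2]→ₗ[ℝ] ℂ) : Module.End ℂ (SpinorAt T) :=
  ∑ j ∈ Finset.range (Module.finrank ℝ T + 2), ((j.factorial : ℂ)⁻¹) • twoOp c ^ j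

theorem wedgePow_eq (c : T [⋀^Fin 2]→ₗ[ℝ] ℂ) (j : ℕ) :
    wedgePow (homogeneous c) j = (twoOp c ^ j) (unitSpinor T) := by
  induction j with
  | zero => rfl
  | succ j ih => rw [pow_succ', Module.End.mul_apply, ← ih]; rfl

theorem commute_expOp {c : T [⋀^Fin 2]→ₗ[ℝ] ℂ} {A : Module.End ℂ (SpinorAt T)}
    (h : Commute (twoOp c) A) : Commute (expOp c) A :=
  Commute.sum_left _ _ _ fun _ _ => (h.pow_left _).smul_left _

/-- In the lowest degree where `ρ` is nonzero, `e^c ∧ ρ` coincides with `ρ`. -/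
theorem expOp_injective {c : T [⋀^Fin 2]→ₗ[ℝ] ℂ} {ρ : SpinorAt T} (h : expOp c ρ = 0) : ρ = 0 := by
  funext n
  induction n using Nat.strong_induction_on with
  | _ n ih =>
    have hn := congrFun h n
    rw [expOp, Finset.sum_range_succ'] at hn
    simp only [LinearMap.add_apply, LinearMap.sum_apply, Finset.sum_apply, Pi.add_apply,
      LinearMap.smul_apply, Pi.smul_apply] at hn
    rw [Finset.sum_eq_zero fun j _ => ?_] at hn
    · simpa using hn
    · rw [twoOp_pow_apply_eq_zero, smul_zero]
      intro m hm
      exact ih m (by omega)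

variable [FiniteDimensional ℝ T]

theorem unitSpinor_wedge (ρ : SpinorAt T) : spinorWedge (unitSpinor T) ρ = ρ := by
  rw [unitSpinor_eq, ← spinorWedgeL_apply]
  induction ρ using spinor_induction with
  | zero => simp
  | add ρ ρ' h h' => rw [map_add, h, h']
  | smul c ρ h => rw [map_smul, h]
  | @mem k ξ =>
    rw [spinorWedgeL_apply, spinorWedge_homogeneous, wedge_decomposable, Fin.elim0_append,
      ← decomposable_domDomCongr (Nat.zero_add k).symm, homogeneous_domDomCongr]

theorem wedge_unitSpinor (ρ : SpinorAt T) : spinorWedge ρ (unitSpinor T) = ρ := by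
  rw [unitSpinor_eq, ← spinorWedgeL_apply]
  induction ρ using spinor_induction with
  | zero => simp
  | add ρ ρ' h h' => rw [map_add, LinearMap.add_apply, h, h']
  | smul c ρ h => rw [map_smul, LinearMap.smul_apply, h]
  | mem ξ =>
    rw [spinorWedgeL_apply, spinorWedge_homogeneous, wedge_decomposable, Fin.append_elim0,
      ← decomposable_domDomCongr (Nat.add_zero _).symm, homogeneous_domDomCongr]

theorem oneForm_wedge_oneForm_apply (ξ η : T →ₗ[ℝ] ℂ) (v : Fin 2 → T) :
    spinorWedge (oneForm ξ) (oneForm η) 2 v = ξ (v 0) * η (v 1) - ξ (v 1) * η (v 0) := by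
  rw [oneForm_wedge_apply, Fin.sum_univ_two, oneForm, homogeneous_apply_self]
  simp [Fin.removeNth, Fin.succAbove, Fin.tail]
  ring

/-- Induction principle for products with a `2`-covector. -/
theorem two_induction {P : SpinorAt T → Prop} (c : T [⋀^Fin 2]→ₗ[ℝ] ℂ) (zero : P 0)
    (add : ∀ ρ τ, P ρ → P τ → P (ρ + τ)) (smul : ∀ (c : ℂ) ρ, P ρ → P (c • ρ))
    (mem : ∀ ξ η : T →ₗ[ℝ] ℂ, P (spinorWedge (oneForm ξ) (oneForm η))) : P (homogeneous c) := by
  have hc : c ∈ Submodule.span ℂ (Set.range (decomposable : (Fin 2 → T →ₗ[ℝ] ℂ) → _)) := by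
    rw [span_decomposable]; trivial
  induction hc using Submodule.span_induction with
  | mem c hc =>
    obtain ⟨ξ, rfl⟩ := hc
    have : ξ = ![ξ 0, ξ 1] := by ext i; fin_cases i <;> rfl
    rw [this, ← oneForm_wedge_oneForm]
    exact mem _ _
  | zero => rwa [← homogeneousL_apply, map_zero]
  | add α β _ _ hα hβ =>
    rw [← homogeneousL_apply, map_add]
    exact add _ _ hα hβ
  | smul c α _ hα =>
    rw [← homogeneousL_apply, map_smul]
    exact smul _ _ hα

theorem two_wedge_oneForm_wedge (c : T [⋀^Fin 2]→ₗ[ℝ] ℂ) (ξ : T →ₗ[ℝ] ℂ) (ρ : SpinorAt T) :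
    spinorWedge (homogeneous c) (spinorWedge (oneForm ξ) ρ) =
      spinorWedge (oneForm ξ) (spinorWedge (homogeneous c) ρ) := by
  simp only [← spinorWedgeL_apply]
  refine two_induction (P := fun σ => spinorWedgeL T σ (spinorWedgeL T (oneForm ξ) ρ) =
    spinorWedgeL T (oneForm ξ) (spinorWedgeL T σ ρ)) c (by simp)
    (fun σ τ h h' => by simp [h, h'])
    (fun a σ h => by simp [h]) fun α β => ?_
  simp only [spinorWedgeL_apply]
  rw [spinorWedge_assoc, ← spinorWedge_assoc (oneForm β), oneForm_wedge_oneForm_comm β ξ,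
    ← spinorWedge_assoc (oneForm ξ), ← spinorWedge_assoc (oneForm ξ),
    oneForm_wedge_oneForm_comm ξ α]
  simp only [← spinorWedgeL_apply, map_neg, LinearMap.neg_apply]
  simp only [spinorWedgeL_apply, spinorWedge_assoc]

theorem two_wedge_two_wedge (c c' : T [⋀^Fin 2]→ₗ[ℝ] ℂ) (ρ : SpinorAt T) :
    spinorWedge (homogeneous c) (spinorWedge (homogeneous c') ρ) =
      spinorWedge (homogeneous c') (spinorWedge (homogeneous c) ρ) := by
  simp only [← spinorWedgeL_apply]
  refine two_induction (P := fun σ => spinorWedgeL T (homogeneous c) (spinorWedgeL T σ ρ) =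
    spinorWedgeL T σ (spinorWedgeL T (homogeneous c) ρ)) c' (by simp)
    (fun σ τ h h' => by simp [h, h'])
    (fun a σ h => by simp [h]) fun α β => ?_
  simp only [spinorWedgeL_apply, spinorWedge_assoc, two_wedge_oneForm_wedge]

theorem contract_oneForm (X : ℂ ⊗[ℝ] T) (ξ : T →ₗ[ℝ] ℂ) :
    contract X (oneForm ξ) = evalC ξ X • unitSpinor T := by
  rw [← wedge_unitSpinor (oneForm ξ), contract_oneForm_wedge, contract_unitSpinor,
    ← spinorWedgeL_apply, map_zero, sub_zero]

/-- Contraction is a derivation on products with a `2`-covector. -/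
theorem contract_two_wedge (X : ℂ ⊗[ℝ] T) (c : T [⋀^Fin 2]→ₗ[ℝ] ℂ) (ρ : SpinorAt T) :
    contract X (spinorWedge (homogeneous c) ρ) =
      spinorWedge (homogeneous c) (contract X ρ) +
        spinorWedge (oneForm (interior c X)) ρ := by
  rw [← contract_homogeneous_two]
  simp only [← spinorWedgeL_apply, ← contractL_apply]
  refine two_induction (P := fun σ => contractL T X (spinorWedgeL T σ ρ) =
    spinorWedgeL T σ (contractL T X ρ) + spinorWedgeL T (contractL T X σ) ρ) c (by simp)
    (fun σ τ h h' => by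
      simp only [map_add, LinearMap.add_apply, h, h']; abel)
    (fun a σ h => by simp [h]) fun ξ η => ?_
  simp only [spinorWedgeL_apply, contractL_apply, spinorWedge_assoc]
  simp only [contract_oneForm_wedge, contract_oneForm]
  simp only [← spinorWedgeL_apply, map_sub, map_smul, LinearMap.sub_apply, LinearMap.smul_apply]
  simp only [spinorWedgeL_apply, wedge_unitSpinor]
  abel

theorem commute_twoOp_oneOp (c : T [⋀^Fin 2]→ₗ[ℝ] ℂ) (ξ : T →ₗ[ℝ] ℂ) :
    Commute (twoOp c) (oneOp ξ) :=
  LinearMap.ext fun ρ => two_wedge_oneForm_wedge c ξ ρ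

theorem commute_twoOp_twoOp (c c' : T [⋀^Fin 2]→ₗ[ℝ] ℂ) : Commute (twoOp c) (twoOp c') :=
  LinearMap.ext fun ρ => two_wedge_two_wedge c c' ρ

theorem spinor_apply_eq_zero {ρ : SpinorAt T} {n : ℕ} (hn : Module.finrank ℝ T < n) : ρ n = 0 := by
  ext v
  refine AlternatingMap.map_linearDependent (ρ n) v fun h => absurd hn ?_
  have := h.fintype_card_le_finrank
  rw [Fintype.card_fin] at this
  omega

theorem twoOp_pow_eq_zero (c : T [⋀^Fin 2]→ₗ[ℝ] ℂ) {j : ℕ} (hj : Module.finrank ℝ T < j) :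
    twoOp c ^ j = 0 := by
  ext ρ n : 2
  by_cases hn : Module.finrank ℝ T < n
  · exact spinor_apply_eq_zero hn
  · exact twoOp_pow_apply_eq_zero j fun m hm => by omega

theorem expOp_eq_sum (c : T [⋀^Fin 2]→ₗ[ℝ] ℂ) :
    expOp c = ∑ j ∈ Finset.range (Module.finrank ℝ T + 1),
      ((j.factorial : ℂ)⁻¹) • twoOp c ^ j := by
  rw [expOp, Finset.sum_range_succ, twoOp_pow_eq_zero c (Nat.lt_succ_self _), smul_zero, add_zero]

theorem expTwo_eq (c : T [⋀^Fin 2]→ₗ[ℝ] ℂ) : expTwo c = expOp c (unitSpinor T) := by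
  funext n
  by_cases hn : Module.finrank ℝ T < n
  · exact (spinor_apply_eq_zero hn).trans (spinor_apply_eq_zero hn).symm
  simp only [expTwo, expOp, LinearMap.sum_apply, Finset.sum_apply, LinearMap.smul_apply,
    Pi.smul_apply, wedgePow_eq]
  refine Finset.sum_subset (fun j => ?_) fun j _ hj => ?_
  · simp only [Finset.mem_range]; omega
  · have h : (twoOp c ^ j) (unitSpinor T) n = 0 := by
      refine twoOp_pow_apply_eq_zero j fun m hm => ?_
      simp only [Finset.mem_range] at hj
      omega
    rw [h, smul_zero]

theorem twoOp_pow_wedge (c : T [⋀^Fin 2]→ₗ[ℝ] ℂ) (j : ℕ) (σ ρ : SpinorAt T) :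
    spinorWedge ((twoOp c ^ j) σ) ρ = (twoOp c ^ j) (spinorWedge σ ρ) := by
  induction j with
  | zero => rfl
  | succ j ih =>
    rw [pow_succ', Module.End.mul_apply, Module.End.mul_apply, ← ih, spinorWedgeL_apply,
      spinorWedge_assoc, spinorWedgeL_apply]

theorem expTwo_wedge (c : T [⋀^Fin 2]→ₗ[ℝ] ℂ) (ρ : SpinorAt T) :
    spinorWedge (expTwo c) ρ = expOp c ρ := by
  rw [expTwo_eq, ← spinorWedgeL_apply]
  simp only [expOp, LinearMap.sum_apply, map_sum, LinearMap.smul_apply, map_smul,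
    spinorWedgeL_apply, twoOp_pow_wedge, unitSpinor_wedge]

theorem contractL_mul_twoOp_pow (X : ℂ ⊗[ℝ] T) (c : T [⋀^Fin 2]→ₗ[ℝ] ℂ) (j : ℕ) :
    contractL T X * twoOp c ^ (j + 1) =
      twoOp c ^ (j + 1) * contractL T X +
        ((j + 1 : ℕ) : ℂ) • (oneOp (interior c X) * twoOp c ^ j) := by
  have h1 : contractL T X * twoOp c = twoOp c * contractL T X + oneOp (interior c X) :=
    LinearMap.ext fun ρ => contract_two_wedge X c ρ
  have hc := commute_twoOp_oneOp c (interior c X)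
  induction j with
  | zero => simpa using h1
  | succ j ih =>
    rw [pow_succ, ← mul_assoc, ih, add_mul, mul_assoc, h1, mul_add, smul_mul_assoc, mul_assoc,
      ← pow_succ, (hc.pow_left (j + 1)).eq, ← mul_assoc, ← pow_succ, add_assoc]
    congr 1
    rw [Nat.cast_succ (j + 1), add_smul, one_smul, add_comm]

/-- Conjugation by `e^c` turns `ι_X` into `ι_X + (ι_X c) ∧`. -/
theorem contractL_mul_expOp (X : ℂ ⊗[ℝ] T) (c : T [⋀^Fin 2]→ₗ[ℝ] ℂ) :
    contractL T X * expOp c =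
      expOp c * (contractL T X + oneOp (interior c X)) := by
  rw [mul_add, (commute_expOp (commute_twoOp_oneOp c (interior c X))).eq]
  nth_rewrite 3 [expOp_eq_sum c]
  rw [expOp, Finset.mul_sum, Finset.sum_mul, Finset.sum_range_succ', Finset.mul_sum,
    Finset.sum_range_succ' (fun j => _ * contractL T X)]
  simp only [mul_smul_comm, smul_mul_assoc, contractL_mul_twoOp_pow, smul_add,
    Finset.sum_add_distrib, smul_smul, pow_zero, one_mul, mul_one]
  rw [add_right_comm]
  congr 1
  refine Finset.sum_congr rfl fun j _ => ?_
  congr 1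
  rw [Nat.factorial_succ]
  push_cast
  have := Nat.cast_ne_zero (R := ℂ).2 j.factorial_ne_zero
  have h2 : (j : ℂ) + 1 ≠ 0 := by exact_mod_cast j.succ_ne_zero
  field_simp

end Exponential

/-! ### Null spaces of the spinors `e^c ∧ γ` -/

section NullSpace
variable {T : Type*} [AddCommGroup T] [Module ℝ T]

theorem clifford_smul (v : GenVec T) (a : ℂ) (ρ : SpinorAt T) :
    clifford v (a • ρ) = a • clifford v ρ := by
  simp only [clifford, ← contractL_apply, ← spinorWedgeL_apply, map_smul, smul_add]

theorem oneForm_smul (a : ℂ) (ξ : T →ₗ[ℝ] ℂ) : oneForm (a • ξ) = a • oneForm ξ := by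
  simp only [oneForm, ← homogeneousL_apply, ← map_smul]
  rfl

theorem isPure_smul {a : ℂ} (ha : a ≠ 0) {ρ : SpinorAt T} (h : IsPure ρ) : IsPure (a • ρ) := by
  obtain ⟨L, hL, h⟩ := h
  refine ⟨L, fun v => ?_, h⟩
  rw [hL, clifford_smul, smul_eq_zero, or_iff_right ha]

theorem hasRealRankZero_smul {a : ℂ} (ha : a ≠ 0) {ρ : SpinorAt T} (h : HasRealRankZero ρ) :
    HasRealRankZero (a • ρ) := by
  intro v h1 h2
  rw [clifford_smul, smul_eq_zero, or_iff_right ha] at h1 h2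
  exact h v h1 h2

/-- Every complex vector is `u + i w` with `u`, `w` real. -/
theorem exists_re_im (X : ℂ ⊗[ℝ] T) : ∃ u w : T, X = (1 : ℂ) ⊗ₜ[ℝ] u + Complex.I ⊗ₜ[ℝ] w := by
  induction X using TensorProduct.induction_on with
  | zero => exact ⟨0, 0, by simp⟩
  | add X Y hX hY =>
    obtain ⟨u, w, rfl⟩ := hX
    obtain ⟨u', w', rfl⟩ := hY
    exact ⟨u + u', w + w', by simp only [TensorProduct.tmul_add]; abel⟩
  | tmul c v =>
    refine ⟨c.re • v, c.im • v, ?_⟩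
    rw [← TensorProduct.smul_tmul, ← TensorProduct.smul_tmul, ← TensorProduct.add_tmul]
    congr 1
    apply Complex.ext <;> simp

variable [FiniteDimensional ℝ T] {c : T [⋀^Fin 2]→ₗ[ℝ] ℂ} {γ : T →ₗ[ℝ] ℂ}

theorem clifford_expOp (v : GenVec T) (c : T [⋀^Fin 2]→ₗ[ℝ] ℂ) (ρ : SpinorAt T) :
    clifford v (expOp c ρ) = expOp c (clifford (v.1, v.2 + interior c v.1) ρ) := by
  have h1 := LinearMap.congr_fun (contractL_mul_expOp v.1 c) ρ
  have h2 := LinearMap.congr_fun (commute_expOp (commute_twoOp_oneOp c v.2)).eq ρ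
  simp only [Module.End.mul_apply] at h1 h2
  simp only [clifford, ← contractL_apply, ← spinorWedgeL_apply]
  rw [h1, ← oneForm, ← oneOp, ← h2, ← map_add]
  congr 1
  change _ = _ + spinorWedgeL T (oneForm (v.2 + interior c v.1)) ρ
  rw [oneForm_add, map_add, LinearMap.add_apply, LinearMap.add_apply]
  abel

/-- The null space of `e^c ∧ γ`, for `γ` a nonzero complex `1`-covector: conjugation by `e^c`
reduces it to the null space of `γ`, which consists of the `(X, ζ)` with `γ(X) = 0` and
`ζ ∈ ℂ γ`. -/
theorem clifford_expOp_oneForm_eq_zero_iff {w : T} (hw : γ w = 1) (v : GenVec T) :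
    clifford v (expOp c (oneForm γ)) = 0 ↔
      evalC γ v.1 = 0 ∧ ∃ a : ℂ, v.2 + interior c v.1 = a • γ := by
  rw [clifford_expOp]
  set ζ := v.2 + interior c v.1
  have hcl : clifford (v.1, ζ) (oneForm γ) =
      evalC γ v.1 • unitSpinor T + spinorWedge (oneForm ζ) (oneForm γ) := by
    rw [clifford, contract_oneForm]
  constructor
  · intro h
    have h := expOp_injective h
    rw [hcl] at h
    have h0 : evalC γ v.1 = 0 := by
      have := congrArg (fun α => α ![]) (congrFun h 0)
      simpa [oneForm_wedge_zero, unitSpinor, homogeneous_apply_self] using this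
    refine ⟨h0, ζ w, ?_⟩
    ext t
    have := congrArg (fun α => α ![t, w]) (congrFun h 2)
    rw [h0, zero_smul, zero_add] at this
    simp only [oneForm_wedge_oneForm_apply] at this
    simp [hw] at this
    rw [LinearMap.smul_apply, smul_eq_mul, ← sub_eq_zero]
    exact this
  · rintro ⟨h0, a, ha⟩
    have h1 : spinorWedge (oneForm γ) (oneForm γ) = 0 := by
      have h := oneForm_wedge_oneForm_comm γ γ
      rw [← add_eq_zero_iff_eq_neg, ← two_smul ℂ, smul_eq_zero] at h
      exact h.resolve_left two_ne_zero
    rw [hcl, h0, ha, zero_smul, zero_add, oneForm_smul, ← spinorWedgeL_apply, map_smul,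
      LinearMap.smul_apply, spinorWedgeL_apply, h1, smul_zero, map_zero]

/-- `e^c ∧ γ` is pure when `γ` is nonzero: its null space is isotropic, and a vector orthogonal to
it already lies in it. -/
theorem isPure_expOp_oneForm {w : T} (hw : γ w = 1) : IsPure (expOp c (oneForm γ)) := by
  let L : Submodule ℂ (GenVec T) :=
    { carrier := {v | evalC γ v.1 = 0 ∧ ∃ a : ℂ, v.2 + interior c v.1 = a • γ}
      add_mem' := by
        rintro v v' ⟨h, a, ha⟩ ⟨h', a', ha'⟩
        refine ⟨?_, a + a', ?_⟩
        · rw [evalC] at h h' ⊢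
          rw [Prod.fst_add, map_add, h, h', add_zero]
        · rw [Prod.fst_add, Prod.snd_add, map_add, add_smul, ← ha, ← ha']; abel
      zero_mem' := ⟨by simp, 0, by simp⟩
      smul_mem' := by
        rintro b v ⟨h, a, ha⟩
        refine ⟨?_, b * a, ?_⟩
        · rw [evalC] at h ⊢
          rw [Prod.smul_fst, map_smul, h, smul_zero]
        · rw [Prod.smul_fst, Prod.smul_snd, map_smul, ← smul_add, ha, smul_smul] }
  have mem_L : ∀ v, v ∈ L ↔ evalC γ v.1 = 0 ∧ ∃ a : ℂ, v.2 + interior c v.1 = a • γ :=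
    fun _ => Iff.rfl
  refine ⟨L, fun v => (clifford_expOp_oneForm_eq_zero_iff hw v).symm, ?_, ?_⟩
  · rintro v ⟨h, a, ha⟩ v' ⟨h', a', ha'⟩
    rw [← eq_sub_iff_add_eq, sub_eq_add_neg, ← neg_one_smul ℂ (interior c _)] at ha ha'
    have e1 : evalC v.2 v'.1 = - evalC (interior c v.1) v'.1 := by
      rw [ha, evalC_add, evalC_smul, evalC_smul, h']; ring
    have e2 : evalC v'.2 v.1 = - evalC (interior c v'.1) v.1 := by
      rw [ha', evalC_add, evalC_smul, evalC_smul, h]; ring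
    rw [pairing]
    change (evalC v.2 v'.1 + evalC v'.2 v.1) / 2 = 0
    rw [e1, e2, evalC_interior_swap]
    ring
  · refine fun L' hL' hle => le_antisymm (fun v hv => ?_) hle
    have pair : ∀ v' ∈ L, evalC v.2 v'.1 + evalC v'.2 v.1 = 0 := fun v' hv' => by
      have := hL' v hv v' (hle hv')
      rw [pairing, div_eq_zero_iff, or_iff_left two_ne_zero] at this
      exact this
    refine ⟨?_, (v.2 + interior c v.1) w, ?_⟩
    · simpa using pair (0, γ) ⟨by simp, 1, by simp⟩
    · ext t
      -- `t - γ(t) w` spans the kernel of `γ` as `t` varies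
      let Y : ℂ ⊗[ℝ] T := 1 ⊗ₜ t - γ t ⊗ₜ w
      have hY : (Y, -interior c Y) ∈ L := ⟨by simp [Y, evalC, hw], 0, by simp⟩
      have := pair _ hY
      have e : evalC (-interior c Y) v.1 = evalC (interior c v.1) Y := by
        rw [evalC_interior_swap c v.1, ← neg_one_smul ℂ, evalC_smul]; ring
      simp only [e] at this
      rw [← evalC_add] at this
      simp only [evalC, Y, map_sub, LinearMap.liftBaseChange_tmul, smul_eq_mul] at this
      rw [LinearMap.smul_apply, smul_eq_mul]
      linear_combination this

/-- `e^{i Ω} ∧ γ` has real rank zero when `γ` is onto `ℂ` and `Ω` is nondegenerate on the real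
kernel of `γ`. -/
theorem hasRealRankZero_expOp_oneForm {Ω : T [⋀^Fin 2]→ₗ[ℝ] ℝ} {w w' : T} (hw : γ w = 1)
    (hw' : γ w' = Complex.I)
    (hΩ : ∀ u, γ u = 0 → (∀ t, γ t = 0 → Ω ![u, t] = 0) → u = 0) :
    HasRealRankZero (expOp (Complex.I • complexify Ω) (oneForm γ)) := by
  rintro ⟨X, ξ⟩ h1 h2
  rw [clifford_expOp_oneForm_eq_zero_iff hw] at h1 h2
  obtain ⟨u, u', rfl⟩ := exists_re_im X
  obtain ⟨h1, a, ha⟩ := h1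
  obtain ⟨h2, b, hb⟩ := h2
  simp only [conjGen, map_add, evalC, LinearMap.rTensor_tmul, LinearMap.liftBaseChange_tmul,
    AlgEquiv.toLinearMap_apply, Complex.conjAe_coe, map_one, Complex.conj_I,
    smul_eq_mul, one_mul] at h1 h2 hb ha
  have hu : γ u = 0 := by linear_combination (h1 + h2) / 2
  have hu' : γ u' = 0 := by
    have : Complex.I * γ u' = 0 := by linear_combination (h1 - h2) / 2
    simpa using this
  -- on `ker γ` both `ξ + i ι_X Ω` and its conjugate counterpart `ξ - i ι_X Ω` vanish
  have key : ∀ t, γ t = 0 → Ω ![u, t] = 0 ∧ Ω ![u', t] = 0 := by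
    intro t ht
    have e1 := LinearMap.congr_fun ha t
    have e2 := LinearMap.congr_fun hb t
    simp only [LinearMap.add_apply, interior_tmul, LinearMap.smul_apply, ht,
      AlternatingMap.smul_apply, complexify, LinearMap.compAlternatingMap_apply,
      LinearMap.comp_apply, AlgEquiv.toLinearMap_apply, Complex.conjAe_coe, smul_eq_mul] at e1 e2
    have e3 := congrArg (starRingEnd ℂ) e2
    simp at e1 e3
    have e4 : ((Ω ![u, t] : ℝ) : ℂ) + Complex.I * (Ω ![u', t] : ℝ) = 0 := by
      have : Complex.I * (((Ω ![u, t] : ℝ) : ℂ) + Complex.I * (Ω ![u', t] : ℝ)) = 0 := by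
        linear_combination (e1 - e3) / 2
      simpa using this
    exact ⟨by simpa using congrArg Complex.re e4, by simpa using congrArg Complex.im e4⟩
  have hu0 : u = 0 := hΩ u hu fun t ht => (key t ht).1
  have hu0' : u' = 0 := hΩ u' hu' fun t ht => (key t ht).2
  subst hu0 hu0'
  -- now `ξ = a γ` and `conj ξ = b γ`; evaluation on `w` and `w'` forces `a = b = 0`
  simp only [TensorProduct.tmul_zero, map_zero, add_zero] at ha hb ⊢
  have e1 := LinearMap.congr_fun hb w
  have e2 := LinearMap.congr_fun hb w'
  simp [ha, hw, hw'] at e1 e2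
  have ha0 : a = 0 := by
    have : b = 0 := by
      have : Complex.I * b = 0 := by linear_combination (-e2 - Complex.I * e1) / 2
      simpa using this
    simpa [this] using e1
  rw [ha, ha0, zero_smul]
  rfl

end NullSpace

/-! ### Pullback of spinors -/

section Naturality
variable {T T' : Type*} [AddCommGroup T] [Module ℝ T] [AddCommGroup T'] [Module ℝ T']

theorem wedge_compLinearMap {k l : ℕ} (α : T [⋀^Fin k]→ₗ[ℝ] ℂ) (β : T [⋀^Fin l]→ₗ[ℝ] ℂ)
    (f : T' →ₗ[ℝ] T) :
    (wedge α β).compLinearMap f = wedge (α.compLinearMap f) (β.compLinearMap f) := by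
  ext v
  simp only [wedge, AlternatingMap.domDomCongr_apply, LinearMap.compAlternatingMap_apply,
    AlternatingMap.compLinearMap_apply,
    AlternatingMap.domCoprod_apply, sum_apply, map_sum]
  refine Finset.sum_congr rfl fun σ _ => ?_
  induction σ using Quotient.inductionOn' with | _ σ
  rcases Int.units_eq_one_or (Equiv.Perm.sign σ) with h | h <;>
    simp [AlternatingMap.domCoprod.summand, h, Function.comp_def]

/-- Pullback of complex covectors of degree `n`, as an additive map. -/
def compLinearMapHom (f : T' →ₗ[ℝ] T) (n : ℕ) :
    (T [⋀^Fin n]→ₗ[ℝ] ℂ) →+ (T' [⋀^Fin n]→ₗ[ℝ] ℂ) where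
  toFun α := α.compLinearMap f
  map_zero' := rfl
  map_add' _ _ := rfl

/-- Pullback of mixed-degree covectors. -/
def spinorPullback (f : T' →ₗ[ℝ] T) (ρ : SpinorAt T) : SpinorAt T' := fun k =>
  (ρ k).compLinearMap f

theorem spinorPullback_wedge (f : T' →ₗ[ℝ] T) (ρ τ : SpinorAt T) :
    spinorPullback f (spinorWedge ρ τ) =
      spinorWedge (spinorPullback f ρ) (spinorPullback f τ) := by
  funext n
  simp only [spinorPullback, spinorWedge, ← wedge_compLinearMap]
  exact map_sum (compLinearMapHom f n) _ _

theorem spinorPullback_homogeneous (f : T' →ₗ[ℝ] T) {k : ℕ} (α : T [⋀^Fin k]→ₗ[ℝ] ℂ) :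
    spinorPullback f (homogeneous α) = homogeneous (α.compLinearMap f) := by
  funext n
  by_cases h : n = k
  · subst h
    rw [spinorPullback, homogeneous_apply_self, homogeneous_apply_self]
  · rw [spinorPullback, homogeneous_apply_ne h, homogeneous_apply_ne h]
    rfl

theorem spinorPullback_expTwo (f : T' →ₗ[ℝ] T) (c : T [⋀^Fin 2]→ₗ[ℝ] ℂ) :
    spinorPullback f (expTwo c) = expTwo (c.compLinearMap f) := by
  have h : ∀ j, spinorPullback f (wedgePow (homogeneous c) j) =
      wedgePow (homogeneous (c.compLinearMap f)) j := by
    intro j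
    induction j with
    | zero =>
      rw [wedgePow, spinorPullback_homogeneous]
      rfl
    | succ j ih => rw [wedgePow, spinorPullback_wedge, ih, spinorPullback_homogeneous, wedgePow]
  funext n
  simp only [expTwo, ← h]
  exact map_sum (compLinearMapHom f n) _ _

end Naturality

open Topology Set

/-! ### Manifolds covered by a vector space -/

section Cover
variable {𝕜 : Type*} [NontriviallyNormedField 𝕜] {E : Type*} [NormedAddCommGroup E]
  [NormedSpace 𝕜 E] {X : Type*} [TopologicalSpace X] {ι : Type*}

/-- The manifold structure on the base of a surjective local homeomorphism `Q` from a normed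
space: the charts are all the local inverses of `Q`. -/
@[reducible]
def coverChartedSpace {Q : E → X} (hQ : IsLocalHomeomorph Q) (hs : Function.Surjective Q) :
    ChartedSpace E X where
  atlas := {e | ∀ y ∈ e.target, e.symm y = Q y}
  chartAt x := hQ.localInverseAt (Function.surjInv hs x)
  mem_chart_source x := by
    have := hQ.apply_self_mem_localInverseAt_source (x := Function.surjInv hs x)
    rwa [Function.surjInv_eq hs x] at this
  chart_mem_atlas x := by
    intro y _
    rw [IsLocalHomeomorph.localInverseAt_symm]

/-- `Q : E → X` presents the manifold `X` as the quotient of the normed space `E` by the affine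
maps `y ↦ L i y + v i`, and the charts of `X` are the local inverses of `Q`. -/
structure IsAffineCover [ChartedSpace E X] (L : ι → E →L[𝕜] E) (v : ι → E) (Q : E → X) : Prop where
  surjective : Function.Surjective Q
  isLocalHomeomorph : IsLocalHomeomorph Q
  eq_iff : ∀ a b, Q a = Q b ↔ ∃ i, b = L i a + v i
  mem_atlas : ∀ e : OpenPartialHomeomorph X E, e ∈ atlas E X ↔ ∀ y ∈ e.target, e.symm y = Q y

namespace IsAffineCover
variable [ChartedSpace E X] {L : ι → E →L[𝕜] E} {v : ι → E} {Q : E → X}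
  (h : IsAffineCover L v Q)
include h

theorem apply_deck (i : ι) (a : E) : Q (L i a + v i) = Q a :=
  ((h.eq_iff a _).2 ⟨i, rfl⟩).symm

theorem continuous : Continuous Q := h.isLocalHomeomorph.continuous

/-- A continuous germ over `Q` is the germ of a deck transformation. -/
theorem eventuallyEq_deck {φ : E → E} {a : E} (hφ : ContinuousAt φ a)
    (hQ : ∀ᶠ y in 𝓝 a, Q (φ y) = Q y) : ∃ i, φ =ᶠ[𝓝 a] fun y => L i y + v i := by
  obtain ⟨i, hi⟩ := (h.eq_iff a (φ a)).1 hQ.self_of_nhds.symm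
  refine ⟨i, ?_⟩
  obtain ⟨U, hU, haU, hinj⟩ := h.isLocalHomeomorph.isLocallyInjective (φ a)
  have hc : ContinuousAt (fun y => L i y + v i) a := by fun_prop
  have hi' : φ a = (fun y => L i y + v i) a := hi
  filter_upwards [hQ, hφ (hU.mem_nhds haU), hc (hU.mem_nhds (hi' ▸ haU))] with y h1 h2 h3
  exact hinj h2 h3 (h1.trans (h.apply_deck i y).symm)

theorem apply_of_mem_atlas {e : OpenPartialHomeomorph X E} (he : e ∈ atlas E X) {x : X}
    (hx : x ∈ e.source) : Q (e x) = x := by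
  rw [← (h.mem_atlas e).1 he _ (e.map_source hx), e.left_inv hx]

theorem apply_chartAt_self (x : X) : Q (chartAt E x x) = x :=
  h.apply_of_mem_atlas (chart_mem_atlas E x) (mem_chart_source E x)

/-- The local inverse of `Q` near `a` is a chart. -/
theorem exists_chart (a : E) : ∃ e ∈ atlas E X, Q a ∈ e.source ∧ e (Q a) = a :=
  ⟨h.isLocalHomeomorph.localInverseAt a, (h.mem_atlas _).2 fun y _ => by simp, by simp, by simp⟩

theorem isManifold : IsManifold 𝓘(𝕜, E) ∞ X := by
  refine isManifold_of_contDiffOn _ _ _ fun e e' he he' => ?_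
  intro y hy
  simp only [modelWithCornersSelf_coe, modelWithCornersSelf_coe_symm, Function.id_comp,
    Function.comp_id, range_id, inter_univ, preimage_id_eq, id_eq] at hy ⊢
  have hopen := (e.symm.trans e').open_source
  obtain ⟨i, hi⟩ := h.eventuallyEq_deck (φ := e.symm.trans e')
    ((e.symm.trans e').continuousAt hy) <| by
      filter_upwards [hopen.mem_nhds hy] with z hz
      rw [OpenPartialHomeomorph.trans_source] at hz
      rw [OpenPartialHomeomorph.coe_trans, Function.comp_apply,
        h.apply_of_mem_atlas he' hz.2, (h.mem_atlas e).1 he z hz.1]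
  have : ContDiffAt 𝕜 ∞ (fun y => L i y + v i) y :=
    ((L i).contDiff.add contDiff_const).contDiffAt
  exact (this.congr_of_eventuallyEq hi).contDiffWithinAt

theorem mem_maximalAtlas {e : OpenPartialHomeomorph X E} (he : e ∈ atlas E X) :
    e ∈ IsManifold.maximalAtlas 𝓘(𝕜, E) ∞ X :=
  haveI := h.isManifold
  IsManifold.subset_maximalAtlas he

theorem isLocalDiffeomorph : IsLocalDiffeomorph 𝓘(𝕜, E) 𝓘(𝕜, E) ∞ Q := by
  intro a
  obtain ⟨e, he, ha, hea⟩ := h.exists_chart a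
  refine ⟨{ e.symm.toPartialEquiv with
    open_source := e.open_target
    open_target := e.open_source
    contMDiffOn_toFun := contMDiffOn_symm_of_mem_maximalAtlas (h.mem_maximalAtlas he)
    contMDiffOn_invFun := contMDiffOn_of_mem_maximalAtlas (h.mem_maximalAtlas he) }, ?_, ?_⟩
  · change a ∈ e.target
    rw [← hea]
    exact e.map_source ha
  · intro y hy
    exact ((h.mem_atlas e).1 he y hy).symm

theorem contMDiff : ContMDiff 𝓘(𝕜, E) 𝓘(𝕜, E) ∞ Q := h.isLocalDiffeomorph.contMDiff

/-- A map out of `X` is smooth at `Q a` as soon as its lift is smooth at `a`. -/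
theorem contMDiffAt_of_comp {E' H' N : Type*} [NormedAddCommGroup E'] [NormedSpace 𝕜 E']
    [TopologicalSpace H'] {I' : ModelWithCorners 𝕜 E' H'} [TopologicalSpace N] [ChartedSpace H' N]
    {f : X → N} {a : E} (hf : ContMDiffAt 𝓘(𝕜, E) I' ∞ (f ∘ Q) a) :
    ContMDiffAt 𝓘(𝕜, E) I' ∞ f (Q a) := by
  obtain ⟨e, he, ha, hea⟩ := h.exists_chart a
  have h1 : ContMDiffAt 𝓘(𝕜, E) 𝓘(𝕜, E) ∞ e (Q a) :=
    contMDiffAt_of_mem_maximalAtlas (h.mem_maximalAtlas he) ha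
  rw [← hea] at hf
  refine (hf.comp (Q a) h1).congr_of_eventuallyEq ?_
  filter_upwards [e.open_source.mem_nhds ha] with x hx
  rw [Function.comp_apply, Function.comp_apply, h.apply_of_mem_atlas he hx]

/-- The preferred chart at `Q y`, composed with `Q`, is near `y` a deck transformation. -/
theorem exists_chartAt_comp (y : E) :
    ∃ i, chartAt E (Q y) (Q y) = L i y + v i ∧
      (chartAt E (Q y) ∘ Q) =ᶠ[𝓝 y] fun z => L i z + v i := by
  have hs := mem_chart_source E (Q y)
  obtain ⟨i, hi⟩ := h.eventuallyEq_deck (φ := chartAt E (Q y) ∘ Q) (a := y)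
    (((chartAt E (Q y)).continuousAt hs).comp h.continuous.continuousAt) <| by
      filter_upwards [h.continuous.continuousAt ((chartAt E (Q y)).open_source.mem_nhds hs)]
        with z hz
      exact h.apply_of_mem_atlas (chart_mem_atlas E _) hz
  exact ⟨i, hi.self_of_nhds, hi⟩

end IsAffineCover
end Cover

/-! ### Differential forms on a manifold covered by a vector space -/

section RealCover
variable {E : Type*} [NormedAddCommGroup E]
  [NormedSpace ℝ E] {X : Type*} [TopologicalSpace X] {ι : Type*} [ChartedSpace E X]
  {L : ι → E →L[ℝ] E} {v : ι → E} {Q : E → X}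
  {F : Type*} [NormedAddCommGroup F] [NormedSpace ℝ F] {k : ℕ}
  {E' M : Type*} [NormedAddCommGroup E'] [NormedSpace ℝ E'] [TopologicalSpace M] [ChartedSpace E' M]

theorem diffAt_comp {E₁ E₂ E₃ M₁ M₂ M₃ : Type*} [NormedAddCommGroup E₁] [NormedSpace ℝ E₁]
    [NormedAddCommGroup E₂] [NormedSpace ℝ E₂] [NormedAddCommGroup E₃] [NormedSpace ℝ E₃]
    [TopologicalSpace M₁] [ChartedSpace E₁ M₁] [TopologicalSpace M₂] [ChartedSpace E₂ M₂]
    [TopologicalSpace M₃] [ChartedSpace E₃ M₃] {g : M₂ → M₃} {f : M₁ → M₂} {x : M₁}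
    (hg : MDifferentiableAt 𝓘(ℝ, E₂) 𝓘(ℝ, E₃) g (f x))
    (hf : MDifferentiableAt 𝓘(ℝ, E₁) 𝓘(ℝ, E₂) f x) :
    diffAt E₁ E₃ (g ∘ f) x = (diffAt E₂ E₃ g (f x)).comp (diffAt E₁ E₂ f x) :=
  mfderiv_comp x hg hf

theorem diffAt_congr {f g : X → M} {x : X} (hfg : f =ᶠ[𝓝 x] g) :
    diffAt E E' f x = diffAt E E' g x :=
  hfg.mfderiv_eq

theorem diffAt_eq_fderiv (f : E → E') (x : E) : diffAt E E' f x = fderiv ℝ f x :=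
  mfderiv_eq_fderiv

namespace IsAffineCover
variable (h : IsAffineCover L v Q)
include h

theorem mdifferentiableAt (y : E) : MDifferentiableAt 𝓘(ℝ, E) 𝓘(ℝ, E) Q y :=
  h.contMDiff.contMDiffAt.mdifferentiableAt (by simp)

/-- The tangent space of `X` is identified with `E` through the preferred chart, in which the
differential of `Q` is the linear part of a deck transformation. -/
theorem exists_diffAt (y : E) :
    ∃ i, chartAt E (Q y) (Q y) = L i y + v i ∧ diffAt E E Q y = L i := by
  obtain ⟨i, hi, hi'⟩ := h.exists_chartAt_comp y
  refine ⟨i, hi, ?_⟩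
  rw [diffAt, (h.mdifferentiableAt y).mfderiv]
  simp only [writtenInExtChartAt, extChartAt, OpenPartialHomeomorph.extend,
    modelWithCornersSelf_partialEquiv, PartialEquiv.trans_refl,
    OpenPartialHomeomorph.toFun_eq_coe, modelWithCornersSelf_coe, range_id, fderivWithin_univ,
    chartAt_self_eq, OpenPartialHomeomorph.refl_partialEquiv, PartialEquiv.refl_coe,
    PartialEquiv.refl_symm, Function.comp_id, id_eq]
  rw [hi'.fderiv_eq]
  simp

theorem diffAt_chart (x : X) : diffAt E E Q (chartAt E x x) = ContinuousLinearMap.id ℝ E := by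
  have hx := h.apply_chartAt_self x
  rw [diffAt, (h.mdifferentiableAt _).mfderiv]
  simp only [writtenInExtChartAt, extChartAt, OpenPartialHomeomorph.extend,
    modelWithCornersSelf_partialEquiv, PartialEquiv.trans_refl,
    OpenPartialHomeomorph.toFun_eq_coe, modelWithCornersSelf_coe, range_id, fderivWithin_univ,
    chartAt_self_eq, OpenPartialHomeomorph.refl_partialEquiv, PartialEquiv.refl_coe,
    PartialEquiv.refl_symm, Function.comp_id, id_eq, hx]
  have : (chartAt E x ∘ Q) =ᶠ[𝓝 (chartAt E x x)] id := by
    filter_upwards [(chartAt E x).open_target.mem_nhds (mem_chart_target E x)] with z hz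
    rw [Function.comp_apply, ← (h.mem_atlas _).1 (chart_mem_atlas E x) z hz,
      (chartAt E x).right_inv hz, id]
  rw [this.fderiv_eq]
  exact fderiv_id

theorem diffAt_chartAt_self (x : X) :
    diffAt E E (chartAt E x) x = ContinuousLinearMap.id ℝ E := by
  have hx := h.apply_chartAt_self x
  have := h.isManifold
  have h1 : MDifferentiableAt 𝓘(ℝ, E) 𝓘(ℝ, E) (chartAt E x) (Q (chartAt E x x)) := by
    rw [hx]
    exact (contMDiffAt_of_mem_maximalAtlas (h.mem_maximalAtlas (chart_mem_atlas E x))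
      (mem_chart_source E x)).mdifferentiableAt (n := ∞) (by simp)
  have h2 := diffAt_comp h1 (h.mdifferentiableAt _)
  have : (chartAt E x ∘ Q) =ᶠ[𝓝 (chartAt E x x)] id := by
    filter_upwards [(chartAt E x).open_target.mem_nhds (mem_chart_target E x)] with z hz
    rw [Function.comp_apply, ← (h.mem_atlas _).1 (chart_mem_atlas E x) z hz,
      (chartAt E x).right_inv hz, id]
  rw [diffAt_congr this, h.diffAt_chart, ContinuousLinearMap.comp_id, hx, diffAt_eq_fderiv,
    fderiv_id] at h2
  exact h2.symm

/-- The differential of a map out of `X`, in terms of its lift. -/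
theorem diffAt_of_lift {f : X → M} {x : X} {g : E → M} (hg : f ∘ Q = g)
    (hf : MDifferentiableAt 𝓘(ℝ, E) 𝓘(ℝ, E') f x) :
    diffAt E E' f x = diffAt E E' g (chartAt E x x) := by
  have hx := h.apply_chartAt_self x
  have h2 := diffAt_comp (f := Q) (x := chartAt E x x) (g := f) (by rwa [hx])
    (h.mdifferentiableAt _)
  rw [h.diffAt_chart, ContinuousLinearMap.comp_id, hx, hg] at h2
  exact h2.symm

theorem inChart_eq (α : Form E X F k) (c : X) {y : E} (hy : y ∈ (chartAt E c).target) :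
    inChart α c y = pullback Q α y := by
  have hs : ∀ z ∈ (chartAt E c).target, (chartAt E c).symm z = Q z :=
    (h.mem_atlas _).1 (chart_mem_atlas E c)
  have : (chartAt E c).symm =ᶠ[𝓝 y] Q := by
    filter_upwards [(chartAt E c).open_target.mem_nhds hy] with z hz using hs z hz
  rw [inChart, pullback, pullback, diffAt_congr this, hs y hy]

/-- The lift of a form is invariant under deck transformations. -/
theorem pullback_deck (α : Form E X F k) (i : ι) (y : E) :
    (pullback Q α (L i y + v i)).compContinuousLinearMap (L i) = pullback Q α y := by
  have hd : HasFDerivAt (fun z => L i z + v i) (L i) y := (L i).hasFDerivAt.add_const _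
  have h2 := diffAt_comp (f := fun z => L i z + v i) (x := y) (g := Q) (h.mdifferentiableAt _)
    hd.differentiableAt.mdifferentiableAt
  rw [diffAt_eq_fderiv, hd.fderiv] at h2
  have h3 : Q ∘ (fun z => L i z + v i) = Q := funext fun z => h.apply_deck i z
  rw [h3] at h2
  rw [pullback, pullback, h2, h.apply_deck]
  rfl

/-- Forms on `E` invariant under the deck transformations descend to `X`. -/
theorem pullback_descend {β : E → E [⋀^Fin k]→L[ℝ] F}
    (hβ : ∀ i y, (β (L i y + v i)).compContinuousLinearMap (L i) = β y) :
    pullback Q (fun x => β (chartAt E x x)) = β := by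
  funext y
  obtain ⟨i, hi, hi'⟩ := h.exists_diffAt y
  rw [pullback, hi', hi, hβ]

/-- The exterior derivative can be computed on the lift. -/
theorem extD_apply (α : Form E X F k) (x : X) :
    extD α x = extDeriv (pullback Q α) (chartAt E x x) := by
  have : inChart α x =ᶠ[𝓝 (chartAt E x x)] pullback Q α := by
    filter_upwards [(chartAt E x).open_target.mem_nhds (mem_chart_target E x)] with y hy
    exact h.inChart_eq α x hy
  rw [extD, h.diffAt_chartAt_self, this.extDeriv_eq]
  rfl

theorem smoothFormOn_of_pullback {α : Form E X F k} {U : Set X}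
    (hα : ContDiffOn ℝ ∞ (pullback (E := E) (E' := E) Q α) (Q ⁻¹' U)) : SmoothFormOn α U := by
  intro c
  have hs : ∀ z ∈ (chartAt E c).target, (chartAt E c).symm z = Q z :=
    (h.mem_atlas _).1 (chart_mem_atlas E c)
  refine (hα.mono ?_).congr fun y hy => h.inChart_eq α c hy.1
  intro y hy
  rw [mem_preimage, ← hs y hy.1]
  exact hy.2

theorem contDiffAt_pullback {α : Form E X F k} {U : Set X} (hU : IsOpen U)
    (hα : SmoothFormOn α U) {y : E} (hy : Q y ∈ U) :
    ContDiffAt ℝ ∞ (pullback (E := E) (E' := E) Q α) y := by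
  obtain ⟨i, hi, -⟩ := h.exists_chartAt_comp y
  set c := Q y with hc
  have hs : ∀ z ∈ (chartAt E c).target, (chartAt E c).symm z = Q z :=
    (h.mem_atlas _).1 (chart_mem_atlas E c)
  have h1 : ContDiffAt ℝ ∞ (pullback (E := E) (E' := E) Q α) (chartAt E c c) := by
    have hmem : chartAt E c c ∈ (chartAt E c).target ∩ (chartAt E c).symm ⁻¹' U :=
      ⟨mem_chart_target E c, by rw [mem_preimage, (chartAt E c).left_inv (mem_chart_source E c)]
                                exact hy⟩
    have h2 := (hα c).contDiffAt
      (((chartAt E c).symm.isOpen_inter_preimage hU).mem_nhds hmem)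
    refine h2.congr_of_eventuallyEq ?_
    filter_upwards [(chartAt E c).open_target.mem_nhds (mem_chart_target E c)] with z hz
    exact (h.inChart_eq α c hz).symm
  have h3 : pullback Q α = fun z => ContinuousAlternatingMap.compContinuousLinearMapCLM (L i)
      (pullback Q α (L i z + v i)) := funext fun z => (h.pullback_deck α i z).symm
  rw [h3]
  rw [hi] at h1
  have h4 : ContDiffAt ℝ ∞ (fun z => L i z + v i) y :=
    ((L i).contDiff.add contDiff_const).contDiffAt
  have h5 : ContDiffAt ℝ ∞ (fun z => pullback Q α (L i z + v i)) y :=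
    ContDiffAt.comp (f := fun z => L i z + v i) y h1 h4
  exact (ContinuousLinearMap.contDiff _).contDiffAt.comp y h5

end IsAffineCover
end RealCover

/-! ### Topology of quotients by affine maps -/

section Quotients
variable {𝕜 : Type*} [NontriviallyNormedField 𝕜] {E : Type*} [NormedAddCommGroup E]
  [NormedSpace 𝕜 E] {ι : Type*} {L : ι → E →L[𝕜] E} {v : ι → E} {s : Setoid E}

theorem isOpenQuotientMap_mk (hs : ∀ a b, s a b ↔ ∃ i, b = L i a + v i) :
    IsOpenQuotientMap (Quotient.mk s) := by
  refine ⟨Quotient.mk_surjective, continuous_quotient_mk', fun U hU => ?_⟩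
  have : Quotient.mk s ⁻¹' (Quotient.mk s '' U) = ⋃ i, (fun y => L i y + v i) ⁻¹' U := by
    ext b
    simp only [mem_preimage, mem_image, mem_iUnion]
    constructor
    · rintro ⟨a, ha, hab⟩
      obtain ⟨i, rfl⟩ := (hs b a).1 (Quotient.exact hab.symm)
      exact ⟨i, ha⟩
    · rintro ⟨i, hi⟩
      exact ⟨_, hi, Quotient.sound (s.symm ((hs b _).2 ⟨i, rfl⟩))⟩
  rw [← isQuotientMap_quotient_mk'.isOpen_preimage]
  change IsOpen (Quotient.mk s ⁻¹' (Quotient.mk s '' U))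
  rw [this]
  exact isOpen_iUnion fun i => hU.preimage (by fun_prop)

/-- If the maps `y ↦ L i y + v i` move every point either not at all or by at least `ε`, the
quotient map is a local homeomorphism. -/
theorem isLocalHomeomorph_mk (hs : ∀ a b, s a b ↔ ∃ i, b = L i a + v i) {ε : ℝ} (hε : 0 < ε)
    (hsep : ∀ i a, ‖L i a + v i - a‖ < ε → L i a + v i = a) :
    IsLocalHomeomorph (Quotient.mk s) := by
  have hq := isOpenQuotientMap_mk hs
  refine isLocalHomeomorph_iff_isOpenEmbedding_restrict.2 fun a =>
    ⟨Metric.ball a (ε / 2), Metric.ball_mem_nhds a (half_pos hε),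
      .of_continuous_injective_isOpenMap (hq.continuous.comp continuous_subtype_val) ?_
        (hq.isOpenMap.comp Metric.isOpen_ball.isOpenMap_subtype_val)⟩
  rintro ⟨x, hx⟩ ⟨y, hy⟩ hxy
  obtain ⟨i, rfl⟩ := (hs x y).1 (Quotient.exact hxy)
  refine Subtype.ext (hsep i x ?_).symm
  rw [← dist_eq_norm]
  calc dist (L i x + v i) x ≤ dist (L i x + v i) a + dist x a := dist_triangle_right _ _ _
    _ < ε / 2 + ε / 2 := add_lt_add hy hx
    _ = ε := add_halves ε

theorem t2Space_quotient (hs : ∀ a b, s a b ↔ ∃ i, b = L i a + v i)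
    (hc : IsClosed {q : E × E | ∃ i, q.2 = L i q.1 + v i}) : T2Space (Quotient s) := by
  rw [t2Space_iff_of_isOpenQuotientMap (isOpenQuotientMap_mk hs)]
  convert hc using 1
  ext q
  rw [mem_ofPred_eq, mem_ofPred_eq, ← hs]
  exact Quotient.eq

theorem compactSpace_quotient (hs : ∀ a b, s a b ↔ ∃ i, b = L i a + v i) {K : Set E}
    (hK : IsCompact K) (h : ∀ a, ∃ i, L i a + v i ∈ K) : CompactSpace (Quotient s) := by
  refine ⟨?_⟩
  convert hK.image (continuous_quotient_mk' (s := s))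
  refine (eq_univ_of_forall fun x => ?_).symm
  induction x using Quotient.inductionOn with | _ a
  obtain ⟨i, hi⟩ := h a
  exact ⟨_, hi, Quotient.sound (s.symm ((hs _ _).2 ⟨i, rfl⟩))⟩

theorem connectedSpace_quotient [NormedSpace ℝ E] : ConnectedSpace (Quotient s) :=
  Quotient.mk_surjective.connectedSpace continuous_quotient_mk'

theorem isAffineCover_mk (hs : ∀ a b, s a b ↔ ∃ i, b = L i a + v i)
    (hl : IsLocalHomeomorph (Quotient.mk s)) :
    @IsAffineCover 𝕜 _ E _ _ (Quotient s) _ ι (coverChartedSpace hl Quotient.mk_surjective) L v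
      (Quotient.mk s) :=
  letI := coverChartedSpace hl Quotient.mk_surjective
  { surjective := Quotient.mk_surjective
    isLocalHomeomorph := hl
    eq_iff := fun a b => by rw [← hs]; exact Quotient.eq
    mem_atlas := fun _ => Iff.rfl }

end Quotients

/-! ### The two tori -/

/-- The space `ℝ⁴`; the forms `θ₁, …, θ₄` are its coordinates `0, …, 3`. -/
abbrev E4 : Type := EuclideanSpace ℝ (Fin 4)

/-- A vector with integral coordinates. -/
def intVec (n : Fin 4 → ℤ) : E4 := WithLp.toLp 2 fun i => (n i : ℝ)

@[simp] theorem intVec_apply (n : Fin 4 → ℤ) (i : Fin 4) : intVec n i = n i := rfl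

/-- The Gaussian integer `m + n i`. -/
def gauss (m : ℤ × ℤ) : ℂ := m.1 + m.2 * Complex.I

@[simp] theorem gauss_re (m : ℤ × ℤ) : (gauss m).re = m.1 := by simp [gauss]
@[simp] theorem gauss_im (m : ℤ × ℤ) : (gauss m).im = m.2 := by simp [gauss]

/-- Congruence modulo `ℤ⁴`. -/
def torusSetoid : Setoid E4 where
  r a b := ∃ n, b = ContinuousLinearMap.id ℝ E4 a + intVec n
  iseqv :=
    { refl := fun a => ⟨0, by ext i; simp⟩
      symm := by
        rintro a b ⟨n, rfl⟩
        exact ⟨-n, by ext i; simp⟩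
      trans := by
        rintro a b c ⟨n, rfl⟩ ⟨m, rfl⟩
        exact ⟨n + m, by ext i; simp [add_assoc]⟩ }

/-- The torus `ℝ⁴ / ℤ⁴`. -/
def Torus : Type := Quotient torusSetoid

/-- The quotient map `ℝ⁴ → T⁴`. -/
def toTorus : E4 → Torus := Quotient.mk torusSetoid

theorem abs_int_lt_one {n : ℤ} (h : |(n : ℝ)| < 1) : n = 0 := by
  rw [← Int.abs_lt_one_iff]
  exact_mod_cast h

theorem abs_apply_le_norm (a : E4) (i : Fin 4) : |a i| ≤ ‖a‖ := by
  simpa using PiLp.norm_apply_le a i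

instance : TopologicalSpace Torus := inferInstanceAs (TopologicalSpace (Quotient torusSetoid))

theorem isLocalHomeomorph_toTorus : IsLocalHomeomorph toTorus := by
  refine isLocalHomeomorph_mk (s := torusSetoid) (L := fun _ => .id ℝ E4) (v := intVec)
    (fun _ _ => Iff.rfl) zero_lt_one fun n a h => ?_
  have : n = 0 := by
    ext i
    refine abs_int_lt_one ((abs_apply_le_norm (intVec n) i).trans_lt ?_)
    simpa using h
  subst this
  ext i; simp

instance : ChartedSpace E4 Torus :=
  coverChartedSpace isLocalHomeomorph_toTorus Quotient.mk_surjective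

theorem torusCover : IsAffineCover (fun _ => .id ℝ E4) intVec toTorus :=
  isAffineCover_mk (fun _ _ => Iff.rfl) isLocalHomeomorph_toTorus

theorem isClosed_range_int : IsClosed (range ((↑) : ℤ → ℝ)) :=
  Int.isClosedEmbedding_coe_real.isClosed_range

instance : T2Space Torus := by
  refine t2Space_quotient (s := torusSetoid) (L := fun _ => .id ℝ E4) (v := intVec)
    (fun _ _ => Iff.rfl) ?_
  have : {q : E4 × E4 | ∃ n, q.2 = ContinuousLinearMap.id ℝ E4 q.1 + intVec n} =
      ⋂ i, (fun q : E4 × E4 => q.2 i - q.1 i) ⁻¹' range ((↑) : ℤ → ℝ) := by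
    ext ⟨a, b⟩
    simp only [mem_ofPred_eq, mem_iInter, mem_preimage, mem_range]
    constructor
    · rintro ⟨n, rfl⟩ i
      exact ⟨n i, by simp⟩
    · intro h
      choose n hn using h
      exact ⟨n, by ext i; simp [hn]⟩
  rw [this]
  exact isClosed_iInter fun i => isClosed_range_int.preimage (by fun_prop)

theorem mem_closedBall_of_coord {a : E4} (h : ∀ i, |a i| ≤ 1) :
    a ∈ Metric.closedBall (0 : E4) 2 := by
  rw [mem_closedBall_zero_iff, EuclideanSpace.norm_eq, Real.sqrt_le_left zero_le_two,
    Fin.sum_univ_four]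
  have h2 : ∀ i, ‖a i‖ ^ 2 ≤ 1 := fun i => by
    rw [Real.norm_eq_abs]; exact pow_le_one₀ (abs_nonneg _) (h i)
  linarith [h2 0, h2 1, h2 2, h2 3]

theorem abs_fract_le_one (x : ℝ) : |Int.fract x| ≤ 1 := by
  rw [abs_of_nonneg (Int.fract_nonneg x)]
  exact (Int.fract_lt_one x).le

instance : CompactSpace Torus := by
  refine compactSpace_quotient (s := torusSetoid) (L := fun _ => .id ℝ E4) (v := intVec)
    (fun _ _ => Iff.rfl) (isCompact_closedBall (0 : E4) 2) fun a =>
      ⟨fun i => -⌊a i⌋, mem_closedBall_of_coord fun i => ?_⟩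
  have : (ContinuousLinearMap.id ℝ E4 a + intVec fun i => -⌊a i⌋) i = Int.fract (a i) := by
    simp [Int.fract, sub_eq_add_neg]
  rw [this]
  exact abs_fract_le_one _

instance : ConnectedSpace Torus := connectedSpace_quotient (s := torusSetoid)

/-- Congruence modulo `ℤ + iℤ`. -/
def baseSetoid : Setoid ℂ where
  r a b := ∃ m, b = ContinuousLinearMap.id ℂ ℂ a + gauss m
  iseqv :=
    { refl := fun a => ⟨0, by simp [gauss]⟩
      symm := by
        rintro a b ⟨n, rfl⟩
        exact ⟨-n, by apply Complex.ext <;> simp⟩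
      trans := by
        rintro a b c ⟨n, rfl⟩ ⟨m, rfl⟩
        exact ⟨n + m, by apply Complex.ext <;> simp [add_assoc]⟩ }

/-- The complex torus `ℂ / (ℤ + iℤ)`. -/
def Base : Type := Quotient baseSetoid

/-- The quotient map `ℂ → B`. -/
def toBase : ℂ → Base := Quotient.mk baseSetoid

theorem eq_zero_of_norm_gauss_lt {m : ℤ × ℤ} (h : ‖gauss m‖ < 1) : m = 0 := by
  refine Prod.ext (abs_int_lt_one ?_) (abs_int_lt_one ?_)
  · simpa using (Complex.abs_re_le_norm (gauss m)).trans_lt h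
  · simpa using (Complex.abs_im_le_norm (gauss m)).trans_lt h

instance : TopologicalSpace Base := inferInstanceAs (TopologicalSpace (Quotient baseSetoid))

theorem isLocalHomeomorph_toBase : IsLocalHomeomorph toBase := by
  refine isLocalHomeomorph_mk (s := baseSetoid) (L := fun _ => .id ℂ ℂ) (v := gauss)
    (fun _ _ => Iff.rfl) zero_lt_one fun n a h => ?_
  obtain rfl : n = 0 := eq_zero_of_norm_gauss_lt (by simpa using h)
  simp [gauss]

instance : ChartedSpace ℂ Base :=
  coverChartedSpace isLocalHomeomorph_toBase Quotient.mk_surjective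

theorem baseCover : IsAffineCover (fun _ => .id ℂ ℂ) gauss toBase :=
  isAffineCover_mk (fun _ _ => Iff.rfl) isLocalHomeomorph_toBase

theorem baseCoverReal : IsAffineCover (fun _ => .id ℝ ℂ) gauss toBase :=
  isAffineCover_mk (fun _ _ => Iff.rfl) isLocalHomeomorph_toBase

instance : T2Space Base := by
  refine t2Space_quotient (s := baseSetoid) (L := fun _ => .id ℂ ℂ) (v := gauss)
    (fun _ _ => Iff.rfl) ?_
  have : {q : ℂ × ℂ | ∃ n, q.2 = ContinuousLinearMap.id ℂ ℂ q.1 + gauss n} =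
      (fun q : ℂ × ℂ => q.2.re - q.1.re) ⁻¹' range ((↑) : ℤ → ℝ) ∩
        (fun q : ℂ × ℂ => q.2.im - q.1.im) ⁻¹' range ((↑) : ℤ → ℝ) := by
    ext ⟨a, b⟩
    simp only [mem_ofPred_eq, mem_inter_iff, mem_preimage, mem_range]
    constructor
    · rintro ⟨n, rfl⟩
      exact ⟨⟨n.1, by simp⟩, ⟨n.2, by simp⟩⟩
    · rintro ⟨⟨m, hm⟩, ⟨n, hn⟩⟩
      exact ⟨(m, n), by apply Complex.ext <;> simp [hm, hn]⟩
  rw [this]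
  exact (isClosed_range_int.preimage (by fun_prop)).inter
    (isClosed_range_int.preimage (by fun_prop))

theorem mem_closedBall_of_re_im {z : ℂ} (h : |z.re| ≤ 1) (h' : |z.im| ≤ 1) :
    z ∈ Metric.closedBall (0 : ℂ) 2 := by
  rw [mem_closedBall_zero_iff]
  linarith [Complex.norm_le_abs_re_add_abs_im z]

theorem exists_gauss_mem (z : ℂ) : ∃ m, z + gauss m ∈ Metric.closedBall (0 : ℂ) 2 := by
  refine ⟨(-⌊z.re⌋, -⌊z.im⌋), mem_closedBall_of_re_im ?_ ?_⟩
  · simpa [Int.fract, sub_eq_add_neg] using abs_fract_le_one z.re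
  · simpa [Int.fract, sub_eq_add_neg] using abs_fract_le_one z.im

instance : CompactSpace Base :=
  compactSpace_quotient (s := baseSetoid) (L := fun _ => .id ℂ ℂ) (v := gauss)
    (fun _ _ => Iff.rfl) (isCompact_closedBall (0 : ℂ) 2) exists_gauss_mem

instance : ConnectedSpace Base := connectedSpace_quotient (s := baseSetoid)

/-! ### The total space -/

/-- The shear `(t₁, t₂, t₃, t₄) ↦ (t₁, t₂ - c t₃, t₃, t₄)`. -/
def shear (c : ℝ) : E4 →L[ℝ] E4 :=
  .id ℝ E4 -
    c • (EuclideanSpace.proj (2 : Fin 4) : E4 →L[ℝ] ℝ).smulRight (EuclideanSpace.single 1 1)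

@[simp] theorem shear_zero_apply (c : ℝ) (t : E4) : shear c t 0 = t 0 := by simp [shear]
@[simp] theorem shear_one_apply (c : ℝ) (t : E4) : shear c t 1 = t 1 - c * t 2 := by simp [shear]
@[simp] theorem shear_two_apply (c : ℝ) (t : E4) : shear c t 2 = t 2 := by simp [shear]
@[simp] theorem shear_three_apply (c : ℝ) (t : E4) : shear c t 3 = t 3 := by simp [shear]

theorem E4_ext {a b : E4} (h0 : a 0 = b 0) (h1 : a 1 = b 1) (h2 : a 2 = b 2) (h3 : a 3 = b 3) :
    a = b := by
  ext i; fin_cases i <;> assumption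

theorem shear_zero (t : E4) : shear 0 t = t := by apply E4_ext <;> simp

theorem shear_add (c d : ℝ) (t : E4) : shear (c + d) t = shear c (shear d t) := by
  apply E4_ext <;> simp; ring

/-- The integral shear. -/
def intShear (c : ℤ) (n : Fin 4 → ℤ) : Fin 4 → ℤ := ![n 0, n 1 - c * n 2, n 2, n 3]

theorem intVec_intShear (c : ℤ) (n : Fin 4 → ℤ) : intVec (intShear c n) = shear c (intVec n) := by
  apply E4_ext <;> simp [intShear]

theorem intVec_add (m n : Fin 4 → ℤ) : intVec (m + n) = intVec m + intVec n := by
  ext i; simp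

theorem gauss_add (m n : ℤ × ℤ) : gauss (m + n) = gauss m + gauss n := by
  apply Complex.ext <;> simp

/-- The space `ℝ⁴ × ℂ`, on which the total space is modelled. -/
abbrev EX : Type := E4 × ℂ

/-- Deck transformations of `ℝ⁴ × ℂ`, indexed by a translation in `ℤ⁴` and an element of
`ℤ + iℤ`: the linear parts. -/
def deckLin (i : (Fin 4 → ℤ) × ℤ × ℤ) : EX →L[ℝ] EX := (shear i.2.1).prodMap (.id ℝ ℂ)

/-- The translation parts of the deck transformations. -/
def deckVec (i : (Fin 4 → ℤ) × ℤ × ℤ) : EX := (intVec i.1, gauss i.2)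

@[simp] theorem deckLin_apply (i : (Fin 4 → ℤ) × ℤ × ℤ) (y : EX) :
    deckLin i y = (shear i.2.1 y.1, y.2) := rfl

theorem deck_apply (i : (Fin 4 → ℤ) × ℤ × ℤ) (y : EX) :
    deckLin i y + deckVec i = (shear i.2.1 y.1 + intVec i.1, y.2 + gauss i.2) := rfl

/-- Equivalence under the deck transformations of `ℝ⁴ × ℂ`. -/
def totalSetoid : Setoid EX where
  r a b := ∃ i, b = deckLin i a + deckVec i
  iseqv :=
    { refl := fun a => ⟨0, by
        rw [deck_apply]
        refine Prod.ext ?_ ?_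
        · apply E4_ext <;> simp
        · simp [gauss]⟩
      symm := by
        rintro a b ⟨⟨n, m⟩, rfl⟩
        refine ⟨(-intShear (-m.1) n, -m), ?_⟩
        rw [deck_apply, deck_apply]
        refine Prod.ext ?_ ?_
        · apply E4_ext <;> simp [intShear]; ring
        · apply Complex.ext <;> simp
      trans := by
        rintro a b c ⟨⟨n, m⟩, rfl⟩ ⟨⟨n', m'⟩, rfl⟩
        refine ⟨(intShear m'.1 n + n', m' + m), ?_⟩
        simp only [deck_apply]
        refine Prod.ext ?_ ?_
        · simp only [intVec_add, intVec_intShear, map_add, Prod.fst_add, Int.cast_add, shear_add]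
          abel
        · simp only [gauss_add]; ring }

/-- The total space `(T⁴ × ℂ) / (ℤ + iℤ)`, constructed as a quotient of `ℝ⁴ × ℂ`. -/
def Total : Type := Quotient totalSetoid

/-- The quotient map `ℝ⁴ × ℂ → X`. -/
def toTotal : EX → Total := Quotient.mk totalSetoid

instance : TopologicalSpace Total := inferInstanceAs (TopologicalSpace (Quotient totalSetoid))

theorem isLocalHomeomorph_toTotal : IsLocalHomeomorph toTotal := by
  refine isLocalHomeomorph_mk (s := totalSetoid) (L := deckLin) (v := deckVec) (fun _ _ => Iff.rfl)
    zero_lt_one ?_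
  rintro ⟨n, m⟩ a h
  rw [deck_apply] at h ⊢
  have h2 := (norm_snd_le _).trans_lt h
  have h1 := (norm_fst_le _).trans_lt h
  obtain rfl : m = 0 := eq_zero_of_norm_gauss_lt (by simpa using h2)
  simp only [Prod.fst_zero, Int.cast_zero, shear_zero] at h1 ⊢
  obtain rfl : n = 0 := by
    ext i
    refine abs_int_lt_one ((abs_apply_le_norm (intVec n) i).trans_lt ?_)
    simpa using h1
  refine Prod.ext ?_ ?_
  · ext i; simp
  · simp [gauss]

instance : ChartedSpace EX Total :=
  coverChartedSpace isLocalHomeomorph_toTotal Quotient.mk_surjective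

theorem totalCover : IsAffineCover deckLin deckVec toTotal :=
  isAffineCover_mk (fun _ _ => Iff.rfl) isLocalHomeomorph_toTotal

instance : T2Space Total := by
  refine t2Space_quotient (s := totalSetoid) (L := deckLin) (v := deckVec)
    (fun _ _ => Iff.rfl) ?_
  -- the real number `x' - x` replaces the integer `m` that it has to be equal to
  have : {q : EX × EX | ∃ i, q.2 = deckLin i q.1 + deckVec i} =
      (⋂ j, (fun q : EX × EX => q.2.1 j - shear (q.2.2.re - q.1.2.re) q.1.1 j) ⁻¹'
        range ((↑) : ℤ → ℝ)) ∩
      ((fun q : EX × EX => q.2.2.re - q.1.2.re) ⁻¹' range ((↑) : ℤ → ℝ) ∩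
        (fun q : EX × EX => q.2.2.im - q.1.2.im) ⁻¹' range ((↑) : ℤ → ℝ)) := by
    ext ⟨a, b⟩
    simp only [mem_ofPred_eq, mem_inter_iff, mem_preimage, mem_range, mem_iInter]
    constructor
    · rintro ⟨⟨n, m⟩, rfl⟩
      rw [deck_apply]
      exact ⟨fun j => ⟨n j, by simp⟩, ⟨m.1, by simp⟩, ⟨m.2, by simp⟩⟩
    · rintro ⟨h, ⟨m, hm⟩, ⟨k, hk⟩⟩
      choose n hn using h
      refine ⟨(n, m, k), Prod.ext ?_ ?_⟩
      · rw [deck_apply]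
        ext j
        simp only [PiLp.add_apply, intVec_apply, hn, hm]
        ring
      · rw [deck_apply]
        apply Complex.ext <;> simp [hm, hk]
  rw [this]
  refine (isClosed_iInter fun j => isClosed_range_int.preimage ?_).inter
    ((isClosed_range_int.preimage (by fun_prop)).inter
    (isClosed_range_int.preimage (by fun_prop)))
  have : ∀ q : EX × EX, shear (q.2.2.re - q.1.2.re) q.1.1 j =
      q.1.1 j - (q.2.2.re - q.1.2.re) * (q.1.1 2 * (EuclideanSpace.single 1 1 : E4) j) := by
    intro q; simp [shear]
  simp only [this]
  fun_prop

instance : CompactSpace Total := by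
  refine compactSpace_quotient (s := totalSetoid) (L := deckLin) (v := deckVec)
    (fun _ _ => Iff.rfl) ((isCompact_closedBall (0 : E4) 2).prod (isCompact_closedBall (0 : ℂ) 2))
      fun a => ?_
  obtain ⟨m, hm⟩ := exists_gauss_mem a.2
  refine ⟨(fun j => -⌊shear m.1 a.1 j⌋, m), ?_⟩
  rw [deck_apply]
  refine ⟨mem_closedBall_of_coord fun j => ?_, hm⟩
  have : (shear m.1 a.1 + intVec fun j => -⌊shear m.1 a.1 j⌋) j = Int.fract (shear m.1 a.1 j) := by
    simp [Int.fract, sub_eq_add_neg]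
  rw [this]
  exact abs_fract_le_one _

instance : ConnectedSpace Total := connectedSpace_quotient (s := totalSetoid)

/-! ### The monodromy and the fibration -/

theorem toTorus_eq_iff (a b : E4) : toTorus a = toTorus b ↔ ∃ n, b = a + intVec n :=
  torusCover.eq_iff a b

theorem toBase_eq_iff (z w : ℂ) : toBase z = toBase w ↔ ∃ m, w = z + gauss m :=
  baseCover.eq_iff z w

theorem toTotal_eq_iff (y y' : EX) : toTotal y = toTotal y' ↔
    ∃ (n : Fin 4 → ℤ) (m : ℤ × ℤ), y'.1 = shear m.1 y.1 + intVec n ∧ y'.2 = y.2 + gauss m := by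
  rw [totalCover.eq_iff]
  constructor
  · rintro ⟨⟨n, m⟩, rfl⟩
    exact ⟨n, m, rfl, rfl⟩
  · rintro ⟨n, m, h1, h2⟩
    exact ⟨(n, m), Prod.ext h1 h2⟩

/-- The map of the torus induced by an integral shear. -/
def torusShear (c : ℤ) : Torus → Torus :=
  Quotient.lift (fun a => toTorus (shear c a)) <| by
    rintro a b ⟨n, rfl⟩
    refine (toTorus_eq_iff _ _).2 ⟨intShear c n, ?_⟩
    rw [intVec_intShear, map_add]
    rfl

theorem torusShear_toTorus (c : ℤ) (a : E4) : torusShear c (toTorus a) = toTorus (shear c a) := rfl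

theorem torusShear_add (c d : ℤ) (t : Torus) :
    torusShear (c + d) t = torusShear c (torusShear d t) := by
  obtain ⟨a, rfl⟩ := torusCover.surjective t
  simp only [torusShear_toTorus, Int.cast_add, shear_add]

theorem torusShear_zero (t : Torus) : torusShear 0 t = t := by
  obtain ⟨a, rfl⟩ := torusCover.surjective t
  simp only [torusShear_toTorus, Int.cast_zero, shear_zero]

/-- The monodromy `λ : ℤ + iℤ → Aut(T⁴)`. -/
def monodromy : Multiplicative (ℤ × ℤ) →* Equiv.Perm Torus where
  toFun m :=
    { toFun := torusShear m.toAdd.1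
      invFun := torusShear (-m.toAdd.1)
      left_inv := fun t => by rw [← torusShear_add, neg_add_cancel, torusShear_zero]
      right_inv := fun t => by rw [← torusShear_add, add_neg_cancel, torusShear_zero] }
  map_one' := Equiv.ext torusShear_zero
  map_mul' m n := Equiv.ext fun t => torusShear_add m.toAdd.1 n.toAdd.1 t

theorem monodromy_toTorus (m : ℤ × ℤ) (a : E4) :
    monodromy (Multiplicative.ofAdd m) (toTorus a) = toTorus (shear m.1 a) := rfl

/-- The quotient map `T⁴ × ℂ → X`. -/
def torusToTotal (y : Torus × ℂ) : Total :=
  Quotient.lift (fun a : E4 => toTotal (a, y.2)) (by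
    rintro a b ⟨n, rfl⟩
    exact (toTotal_eq_iff _ _).2 ⟨n, 0, by simp [shear_zero], by simp [gauss]⟩) y.1

theorem torusToTotal_toTorus (a : E4) (z : ℂ) : torusToTotal (toTorus a, z) = toTotal (a, z) := rfl

/-- The projection `X → B`. -/
def proj : Total → Base :=
  Quotient.lift (fun y : EX => toBase y.2) <| by
    rintro y _ ⟨i, rfl⟩
    exact (toBase_eq_iff _ _).2 ⟨i.2, rfl⟩

theorem proj_toTotal (y : EX) : proj (toTotal y) = toBase y.2 := rfl

theorem proj_torusToTotal (y : Torus × ℂ) : proj (torusToTotal y) = toBase y.2 := by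
  obtain ⟨t, z⟩ := y
  obtain ⟨a, rfl⟩ := torusCover.surjective t
  rfl

theorem torusToTotal_eq_iff (y y' : Torus × ℂ) : torusToTotal y = torusToTotal y' ↔
    ∃ m n : ℤ, y'.1 = monodromy (Multiplicative.ofAdd (m, n)) y.1 ∧
      y'.2 = y.2 + m + n * Complex.I := by
  obtain ⟨t, z⟩ := y
  obtain ⟨t', z'⟩ := y'
  obtain ⟨a, rfl⟩ := torusCover.surjective t
  obtain ⟨a', rfl⟩ := torusCover.surjective t'
  rw [torusToTotal_toTorus, torusToTotal_toTorus, toTotal_eq_iff]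
  simp only [monodromy_toTorus, eq_comm (a := toTorus a'), toTorus_eq_iff]
  constructor
  · rintro ⟨n, m, h1, h2⟩
    exact ⟨m.1, m.2, ⟨n, h1⟩, by rw [h2, gauss, add_assoc]⟩
  · rintro ⟨m, k, ⟨n, h1⟩, h2⟩
    exact ⟨n, (m, k), h1, by rw [h2, gauss, add_assoc]⟩

instance : IsManifold 𝓘(ℝ, E4) ∞ Torus := torusCover.isManifold
instance : IsManifold 𝓘(ℂ, ℂ) ∞ Base := baseCover.isManifold
instance : IsManifold 𝓘(ℝ, ℂ) ∞ Base := baseCoverReal.isManifold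
instance : IsManifold 𝓘(ℝ, EX) ∞ Total := totalCover.isManifold

/-- `T⁴ × ℂ → X` is a local diffeomorphism: locally it is a chart of the torus followed by the
covering `ℝ⁴ × ℂ → X`. -/
theorem isLocalDiffeomorph_torusToTotal :
    IsLocalDiffeomorph (𝓘(ℝ, E4).prod 𝓘(ℝ, ℂ)) 𝓘(ℝ, EX) ∞ torusToTotal := by
  rintro ⟨t, z⟩
  obtain ⟨a, rfl⟩ := torusCover.surjective t
  obtain ⟨e, he, ha, hea⟩ := torusCover.exists_chart a
  have hmax := torusCover.mem_maximalAtlas he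
  obtain ⟨Φ, hΦ, hΦQ⟩ := totalCover.isLocalDiffeomorph (a, z)
  let Ψ : PartialDiffeomorph (𝓘(ℝ, E4).prod 𝓘(ℝ, ℂ)) 𝓘(ℝ, EX) (Torus × ℂ) EX ∞ :=
    { (e.prod (OpenPartialHomeomorph.refl ℂ)).toPartialEquiv with
      open_source := (e.prod (OpenPartialHomeomorph.refl ℂ)).open_source
      open_target := (e.prod (OpenPartialHomeomorph.refl ℂ)).open_target
      contMDiffOn_toFun := by
        have h1 : ContMDiffOn (𝓘(ℝ, E4).prod 𝓘(ℝ, ℂ)) 𝓘(ℝ, E4) ∞ (fun y : Torus × ℂ => e y.1)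
            (e.prod (OpenPartialHomeomorph.refl ℂ)).source :=
          (contMDiffOn_of_mem_maximalAtlas hmax).comp contMDiff_fst.contMDiffOn fun y hy => hy.1
        exact h1.prodMk_space contMDiff_snd.contMDiffOn
      contMDiffOn_invFun := by
        have h1 : ContMDiffOn 𝓘(ℝ, EX) 𝓘(ℝ, E4) ∞ (fun y : EX => e.symm y.1)
            (e.prod (OpenPartialHomeomorph.refl ℂ)).target :=
          (contMDiffOn_symm_of_mem_maximalAtlas hmax).comp
            contDiff_fst.contMDiff.contMDiffOn fun y hy => hy.1
        exact h1.prodMk contDiff_snd.contMDiff.contMDiffOn }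
  refine ⟨Ψ.trans Φ, ⟨⟨ha, trivial⟩, ?_⟩, ?_⟩
  · change (e (toTorus a), z) ∈ Φ.source
    rwa [hea]
  · rintro ⟨t', z'⟩ ⟨⟨ht', -⟩, hy⟩
    change torusToTotal (t', z') = Φ (e t', z')
    have h1 : toTotal (e t', z') = Φ (e t', z') := hΦQ hy
    rw [← h1, ← torusToTotal_toTorus, torusCover.apply_of_mem_atlas he ht']

theorem contMDiff_proj : ContMDiff 𝓘(ℝ, EX) 𝓘(ℝ, ℂ) ∞ proj := by
  intro x
  obtain ⟨y, rfl⟩ := totalCover.surjective x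
  refine totalCover.contMDiffAt_of_comp ?_
  exact (baseCoverReal.contMDiff.comp contDiff_snd.contMDiff).contMDiffAt

/-- The differential of the projection is the projection `ℝ⁴ × ℂ → ℂ`. -/
theorem diffAt_proj (x : Total) : diffAt EX ℂ proj x = ContinuousLinearMap.snd ℝ E4 ℂ := by
  have hm : MDifferentiableAt 𝓘(ℝ, EX) 𝓘(ℝ, ℂ) proj x :=
    contMDiff_proj.contMDiffAt.mdifferentiableAt (by simp)
  rw [totalCover.diffAt_of_lift (g := toBase ∘ Prod.snd) rfl hm,
    diffAt_comp (E₂ := ℂ) (baseCoverReal.mdifferentiableAt _)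
      differentiableAt_snd.mdifferentiableAt, diffAt_eq_fderiv, fderiv_snd]
  obtain ⟨-, -, h⟩ := baseCoverReal.exists_diffAt (chartAt EX x x).2
  rw [h]
  rfl

theorem isVertical_iff (x : Total) (v : EX) : IsVertical ℂ proj x v ↔ v.2 = 0 := by
  rw [IsVertical, diffAt_proj]
  rfl

/-- Every point of `X` over the domain of a chart `e` of `B` comes from a point of `T⁴ × ℂ` whose
base coordinate is the one given by `e`. -/
theorem exists_torusToTotal_eq {e : OpenPartialHomeomorph Base ℂ} (he : e ∈ atlas ℂ Base)
    {x : Total} (hx : proj x ∈ e.source) : ∃ t, torusToTotal (t, e (proj x)) = x := by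
  obtain ⟨y, rfl⟩ := totalCover.surjective x
  have h := baseCover.apply_of_mem_atlas he hx
  obtain ⟨m, hm⟩ := (toBase_eq_iff _ _).1 ((proj_toTotal y).symm.trans h.symm)
  refine ⟨toTorus (shear m.1 y.1), ?_⟩
  rw [torusToTotal_toTorus]
  exact ((toTotal_eq_iff _ _).2 ⟨0, m, by ext i; simp, hm⟩).symm

/-- Each slice `T⁴ × {z}` embeds in `X`: only `ℓ = 0` fixes `z`. -/
theorem torusToTotal_injective (z : ℂ) {t t' : Torus}
    (h : torusToTotal (t, z) = torusToTotal (t', z)) : t = t' := by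
  obtain ⟨m, n, h1, h2⟩ := (torusToTotal_eq_iff _ _).1 h
  have h3 : gauss (m, n) = 0 := by
    have h2 : z = z + m + n * Complex.I := h2
    rw [gauss]
    linear_combination -h2
  have h4 : (m, n) = 0 := eq_zero_of_norm_gauss_lt (by rw [h3, norm_zero]; exact one_pos)
  have h5 : t' = monodromy (Multiplicative.ofAdd (m, n)) t := h1
  rw [h5, h4, ofAdd_zero, map_one, Equiv.Perm.one_apply]

/-- The fibre coordinate of a point of `X` over the domain of a chart of `B`. Elsewhere its value
is arbitrary. -/
def fibreCoord (e : OpenPartialHomeomorph Base ℂ) (he : e ∈ atlas ℂ Base) (x : Total) : Torus :=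
  open Classical in
  if hx : proj x ∈ e.source then (exists_torusToTotal_eq he hx).choose else toTorus 0

theorem torusToTotal_fibreCoord {e : OpenPartialHomeomorph Base ℂ} (he : e ∈ atlas ℂ Base)
    {x : Total} (hx : proj x ∈ e.source) :
    torusToTotal (fibreCoord e he x, e (proj x)) = x := by
  rw [fibreCoord, dif_pos hx]
  exact (exists_torusToTotal_eq he hx).choose_spec

theorem fibreCoord_toTotal {e : OpenPartialHomeomorph Base ℂ} (he : e ∈ atlas ℂ Base)
    {a : E4} {z : ℂ} (hz : z ∈ e.target) : fibreCoord e he (toTotal (a, z)) = toTorus a := by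
  have hs := (baseCover.mem_atlas e).1 he z hz
  have hx : proj (toTotal (a, z)) ∈ e.source := by
    rw [proj_toTotal, ← hs]
    exact e.map_target hz
  have hez : e (proj (toTotal (a, z))) = z := by
    rw [proj_toTotal, ← hs]
    exact e.right_inv hz
  have h := torusToTotal_fibreCoord he hx
  rw [hez, ← torusToTotal_toTorus a z] at h
  exact torusToTotal_injective z h

theorem contMDiffAt_trivialization {e : OpenPartialHomeomorph Base ℂ} (he : e ∈ atlas ℂ Base)
    {x : Total} (hx : proj x ∈ e.source) :
    ContMDiffAt 𝓘(ℝ, EX) (𝓘(ℝ, ℂ).prod 𝓘(ℝ, E4)) ∞ (fun x => (proj x, fibreCoord e he x)) x := by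
  refine contMDiff_proj.contMDiffAt.prodMk ?_
  have hx' := torusToTotal_fibreCoord he hx
  obtain ⟨a, ha⟩ := torusCover.surjective (fibreCoord e he x)
  rw [← ha, torusToTotal_toTorus] at hx'
  rw [← hx']
  refine totalCover.contMDiffAt_of_comp ?_
  have h1 : ContMDiffAt 𝓘(ℝ, EX) 𝓘(ℝ, E4) ∞ (fun y : EX => toTorus y.1) (a, e (proj x)) :=
    (torusCover.contMDiff.comp contDiff_fst.contMDiff).contMDiffAt
  refine h1.congr_of_eventuallyEq ?_
  have : ∀ᶠ y : EX in 𝓝 (a, e (proj x)), y.2 ∈ e.target :=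
    continuousAt_snd (e.open_target.mem_nhds (e.map_source hx))
  filter_upwards [this] with y hy
  exact fibreCoord_toTotal he hy

theorem contMDiffAt_trivialization_symm {e : OpenPartialHomeomorph Base ℂ} (he : e ∈ atlas ℂ Base)
    {y : Base × Torus} (hy : y.1 ∈ e.source) :
    ContMDiffAt (𝓘(ℝ, ℂ).prod 𝓘(ℝ, E4)) 𝓘(ℝ, EX) ∞
      (fun y : Base × Torus => torusToTotal (y.2, e y.1)) y := by
  have h1 : ContMDiffAt (𝓘(ℝ, ℂ).prod 𝓘(ℝ, E4)) 𝓘(ℝ, ℂ) ∞ (fun y : Base × Torus => e y.1) y :=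
    (contMDiffAt_of_mem_maximalAtlas (baseCoverReal.mem_maximalAtlas he) hy).comp y
      contMDiffAt_fst
  exact isLocalDiffeomorph_torusToTotal.contMDiff.contMDiffAt.comp y
    (contMDiffAt_snd.prodMk h1)

/-- The trivialization of `X` over the domain of a chart of `B`. -/
def trivialization (e : OpenPartialHomeomorph Base ℂ) (he : e ∈ atlas ℂ Base) :
    Bundle.Trivialization Torus proj where
  toFun x := (proj x, fibreCoord e he x)
  invFun y := torusToTotal (y.2, e y.1)
  source := proj ⁻¹' e.source
  target := e.source ×ˢ univ
  map_source' _ hx := ⟨hx, trivial⟩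
  map_target' y hy := by
    rw [mem_preimage, proj_torusToTotal, baseCover.apply_of_mem_atlas he hy.1]
    exact hy.1
  left_inv' _ hx := torusToTotal_fibreCoord he hx
  right_inv' := by
    rintro ⟨b, t⟩ ⟨hb, -⟩
    obtain ⟨a, rfl⟩ := torusCover.surjective t
    refine Prod.ext ?_ ?_
    · change proj (torusToTotal (toTorus a, e b)) = b
      rw [proj_torusToTotal, baseCover.apply_of_mem_atlas he hb]
    · exact fibreCoord_toTotal he (e.map_source hb)
  open_source := e.open_source.preimage contMDiff_proj.continuous
  open_target := e.open_source.prod isOpen_univ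
  continuousOn_toFun _ hx := (contMDiffAt_trivialization he hx).continuousAt.continuousWithinAt
  continuousOn_invFun _ hy :=
    (contMDiffAt_trivialization_symm he hy.1).continuousAt.continuousWithinAt
  baseSet := e.source
  open_baseSet := e.open_source
  source_eq := rfl
  target_eq := rfl
  proj_toFun _ _ := rfl

theorem isSmoothFibreBundle_proj :
    IsSmoothFibreBundle (E := EX) (G := E4) ℂ Torus proj := by
  refine ⟨contMDiff_proj, fun b => ?_⟩
  have he := chart_mem_atlas ℂ b
  exact ⟨trivialization _ he, mem_chart_source ℂ b,
    fun x hx => (contMDiffAt_trivialization he hx).contMDiffWithinAt,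
    fun y hy => (contMDiffAt_trivialization_symm he hy.1).contMDiffWithinAt⟩

/-! ### Continuous forms and spinors -/

section Wedge
variable {E F : Type*} [NormedAddCommGroup E] [NormedSpace ℝ E] [NormedAddCommGroup F]
  [NormedSpace ℝ F] {k : ℕ}

/-- The exterior product `α ∧ τ` of a real continuous `1`-covector with a continuous covector. -/
def wedgeOne (α : E →L[ℝ] ℝ) (τ : E [⋀^Fin k]→L[ℝ] F) : E [⋀^Fin (k + 1)]→L[ℝ] F :=
  ContinuousAlternatingMap.alternatizeUncurryFin (α.smulRight τ)

theorem wedgeOne_apply (α : E →L[ℝ] ℝ) (τ : E [⋀^Fin k]→L[ℝ] F) (v : Fin (k + 1) → E) :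
    wedgeOne α τ v = ∑ i : Fin (k + 1), (-1) ^ (i : ℕ) • α (v i) • τ (i.removeNth v) := by
  rw [wedgeOne, ContinuousAlternatingMap.alternatizeUncurryFin_apply]
  rfl

theorem wedgeOne_comp {E' : Type*} [NormedAddCommGroup E'] [NormedSpace ℝ E']
    (α : E →L[ℝ] ℝ) (τ : E [⋀^Fin k]→L[ℝ] F) (L : E' →L[ℝ] E) :
    (wedgeOne α τ).compContinuousLinearMap L =
      wedgeOne (α.comp L) (τ.compContinuousLinearMap L) := by
  ext v
  simp only [ContinuousAlternatingMap.compContinuousLinearMap_apply, wedgeOne_apply]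
  rfl

/-- A `1`-covector as an alternating map. -/
abbrev altOne (α : E →L[ℝ] F) : E [⋀^Fin 1]→L[ℝ] F :=
  ContinuousAlternatingMap.ofSubsingleton ℝ E F (0 : Fin 1) α

theorem wedgeOne_altOne_apply (α β : E →L[ℝ] ℝ) (v : Fin 2 → E) :
    wedgeOne α (altOne β) v = α (v 0) * β (v 1) - α (v 1) * β (v 0) := by
  rw [wedgeOne_apply, Fin.sum_univ_two]
  simp [Fin.removeNth, Fin.succAbove, Fin.tail]
  ring

/-- A real `1`-covector, as a complex one. -/
abbrev complexOne (α : E →L[ℝ] ℝ) : E →ₗ[ℝ] ℂ := (Complex.ofRealCLM.comp α : E →L[ℝ] ℂ)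

theorem homogeneous_complexify_altOne (α : E →L[ℝ] ℝ) :
    homogeneous (complexify (altOne α).toAlternatingMap) = oneForm (complexOne α) := rfl

/-- The differential of a form whose coefficients are affine functions: `d(A + α B) = α ∧ B` for
constant forms `A`, `B` and a linear function `α`. -/
theorem extDeriv_add_smul (α : E →L[ℝ] ℝ) (A B : E [⋀^Fin k]→L[ℝ] F) (y : E) :
    extDeriv (fun y => A + α y • B) y = wedgeOne α B := by
  have h : HasFDerivAt (fun y => A + α y • B) (α.smulRight B) y :=
    (α.hasFDerivAt.smul_const B).const_add A
  rw [extDeriv, h.fderiv]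
  rfl

variable [FiniteDimensional ℝ E]

theorem homogeneous_complexify_wedgeOne (α : E →L[ℝ] ℝ) (τ : E [⋀^Fin k]→L[ℝ] ℝ) :
    homogeneous (complexify (wedgeOne α τ).toAlternatingMap) =
      spinorWedge (oneForm (complexOne α)) (homogeneous (complexify τ.toAlternatingMap)) := by
  funext n
  cases n with
  | zero => rw [oneForm_wedge_zero, homogeneous_apply_ne (by omega)]
  | succ n =>
    ext v
    rw [oneForm_wedge_apply]
    by_cases hn : n = k
    · subst hn
      rw [homogeneous_apply_self, homogeneous_apply_self]
      change ((wedgeOne α τ v : ℝ) : ℂ) =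
        ∑ i : Fin (n + 1), (-1 : ℂ) ^ (i : ℕ) * ((α (v i) : ℝ) : ℂ) *
        ((τ (i.removeNth v) : ℝ) : ℂ)
      rw [wedgeOne_apply]
      push_cast
      simp [mul_assoc]
    · rw [homogeneous_apply_ne (by omega), homogeneous_apply_ne hn]
      simp

theorem continuous_alternatingMap (α : E [⋀^Fin k]→ₗ[ℝ] ℂ) : Continuous α := by
  have hα : α ∈ Submodule.span ℂ (Set.range (decomposable : (Fin k → E →ₗ[ℝ] ℂ) → _)) := by
    rw [span_decomposable]; trivial
  induction hα using Submodule.span_induction with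
  | mem α hα =>
    obtain ⟨ξ, rfl⟩ := hα
    have : ⇑(decomposable ξ) = fun v => (Matrix.of fun i j => ξ i (v j)).det :=
      funext (decomposable_apply ξ)
    rw [this]
    refine Continuous.matrix_det (continuous_pi fun i => continuous_pi fun j => ?_)
    exact (ξ i).continuous_of_finiteDimensional.comp (continuous_apply j)
  | zero => exact continuous_const
  | add α β _ _ hα hβ => exact hα.add hβ
  | smul c α _ hα => exact hα.const_smul c

/-- On a finite-dimensional space every alternating map is continuous. -/
def toCont (α : E [⋀^Fin k]→ₗ[ℝ] ℂ) : E [⋀^Fin k]→L[ℝ] ℂ :=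
  { α with cont := continuous_alternatingMap α }

theorem toCont_apply (α : E [⋀^Fin k]→ₗ[ℝ] ℂ) (v : Fin k → E) : toCont α v = α v := rfl

theorem toAlternatingMap_wedgeOne_toCont (α : E →L[ℝ] ℝ) (ρ : SpinorAt E) :
    (wedgeOne α (toCont (ρ k))).toAlternatingMap =
      spinorWedge (oneForm (complexOne α)) ρ (k + 1) := by
  ext v
  rw [oneForm_wedge_apply]
  change wedgeOne α (toCont (ρ k)) v = _
  rw [wedgeOne_apply]
  simp [toCont_apply, mul_assoc]

end Wedge

section ExpAdd
variable {T : Type*} [AddCommGroup T] [Module ℝ T]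

/-- The lowest-degree component of `e^c ∧ γ` is `γ`. -/
theorem expOp_apply_one (c : T [⋀^Fin 2]→ₗ[ℝ] ℂ) (γ : T →ₗ[ℝ] ℂ) :
    expOp c (oneForm γ) 1 = AlternatingMap.ofSubsingleton ℝ T ℂ (0 : Fin 1) γ := by
  rw [expOp, Finset.sum_range_succ']
  simp only [LinearMap.add_apply, LinearMap.sum_apply, Finset.sum_apply, Pi.add_apply,
    LinearMap.smul_apply, Pi.smul_apply]
  rw [Finset.sum_eq_zero fun j _ => ?_]
  · simp [oneForm, homogeneous_apply_self]
  · rw [twoOp_pow_apply_eq_zero, smul_zero]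
    intro m hm
    omega

variable [FiniteDimensional ℝ T]

/-- `e^{c + c'} = e^c (1 + c')` when `c' ∧ c' = 0`. -/
theorem expOp_add_of_sq_zero {c c' : T [⋀^Fin 2]→ₗ[ℝ] ℂ} (h : twoOp c' * twoOp c' = 0) :
    expOp (c + c') = expOp c + expOp c * twoOp c' := by
  have hadd : twoOp (c + c') = twoOp c + twoOp c' := by
    rw [twoOp, ← homogeneousL_apply, map_add, map_add]; rfl
  have hcomm : twoOp c' * twoOp c = twoOp c * twoOp c' := (commute_twoOp_twoOp c' c).eq
  have hpow : ∀ j : ℕ, twoOp (c + c') ^ (j + 1) =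
      twoOp c ^ (j + 1) + ((j + 1 : ℕ) : ℂ) • (twoOp c ^ j * twoOp c') := by
    intro j
    induction j with
    | zero => simp [hadd]
    | succ j ih =>
      have h1 : twoOp c ^ j * twoOp c' * twoOp c' = 0 := by rw [mul_assoc, h, mul_zero]
      have h2 : twoOp c ^ j * twoOp c' * twoOp c = twoOp c ^ (j + 1) * twoOp c' := by
        rw [mul_assoc, hcomm, ← mul_assoc, ← pow_succ]
      rw [pow_succ, ih, hadd, mul_add, add_mul, add_mul, smul_mul_assoc, smul_mul_assoc, h1, h2,
        smul_zero, add_zero, ← pow_succ, Nat.cast_succ (j + 1), add_smul, one_smul, add_assoc]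
  nth_rewrite 2 [expOp_eq_sum c]
  rw [expOp, expOp, Finset.sum_range_succ', Finset.sum_range_succ' _ (Module.finrank ℝ T + 1),
    Finset.sum_mul]
  simp only [hpow, smul_add, Finset.sum_add_distrib, smul_smul, pow_zero, smul_mul_assoc]
  rw [add_right_comm]
  congr 1
  refine Finset.sum_congr rfl fun j _ => ?_
  congr 1
  rw [Nat.factorial_succ]
  push_cast
  have := Nat.cast_ne_zero (R := ℂ).2 j.factorial_ne_zero
  have h2 : (j : ℂ) + 1 ≠ 0 := by exact_mod_cast j.succ_ne_zero
  field_simp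

end ExpAdd

/-! ### The symplectic family -/

/-- The forms `θ₁, …, θ₄` on `ℝ⁴ × ℂ`. -/
def theta (i : Fin 4) : EX →L[ℝ] ℝ := (EuclideanSpace.proj i).comp (.fst ℝ E4 ℂ)

/-- The form `dx` on `ℝ⁴ × ℂ`. -/
def formDx : EX →L[ℝ] ℝ := Complex.reCLM.comp (.snd ℝ E4 ℂ)

/-- The form `dy` on `ℝ⁴ × ℂ`. -/
def formDy : EX →L[ℝ] ℝ := Complex.imCLM.comp (.snd ℝ E4 ℂ)

@[simp] theorem theta_apply (i : Fin 4) (v : EX) : theta i v = v.1 i := rfl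
@[simp] theorem formDx_apply (v : EX) : formDx v = v.2.re := rfl
@[simp] theorem formDy_apply (v : EX) : formDy v = v.2.im := rfl

/-- The form `θ₁ ∧ θ₂ + θ₃ ∧ θ₄`. -/
def constForm : EX [⋀^Fin 2]→L[ℝ] ℝ :=
  wedgeOne (theta 0) (altOne (theta 1)) + wedgeOne (theta 2) (altOne (theta 3))

/-- The form `θ₁ ∧ θ₃`. -/
def twistForm : EX [⋀^Fin 2]→L[ℝ] ℝ := wedgeOne (theta 0) (altOne (theta 2))

/-- The form `θ₁ ∧ θ₂ + θ₃ ∧ θ₄ + x θ₁ ∧ θ₃` on `ℝ⁴ × ℂ`. -/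
def liftForm (y : EX) : EX [⋀^Fin 2]→L[ℝ] ℝ := constForm + formDx y • twistForm

theorem twistForm_apply (v : Fin 2 → EX) :
    twistForm v = (v 0).1 0 * (v 1).1 2 - (v 1).1 0 * (v 0).1 2 := by
  rw [twistForm, wedgeOne_altOne_apply]; rfl

theorem liftForm_apply (y : EX) (v : Fin 2 → EX) :
    liftForm y v = ((v 0).1 0 * (v 1).1 1 - (v 0).1 1 * (v 1).1 0) +
      ((v 0).1 2 * (v 1).1 3 - (v 0).1 3 * (v 1).1 2) +
        y.2.re * ((v 0).1 0 * (v 1).1 2 - (v 0).1 2 * (v 1).1 0) := by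
  simp only [liftForm, constForm, twistForm, ContinuousAlternatingMap.add_apply,
    ContinuousAlternatingMap.smul_apply, wedgeOne_altOne_apply, theta_apply, formDx_apply,
    smul_eq_mul]
  ring

/-- The form descends to `X`: the term `-θ₁ ∧ θ₃` by which the monodromy changes `θ₁ ∧ θ₂` is
compensated by the increment of `x`. -/
theorem liftForm_deck (i : (Fin 4 → ℤ) × ℤ × ℤ) (y : EX) :
    (liftForm (deckLin i y + deckVec i)).compContinuousLinearMap (deckLin i) = liftForm y := by
  ext v
  rw [ContinuousAlternatingMap.compContinuousLinearMap_apply, liftForm_apply, liftForm_apply,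
    deck_apply]
  simp
  ring

theorem contDiff_liftForm : ContDiff ℝ ∞ liftForm :=
  contDiff_const.add (formDx.contDiff.smul contDiff_const)

theorem extDeriv_liftForm (y : EX) : extDeriv liftForm y = wedgeOne formDx twistForm :=
  extDeriv_add_smul formDx constForm twistForm y

theorem liftForm_nondegenerate (y v : EX) (hv : v.2 = 0)
    (h : ∀ w : EX, w.2 = 0 → liftForm y ![v, w] = 0) : v = 0 := by
  have key (j : Fin 4) := h (EuclideanSpace.single j 1, 0) rfl
  simp only [liftForm_apply] at key
  have h1 := key 1
  have h3 := key 3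
  have h0 := key 0
  have h2 := key 2
  simp at h0 h1 h2 h3
  refine Prod.ext (E4_ext ?_ ?_ ?_ ?_) hv <;> simp <;> simp [h1, h3] at * <;> linarith

/-- The form `ω̃` on the total space. -/
def totalForm : Form EX Total ℝ 2 := fun x => liftForm (chartAt EX x x)

theorem pullback_totalForm : pullback (E := EX) (E' := EX) toTotal totalForm = liftForm :=
  totalCover.pullback_descend liftForm_deck

theorem smoothFormOn_totalForm : SmoothFormOn totalForm univ :=
  totalCover.smoothFormOn_of_pullback (by
    rw [pullback_totalForm]; exact contDiff_liftForm.contDiffOn)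

theorem extD_totalForm (x : Total) : extD totalForm x = wedgeOne formDx twistForm := by
  rw [totalCover.extD_apply, pullback_totalForm, extDeriv_liftForm]

theorem isSmoothSymplecticFamily :
    IsSmoothSymplecticFamily (G := E4) ℂ Torus proj totalForm where
  bundle := isSmoothFibreBundle_proj
  smooth := smoothFormOn_totalForm
  leafwise_closed := by
    rintro x v ⟨s, hs, hv⟩
    have hu : s = Finset.univ := by
      rw [← Finset.card_eq_iff_eq_univ, Fintype.card_fin]
      have := s.card_le_univ
      rw [Fintype.card_fin] at this
      omega
    subst hu
    rw [extD_totalForm, wedgeOne_apply]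
    refine Finset.sum_eq_zero fun i _ => ?_
    have : formDx (v i) = 0 := by
      rw [formDx_apply, (isVertical_iff x (v i)).1 (hv i (Finset.mem_univ i)), Complex.zero_re]
    rw [this, zero_smul, smul_zero]
  leafwise_nondegenerate x v hv h :=
    liftForm_nondegenerate _ v ((isVertical_iff x v).1 hv) fun w hw =>
      h w ((isVertical_iff x w).2 hw)

/-! ### The spinor `e^{iω} ∧ dz` -/

section Square
variable {T : Type*} [AddCommGroup T] [Module ℝ T]

theorem real_smul_spinor (a : ℝ) (ρ : SpinorAt T) : a • ρ = (a : ℂ) • ρ := by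
  funext k
  ext v
  simp

theorem oneOp_add (ξ η : T →ₗ[ℝ] ℂ) : oneOp (ξ + η) = oneOp ξ + oneOp η := by
  rw [oneOp, oneForm_add, map_add]

theorem oneOp_smul (a : ℂ) (ξ : T →ₗ[ℝ] ℂ) : oneOp (a • ξ) = a • oneOp ξ := by
  rw [oneOp, oneForm_smul, map_smul]

variable [FiniteDimensional ℝ T]

theorem oneOp_oneOp_apply (ξ η : T →ₗ[ℝ] ℂ) (ρ : SpinorAt T) :
    oneOp ξ (oneOp η ρ) = -(oneOp η (oneOp ξ ρ)) := by
  simp only [spinorWedgeL_apply, ← spinorWedge_assoc]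
  rw [oneForm_wedge_oneForm_comm, ← spinorWedgeL_apply, map_neg]
  rfl

theorem oneOp_oneOp_self (ξ : T →ₗ[ℝ] ℂ) (ρ : SpinorAt T) : oneOp ξ (oneOp ξ ρ) = 0 := by
  funext k
  ext v
  exact self_eq_neg.1 (DFunLike.congr_fun (congrFun (oneOp_oneOp_apply ξ ξ ρ) k) v)

end Square

/-- The form `dz` on `ℝ⁴ × ℂ`. -/
def formDz : EX →ₗ[ℝ] ℂ := (ContinuousLinearMap.snd ℝ E4 ℂ : EX →L[ℝ] ℂ)

@[simp] theorem formDz_apply (v : EX) : formDz v = v.2 := rfl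

/-- The exterior product with `θ₁ ∧ θ₃`. -/
def twistOp : Module.End ℂ (SpinorAt EX) := twoOp (complexify twistForm.toAlternatingMap)

theorem twistOp_eq : twistOp = oneOp (complexOne (theta 0)) * oneOp (complexOne (theta 2)) := by
  refine LinearMap.ext fun ρ => ?_
  rw [twistOp, twoOp, twistForm, homogeneous_complexify_wedgeOne, homogeneous_complexify_altOne,
    spinorWedgeL_apply, spinorWedge_assoc]
  rfl

theorem twistOp_mul_self : twistOp * twistOp = 0 := by
  refine LinearMap.ext fun ρ => ?_
  rw [twistOp_eq]
  simp only [Module.End.mul_apply, LinearMap.zero_apply]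
  rw [oneOp_oneOp_apply (complexOne (theta 2)), map_neg, oneOp_oneOp_self, neg_zero]

/-- The exponent `i (θ₁ ∧ θ₂ + θ₃ ∧ θ₄)`. -/
def constExponent : EX [⋀^Fin 2]→ₗ[ℝ] ℂ := Complex.I • complexify constForm.toAlternatingMap

/-- The spinor `e^{iω} ∧ dz` on `ℝ⁴ × ℂ`. -/
def liftSpinor (y : EX) : SpinorAt EX :=
  expOp (Complex.I • complexify (liftForm y).toAlternatingMap) (oneForm formDz)

/-- The value of `e^{iω} ∧ dz` at `x = 0`. -/
def spinorA : SpinorAt EX := expOp constExponent (oneForm formDz)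

/-- The derivative of `e^{iω} ∧ dz` in the direction `∂/∂x`. -/
def spinorB : SpinorAt EX := Complex.I • expOp constExponent (twistOp (oneForm formDz))

theorem liftSpinor_eq (y : EX) : liftSpinor y = spinorA + formDx y • spinorB := by
  have hc : Complex.I • complexify (liftForm y).toAlternatingMap = constExponent +
      (((formDx y : ℝ) : ℂ) * Complex.I) • complexify twistForm.toAlternatingMap := by
    ext v
    change Complex.I * ((liftForm y v : ℝ) : ℂ) = Complex.I * ((constForm v : ℝ) : ℂ) +
      ((formDx y : ℝ) : ℂ) * Complex.I * ((twistForm v : ℝ) : ℂ)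
    rw [liftForm, ContinuousAlternatingMap.add_apply, ContinuousAlternatingMap.smul_apply,
      smul_eq_mul]
    push_cast
    ring
  have htw : twoOp ((((formDx y : ℝ) : ℂ) * Complex.I) • complexify twistForm.toAlternatingMap) =
      (((formDx y : ℝ) : ℂ) * Complex.I) • twistOp := by
    rw [twoOp, ← homogeneousL_apply, map_smul, map_smul]; rfl
  rw [liftSpinor, hc, expOp_add_of_sq_zero, htw]
  · rw [LinearMap.add_apply, Module.End.mul_apply, LinearMap.smul_apply, map_smul,
      real_smul_spinor, spinorB,
      smul_smul]
    rfl
  · rw [htw, smul_mul_smul_comm, twistOp_mul_self, smul_zero]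

theorem liftSpinor_deck (i : (Fin 4 → ℤ) × ℤ × ℤ) (y : EX) :
    spinorPullback (deckLin i : EX →ₗ[ℝ] EX) (liftSpinor (deckLin i y + deckVec i)) =
      liftSpinor y := by
  rw [liftSpinor, liftSpinor, ← expTwo_wedge, ← expTwo_wedge, spinorPullback_wedge,
    spinorPullback_expTwo, spinorPullback_homogeneous, ← liftForm_deck i y]
  rfl

/-- The spinor `e^{iω̃} ∧ π^*dz` on the total space. -/
def totalSpinor : SpinorField EX Total := fun k x => toCont (liftSpinor (chartAt EX x x) k)

theorem val_totalSpinor (x : Total) : totalSpinor.val x = liftSpinor (chartAt EX x x) := rfl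

theorem pullback_totalSpinor (k : ℕ) :
    pullback (E := EX) (E' := EX) toTotal (totalSpinor k) = fun y => toCont (liftSpinor y k) := by
  refine totalCover.pullback_descend (β := fun y => toCont (liftSpinor y k)) fun i y => ?_
  ext v
  exact DFunLike.congr_fun (congrFun (liftSpinor_deck i y) k) v

theorem toCont_liftSpinor (k : ℕ) : (fun y => toCont (liftSpinor y k)) =
    fun y => toCont (spinorA k) + formDx y • toCont (spinorB k) := by
  funext y
  rw [liftSpinor_eq]
  rfl

theorem contDiff_liftSpinor (k : ℕ) : ContDiff ℝ ∞ fun y => toCont (liftSpinor y k) := by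
  rw [toCont_liftSpinor]
  exact contDiff_const.add (formDx.contDiff.smul contDiff_const)

theorem extDeriv_liftSpinor (k : ℕ) (y : EX) :
    extDeriv (fun y => toCont (liftSpinor y k)) y = wedgeOne formDx (toCont (spinorB k)) := by
  rw [toCont_liftSpinor, extDeriv_add_smul]

theorem liftSpinor_one (y : EX) : liftSpinor y 1 (fun _ => (0, 1)) = 1 := by
  rw [liftSpinor, expOp_apply_one]
  simp

theorem liftSpinor_ne_zero (y : EX) : liftSpinor y ≠ 0 := fun h => by
  have := liftSpinor_one y
  rw [h] at this
  simp at this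

/-- The curvature `-dy ∧ θ₁ ∧ θ₃`. -/
def liftCurvature : EX [⋀^Fin 3]→L[ℝ] ℝ := wedgeOne (-formDy) twistForm

theorem liftCurvature_deck (i : (Fin 4 → ℤ) × ℤ × ℤ) :
    liftCurvature.compContinuousLinearMap (deckLin i) = liftCurvature := by
  rw [liftCurvature, wedgeOne_comp]
  congr 1
  ext v
  rw [ContinuousAlternatingMap.compContinuousLinearMap_apply, twistForm_apply, twistForm_apply]
  simp

/-- The curvature on the total space. -/
def totalCurvature : Form EX Total ℝ 3 := fun _ => liftCurvature

theorem pullback_totalCurvature :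
    pullback (E := EX) (E' := EX) toTotal totalCurvature = fun _ => liftCurvature :=
  totalCover.pullback_descend (β := fun _ => liftCurvature) fun i _ => liftCurvature_deck i

theorem smoothFormOn_totalCurvature : SmoothFormOn totalCurvature univ :=
  totalCover.smoothFormOn_of_pullback (by rw [pullback_totalCurvature]; exact contDiffOn_const)

theorem extD_totalCurvature (x : Total) : extD totalCurvature x = 0 := by
  rw [totalCover.extD_apply, pullback_totalCurvature, extDeriv, fderiv_const_apply]
  ext v
  simp [ContinuousAlternatingMap.alternatizeUncurryFin_apply]

/-- In `d_H(e^{iω} ∧ dz)` the derivative of `e^{iω}` contributes `i dx ∧ θ₁ ∧ θ₃` and the curvature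
`-dy ∧ θ₁ ∧ θ₃`; their sum is a multiple of `dz`. -/
theorem dx_add_curvature (y : EX) :
    spinorWedge (oneForm (complexOne formDx)) spinorB +
      spinorWedge (homogeneous (complexify liftCurvature.toAlternatingMap)) (liftSpinor y) = 0 := by
  have hcomm : Commute (expOp constExponent) twistOp := commute_expOp (commute_twoOp_twoOp _ _)
  have hK (ρ : SpinorAt EX) : twistOp (expOp constExponent ρ) = expOp constExponent (twistOp ρ) :=
    (LinearMap.congr_fun hcomm.eq ρ).symm
  have hKK (ρ : SpinorAt EX) : twistOp (twistOp ρ) = 0 := LinearMap.congr_fun twistOp_mul_self ρ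
  have hKB : twistOp (liftSpinor y) = expOp constExponent (twistOp (oneForm formDz)) := by
    rw [liftSpinor_eq,
      real_smul_spinor, map_add, map_smul, spinorB, map_smul, spinorA, hK, hK, hKK, map_zero,
      smul_zero, smul_zero, add_zero]
  rw [liftCurvature, homogeneous_complexify_wedgeOne, spinorWedge_assoc]
  change oneOp _ spinorB + oneOp _ (twistOp (liftSpinor y)) = 0
  rw [hKB, spinorB, map_smul, ← LinearMap.smul_apply, ← LinearMap.add_apply, ← oneOp_smul,
    ← oneOp_add]
  -- `i dx - dy = i dz`
  have hz : Complex.I • complexOne formDx + complexOne (-formDy) = Complex.I • formDz := by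
    ext v
    all_goals simp [Complex.ext_iff]
  have h1 := LinearMap.congr_fun
    (commute_expOp (commute_twoOp_oneOp constExponent formDz)).eq (twistOp (oneForm formDz))
  have h2 := LinearMap.congr_fun
    (commute_twoOp_oneOp (complexify twistForm.toAlternatingMap) formDz).eq (oneForm formDz)
  have h3 : oneOp formDz (oneForm formDz) = 0 := by
    have := oneOp_oneOp_self formDz (unitSpinor EX)
    rwa [spinorWedgeL_apply _ (unitSpinor EX), wedge_unitSpinor] at this
  simp only [Module.End.mul_apply] at h1 h2
  rw [hz, oneOp_smul, LinearMap.smul_apply, ← h1, twistOp, ← h2, h3, map_zero, map_zero, smul_zero]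

theorem val_d_totalSpinor (x : Total) :
    totalSpinor.d.val x = spinorWedge (oneForm (complexOne formDx)) spinorB := by
  funext k
  cases k with
  | zero => rw [oneForm_wedge_zero]; rfl
  | succ k =>
    rw [← toAlternatingMap_wedgeOne_toCont, ← extDeriv_liftSpinor k (chartAt EX x x),
      ← pullback_totalSpinor, ← totalCover.extD_apply]
    rfl

theorem twistedD_totalSpinor (x : Total) : twistedD totalCurvature totalSpinor x = 0 := by
  rw [twistedD, val_d_totalSpinor, val_totalSpinor]
  exact dx_add_curvature _

theorem smoothOn_totalSpinor (U : Set Total) : totalSpinor.SmoothOn U := fun k =>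
  totalCover.smoothFormOn_of_pullback (by
    rw [pullback_totalSpinor]; exact (contDiff_liftSpinor k).contDiffOn)

/-! ### The generalized Calabi–Yau structure -/

/-- The line `e^{iω̃} ∧ κ_I` is spanned by `e^{iω̃} ∧ dz`, since the complex-linear forms on `ℂ`
are the multiples of `dz`. -/
theorem standardLine_eq (x : Total) :
    standardLine ℂ proj totalForm x = Submodule.span ℂ {totalSpinor.val x} := by
  -- the degree `finrank ℂ ℂ` is replaced by a variable, so that it can be set to `1`
  have key : ∀ (n : ℕ), n = 1 → Submodule.span ℂ (Set.range fun γ : ℂ [⋀^Fin n]→L[ℂ] ℂ =>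
      spinorWedge (expTwo (Complex.I • complexify (totalForm x).toAlternatingMap))
        (homogeneous ((γ.restrictScalars ℝ).compContinuousLinearMap
          (diffAt EX ℂ proj x)).toAlternatingMap)) = Submodule.span ℂ {totalSpinor.val x} := by
    rintro n rfl
    have hγ (γ : ℂ [⋀^Fin 1]→L[ℂ] ℂ) :
        spinorWedge (expTwo (Complex.I • complexify (totalForm x).toAlternatingMap))
          (homogeneous ((γ.restrictScalars ℝ).compContinuousLinearMap
            (diffAt EX ℂ proj x)).toAlternatingMap) = γ (fun _ => 1) • totalSpinor.val x := by
      have h1 : ((γ.restrictScalars ℝ).compContinuousLinearMap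
          (diffAt EX ℂ proj x)).toAlternatingMap =
          γ (fun _ => 1) • AlternatingMap.ofSubsingleton ℝ EX ℂ (0 : Fin 1) formDz := by
        ext v
        change γ (fun i => diffAt EX ℂ proj x (v i)) = γ (fun _ => 1) * (v 0).2
        have h2 : (fun i => diffAt EX ℂ proj x (v i)) = fun i : Fin 1 => (v 0).2 • (1 : ℂ) := by
          funext i
          rw [diffAt_proj, Subsingleton.elim i 0]
          simp
        rw [h2, γ.map_smul_univ (fun _ => (v 0).2) fun _ => 1]
        simp [mul_comm]
      rw [h1, ← homogeneousL_apply, map_smul, homogeneousL_apply, ← spinorWedgeL_apply, map_smul,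
        spinorWedgeL_apply, expTwo_wedge]
      rfl
    refine le_antisymm (Submodule.span_le.2 ?_) (Submodule.span_le.2 ?_)
    · rintro _ ⟨γ, rfl⟩
      refine (congrArg (· ∈ Submodule.span ℂ {totalSpinor.val x}) (hγ γ)).mpr ?_
      exact Submodule.smul_mem _ _ (Submodule.mem_span_singleton_self _)
    · rintro _ rfl
      refine Submodule.subset_span
        ⟨ContinuousAlternatingMap.ofSubsingleton ℂ ℂ ℂ (0 : Fin 1) (.id ℂ ℂ), ?_⟩
      exact (hγ _).trans (by simp)
  exact key _ (Module.finrank_self ℂ)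

theorem isGeneratorOn_totalSpinor :
    IsGeneratorOn (standardLine ℂ proj totalForm) totalSpinor univ :=
  ⟨smoothOn_totalSpinor _, fun x _ => ⟨liftSpinor_ne_zero _, standardLine_eq x⟩⟩

theorem isAlmostGeneralizedComplex_standardLine :
    IsAlmostGeneralizedComplex (standardLine ℂ proj totalForm) where
  locally_generated x := ⟨univ, isOpen_univ, mem_univ x, totalSpinor, isGeneratorOn_totalSpinor⟩
  pure x ρ hρ h0 := by
    rw [standardLine_eq] at hρ
    obtain ⟨a, rfl⟩ := Submodule.mem_span_singleton.1 hρ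
    exact isPure_smul (left_ne_zero_of_smul h0)
      (isPure_expOp_oneForm (w := ((0, 1) : EX)) (formDz_apply _))
  real_rank_zero x ρ hρ h0 := by
    rw [standardLine_eq] at hρ
    obtain ⟨a, rfl⟩ := Submodule.mem_span_singleton.1 hρ
    exact hasRealRankZero_smul (left_ne_zero_of_smul h0)
      (hasRealRankZero_expOp_oneForm (w := ((0, 1) : EX)) (w' := ((0, Complex.I) : EX))
        (formDz_apply _) (formDz_apply _) fun u hu h => liftForm_nondegenerate _ u hu h)

/-- The Leibniz rule `d(f g) = df ∧ g + f dg` for a function `f` and a form `g`. -/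
theorem toAlternatingMap_extDeriv_smul {E : Type*} [NormedAddCommGroup E] [NormedSpace ℝ E]
    [FiniteDimensional ℝ E] {f : E → ℂ} (ρ : E → SpinorAt E) {k : ℕ} {y : E}
    (hf : DifferentiableAt ℝ f y) (hg : DifferentiableAt ℝ (fun z => toCont (ρ z k)) y) :
    (extDeriv (fun z => f z • toCont (ρ z k)) y).toAlternatingMap =
      spinorWedge (oneForm (fderiv ℝ f y : E →ₗ[ℝ] ℂ)) (ρ y) (k + 1) +
        f y • (extDeriv (fun z => toCont (ρ z k)) y).toAlternatingMap := by
  ext v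
  rw [AlternatingMap.add_apply, oneForm_wedge_apply]
  change extDeriv (fun z => f z • toCont (ρ z k)) y v = _ + f y • extDeriv _ y v
  have h : fderiv ℝ (fun z => f z • toCont (ρ z k)) y = _ :=
    (hf.hasFDerivAt.smul hg.hasFDerivAt).fderiv
  rw [extDeriv, extDeriv, h, ContinuousAlternatingMap.alternatizeUncurryFin_apply,
    ContinuousAlternatingMap.alternatizeUncurryFin_apply, Finset.smul_sum,
    ← Finset.sum_add_distrib]
  refine Finset.sum_congr rfl fun i _ => ?_
  simp [toCont_apply]
  ring

section Generator
variable {U : Set Total} {ρ : SpinorField EX Total}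

/-- The coefficient of a section of the canonical bundle with respect to `e^{iω̃} ∧ dz`: its
component along `dz`. -/
def coeff (ρ : SpinorField EX Total) (x : Total) : ℂ := ρ 1 x fun _ => (0, 1)

theorem val_eq_coeff_smul (hρ : IsGeneratorOn (standardLine ℂ proj totalForm) ρ U) {x : Total}
    (hx : x ∈ U) : ρ.val x = coeff ρ x • totalSpinor.val x := by
  have h : ρ.val x ∈ standardLine ℂ proj totalForm x := by
    rw [(hρ.2 x hx).2]; exact Submodule.mem_span_singleton_self _
  rw [standardLine_eq] at h
  obtain ⟨a, ha⟩ := Submodule.mem_span_singleton.1 h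
  have h1 : coeff ρ x = a := by
    change ρ.val x 1 (fun _ => (0, 1)) = a
    rw [← ha]
    change a * liftSpinor (chartAt EX x x) 1 (fun _ => (0, 1)) = a
    rw [liftSpinor_one, mul_one]
  rw [h1, ha]

theorem coeff_ne_zero (hρ : IsGeneratorOn (standardLine ℂ proj totalForm) ρ U) {x : Total}
    (hx : x ∈ U) : coeff ρ x ≠ 0 := fun h => (hρ.2 x hx).1 (by
  rw [val_eq_coeff_smul hρ hx, h, zero_smul])

theorem pullback_generator (hρ : IsGeneratorOn (standardLine ℂ proj totalForm) ρ U) {y : EX}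
    (hy : toTotal y ∈ U) (k : ℕ) : pullback (E := EX) (E' := EX) toTotal (ρ k) y =
      coeff ρ (toTotal y) • toCont (liftSpinor y k) := by
  have h : ρ k (toTotal y) = coeff ρ (toTotal y) • totalSpinor k (toTotal y) := by
    ext v
    exact DFunLike.congr_fun (congrFun (val_eq_coeff_smul hρ hy) k) v
  rw [← congrFun (pullback_totalSpinor k) y, pullback, pullback, h]
  rfl

/-- The coefficient is smooth, being a component of the smooth lift of the section. -/
theorem contDiffAt_coeff (hU : IsOpen U)
    (hρ : IsGeneratorOn (standardLine ℂ proj totalForm) ρ U) {y : EX} (hy : toTotal y ∈ U) :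
    ContDiffAt ℝ ∞ (coeff ρ ∘ toTotal) y := by
  have h1 := totalCover.contDiffAt_pullback hU (hρ.1 1) hy
  have h2 : ContDiffAt ℝ ∞
      (fun z => pullback (E := EX) (E' := EX) toTotal (ρ 1) z fun _ => (0, 1)) y :=
    (ContinuousAlternatingMap.apply ℝ EX ℂ fun _ : Fin 1 => ((0, 1) : EX)).contDiff.contDiffAt.comp
      y h1
  refine h2.congr_of_eventuallyEq ?_
  filter_upwards [(hU.preimage totalCover.continuous).mem_nhds hy] with z hz
  rw [pullback_generator hρ hz, ContinuousAlternatingMap.smul_apply, toCont_apply, liftSpinor_one,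
    smul_eq_mul, mul_one]
  rfl

theorem mdifferentiableAt_coeff (hU : IsOpen U)
    (hρ : IsGeneratorOn (standardLine ℂ proj totalForm) ρ U) {y : EX} (hy : toTotal y ∈ U) :
    MDifferentiableAt 𝓘(ℝ, EX) 𝓘(ℝ, ℂ) (coeff ρ) (toTotal y) :=
  (totalCover.contMDiffAt_of_comp (contDiffAt_coeff hU hρ hy).contMDiffAt).mdifferentiableAt
    (by simp)

/-- The logarithmic derivative of the coefficient of a generator. -/
def logDeriv (ρ : SpinorField EX Total) : Form EX Total ℂ 1 := fun x =>
  altOne ((coeff ρ x)⁻¹ • diffAt EX ℂ (coeff ρ) x)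

theorem smoothFormOn_logDeriv (hU : IsOpen U)
    (hρ : IsGeneratorOn (standardLine ℂ proj totalForm) ρ U) :
    SmoothFormOn (logDeriv ρ) U := by
  refine totalCover.smoothFormOn_of_pullback fun y hy => ContDiffAt.contDiffWithinAt ?_
  have hf := contDiffAt_coeff hU hρ hy
  have h1 : ContDiffAt ℝ ∞ (fun z => (coeff ρ (toTotal z))⁻¹ •
      fderiv ℝ (coeff ρ ∘ toTotal) z) y :=
    (hf.inv (coeff_ne_zero hρ hy)).smul (hf.fderiv_right (m := ∞) (by simp))
  have h2 := (ContinuousAlternatingMap.ofSubsingletonLIE (𝕜 := ℝ) (E := EX) (F := ℂ)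
    (0 : Fin 1)).toContinuousLinearEquiv.contDiff.contDiffAt.comp y h1
  refine h2.congr_of_eventuallyEq ?_
  filter_upwards [(hU.preimage totalCover.continuous).mem_nhds hy] with z hz
  have h3 := diffAt_comp (mdifferentiableAt_coeff hU hρ hz) (totalCover.mdifferentiableAt z)
  rw [diffAt_eq_fderiv] at h3
  ext v
  change (coeff ρ (toTotal z))⁻¹ •
    diffAt EX ℂ (coeff ρ) (toTotal z) (diffAt EX EX toTotal z (v 0)) =
    (coeff ρ (toTotal z))⁻¹ • fderiv ℝ (coeff ρ ∘ toTotal) z (v 0)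
  rw [h3]
  rfl

/-- For `ρ = f e^{iω̃} ∧ dz` the closedness of `e^{iω̃} ∧ dz` leaves `d_H ρ = df ∧ e^{iω̃} ∧ dz`. -/
theorem twistedD_generator (hU : IsOpen U)
    (hρ : IsGeneratorOn (standardLine ℂ proj totalForm) ρ U) {x : Total} (hx : x ∈ U) :
    twistedD totalCurvature ρ x =
      spinorWedge (oneForm (diffAt EX ℂ (coeff ρ) x : EX →ₗ[ℝ] ℂ)) (totalSpinor.val x) := by
  set y := chartAt EX x x with hy
  have hxy : toTotal y = x := totalCover.apply_chartAt_self x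
  have hyU : toTotal y ∈ U := by rwa [hxy]
  have hd : diffAt EX ℂ (coeff ρ) x = fderiv ℝ (coeff ρ ∘ toTotal) y := by
    rw [← diffAt_eq_fderiv]
    exact totalCover.diffAt_of_lift rfl (by
      rw [← hxy]; exact mdifferentiableAt_coeff hU hρ hyU)
  have hdρ : ρ.d.val x =
      spinorWedge (oneForm (diffAt EX ℂ (coeff ρ) x : EX →ₗ[ℝ] ℂ)) (totalSpinor.val x) +
        coeff ρ x • totalSpinor.d.val x := by
    funext k
    cases k with
    | zero =>
      rw [Pi.add_apply, oneForm_wedge_zero]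
      change (0 : EX [⋀^Fin 0]→ₗ[ℝ] ℂ) = 0 + coeff ρ x • 0
      rw [smul_zero, add_zero]
    | succ k =>
      have h1 : pullback (E := EX) (E' := EX) toTotal (ρ k) =ᶠ[𝓝 y]
          fun z => (coeff ρ ∘ toTotal) z • toCont (liftSpinor z k) := by
        filter_upwards [(hU.preimage totalCover.continuous).mem_nhds hyU] with z hz
        exact pullback_generator hρ hz k
      change (extD (ρ k) x).toAlternatingMap =
        _ + coeff ρ x • (extD (totalSpinor k) x).toAlternatingMap
      rw [totalCover.extD_apply, totalCover.extD_apply, ← hy, h1.extDeriv_eq, pullback_totalSpinor,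
        toAlternatingMap_extDeriv_smul liftSpinor
          ((contDiffAt_coeff hU hρ hyU).differentiableAt (by simp))
          ((contDiff_liftSpinor k).differentiable (by simp) y), hd, Function.comp_apply, hxy]
      rfl
  have h0 := twistedD_totalSpinor x
  rw [twistedD] at h0
  rw [twistedD, hdρ, val_eq_coeff_smul hρ hx,
    ← spinorWedgeL_apply (homogeneous (complexify _)), map_smul,
    spinorWedgeL_apply, add_assoc, ← smul_add, h0, smul_zero, add_zero]

end Generator

theorem isGeneralizedComplex_standardLine :
    IsGeneralizedComplex totalCurvature (standardLine ℂ proj totalForm) where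
  almost := isAlmostGeneralizedComplex_standardLine
  smooth_curvature := smoothFormOn_totalCurvature
  closed_curvature := extD_totalCurvature
  integrable U hU ρ hρ := by
    have h0 : SmoothVectorFieldOn (fun _ : Total => (0 : EX)) U := fun c => by
      simp only [map_zero]; exact contDiffOn_const
    refine ⟨fun _ => 0, fun _ => 0, logDeriv ρ, h0, h0, smoothFormOn_logDeriv hU hρ,
      fun x hx => ?_⟩
    have h1 : (AlternatingMap.ofSubsingleton ℝ EX ℂ (0 : Fin 1)).symm
        (logDeriv ρ x).toAlternatingMap =
          (coeff ρ x)⁻¹ • (diffAt EX ℂ (coeff ρ) x : EX →ₗ[ℝ] ℂ) := rfl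
    rw [twistedD_generator hU hρ hx, val_eq_coeff_smul hρ hx, clifford_smul, h1,
      TensorProduct.tmul_zero, TensorProduct.tmul_zero, add_zero, clifford]
    simp only [← contractL_apply, ← spinorWedgeL_apply, map_zero, LinearMap.zero_apply, zero_add]
    change _ = coeff ρ x • oneOp ((coeff ρ x)⁻¹ • _) _
    rw [oneOp_smul, LinearMap.smul_apply, smul_smul, mul_inv_cancel₀ (coeff_ne_zero hρ hx),
      one_smul]

theorem isGeneralizedCalabiYau_standardLine :
    IsGeneralizedCalabiYau totalCurvature (standardLine ℂ proj totalForm) :=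
  ⟨isGeneralizedComplex_standardLine, totalSpinor, isGeneratorOn_totalSpinor,
    twistedD_totalSpinor⟩

theorem induces_standardLine : Induces ℂ (standardLine ℂ proj totalForm) proj totalForm :=
  fun x => ⟨0, (totalForm x).toAlternatingMap, fun _ _ => rfl, by
    have : complexify (0 : EX [⋀^Fin 2]→ₗ[ℝ] ℝ) = 0 := by ext v; simp [complexify]
    rw [this, zero_add, standardLine]⟩

/-! ### The obstruction to flatness -/

/-- A closed `2`-form along the fibre over `0` of `ℝ⁴ × ℂ`, periodic in the fibre directions,
cannot have `θ₁ ∧ θ₃`-component equal to `x`: its average over the `2`-torus in the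
`(t₁, t₃)`-directions would have derivative `1` along `∂/∂x`, while closedness expresses this
derivative as a divergence. -/
theorem not_closed_of_periodic {β : EX → EX [⋀^Fin 2]→L[ℝ] ℝ}
    (hd : ∀ a : E4, DifferentiableAt ℝ β (a, 0))
    (hp : ∀ (a : E4) (n : Fin 4 → ℤ), β (a + intVec n, 0) = β (a, 0))
    (hv : ∀ᶠ z in 𝓝 (0 : ℂ), ∀ a : E4,
      β (a, z) ![(EuclideanSpace.single 0 1, 0), (EuclideanSpace.single 2 1, 0)] = z.re)
    (hc : ∀ a : E4, extDeriv β (a, 0)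
      ![(0, 1), (EuclideanSpace.single 0 1, 0), (EuclideanSpace.single 2 1, 0)] = 0) : False := by
  set u₀ : EX := (EuclideanSpace.single 0 1, 0) with hu₀
  set u₂ : EX := (EuclideanSpace.single 2 1, 0) with hu₂
  set uₓ : EX := (0, 1) with huₓ
  have happ (v : Fin 2 → EX) (a : E4) : DifferentiableAt ℝ (fun y => β y v) (a, 0) :=
    (ContinuousAlternatingMap.apply ℝ EX ℝ v).differentiableAt.comp _ (hd a)
  -- `∂_x β(∂₁, ∂₃) = 1`
  have hx (a : E4) : fderiv ℝ (fun y => β y ![u₀, u₂]) (a, 0) uₓ = 1 := by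
    have h1 : HasDerivAt (fun t : ℝ => ((a, (t : ℂ)) : EX)) uₓ 0 :=
      (hasDerivAt_const (0 : ℝ) a).prodMk Complex.ofRealCLM.hasDerivAt
    have h2 : HasDerivAt (fun t : ℝ => β (a, (t : ℂ)) ![u₀, u₂])
        (fderiv ℝ (fun y => β y ![u₀, u₂]) (a, 0) uₓ) 0 := by
      have h3 : HasFDerivAt (fun y => β y ![u₀, u₂])
          (fderiv ℝ (fun y => β y ![u₀, u₂]) (a, 0)) ((a, ((0 : ℝ) : ℂ)) : EX) := by
        rw [Complex.ofReal_zero]; exact (happ _ a).hasFDerivAt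
      exact h3.comp_hasDerivAt 0 h1
    have h4 : (fun t : ℝ => β (a, (t : ℂ)) ![u₀, u₂]) =ᶠ[𝓝 0] fun t => t := by
      have : Filter.Tendsto (fun t : ℝ => (t : ℂ)) (𝓝 0) (𝓝 0) := by
        simpa using Complex.continuous_ofReal.tendsto 0
      filter_upwards [this.eventually hv] with t ht
      rw [ht, Complex.ofReal_re]
    exact h2.unique ((hasDerivAt_id (0 : ℝ)).congr_of_eventuallyEq h4)
  -- so closedness makes `1` a divergence
  have hdiv (a : E4) : fderiv ℝ (fun y => β y ![uₓ, u₂]) (a, 0) u₀ -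
      fderiv ℝ (fun y => β y ![uₓ, u₀]) (a, 0) u₂ = 1 := by
    have h := hc a
    rw [extDeriv_apply (hd a), Fin.sum_univ_three] at h
    have e0 : (0 : Fin 3).removeNth ![uₓ, u₀, u₂] = ![u₀, u₂] := by
      ext i : 1; fin_cases i <;> rfl
    have e1 : (1 : Fin 3).removeNth ![uₓ, u₀, u₂] = ![uₓ, u₂] := by
      ext i : 1; fin_cases i <;> rfl
    have e2 : (2 : Fin 3).removeNth ![uₓ, u₀, u₂] = ![uₓ, u₀] := by
      ext i : 1; fin_cases i <;> rfl
    rw [e0, e1, e2] at h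
    have h' := hx a
    simp at h
    linarith
  -- the plane spanned by `∂₁` and `∂₃`
  let P : ℝ × ℝ →L[ℝ] EX :=
    (ContinuousLinearMap.fst ℝ ℝ ℝ).smulRight u₀ + (ContinuousLinearMap.snd ℝ ℝ ℝ).smulRight u₂
  have hP (p : ℝ × ℝ) : P p = ((P p).1, 0) := Prod.ext rfl (by simp [P, hu₀, hu₂])
  have hP0 : P (1, 0) = u₀ := by simp [P]
  have hP2 : P (0, 1) = u₂ := by simp [P]
  have hF (v : Fin 2 → EX) (p : ℝ × ℝ) : HasFDerivAt (fun p => β (P p) v)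
      ((fderiv ℝ (fun y => β y v) (P p)).comp P) p := by
    have h1 : HasFDerivAt (fun y => β y v) (fderiv ℝ (fun y => β y v) (P p)) (P p) := by
      rw [hP]; exact (happ v _).hasFDerivAt
    exact h1.comp p P.hasFDerivAt
  have hone (p : ℝ × ℝ) : ((fderiv ℝ (fun y => β y ![uₓ, u₂]) (P p)).comp P) (1, 0) +
      (-((fderiv ℝ (fun y => β y ![uₓ, u₀]) (P p)).comp P)) (0, 1) = 1 := by
    have h := hdiv (P p).1
    rw [← hP] at h
    change fderiv ℝ (fun y => β y ![uₓ, u₂]) (P p) (P (1, 0)) +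
      -(fderiv ℝ (fun y => β y ![uₓ, u₀]) (P p) (P (0, 1))) = 1
    rw [hP0, hP2]
    linarith
  have hcont (v : Fin 2 → EX) : Continuous fun p => β (P p) v :=
    continuous_iff_continuousAt.2 fun p => (hF v p).continuousAt
  -- by periodicity the boundary terms on opposite sides of the unit square cancel
  have hper0 (s : ℝ) : β (P (s, 1)) = β (P (s, 0)) := by
    have h1 := hp (P (s, 0)).1 ![0, 0, 1, 0]
    rw [← hP] at h1
    rw [← h1, hP (s, 1)]
    congr 2
    apply E4_ext <;> simp [P, hu₀, hu₂]
  have hper2 (t : ℝ) : β (P (1, t)) = β (P (0, t)) := by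
    have h1 := hp (P (0, t)).1 ![1, 0, 0, 0]
    rw [← hP] at h1
    rw [← h1, hP (1, t)]
    congr 2
    apply E4_ext <;> simp [P, hu₀, hu₂]
  have key := MeasureTheory.integral2_divergence_prod_of_hasFDerivAt
    (fun p => β (P p) ![uₓ, u₂]) (fun p => -β (P p) ![uₓ, u₀])
    (fun p => (fderiv ℝ (fun y => β y ![uₓ, u₂]) (P p)).comp P)
    (fun p => -(fderiv ℝ (fun y => β y ![uₓ, u₀]) (P p)).comp P) 0 0 1 1
    (hcont _).continuousOn (hcont _).neg.continuousOn
    (fun p _ => hF _ p) (fun p _ => (hF _ p).neg) (by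
      simp only [hone]
      exact continuous_const.continuousOn.integrableOn_compact
        (isCompact_uIcc.prod isCompact_uIcc))
  simp only [hone, hper0, hper2] at key
  simp at key

/-- The exterior derivative commutes with the pullback along a covering. -/
theorem IsAffineCover.extDeriv_pullback_cover {E F ι X : Type*} [NormedAddCommGroup E]
    [NormedSpace ℝ E] [NormedAddCommGroup F] [NormedSpace ℝ F] [TopologicalSpace X]
    [ChartedSpace E X] {L : ι → E →L[ℝ] E} {v : ι → E} {Q : E → X} (h : IsAffineCover L v Q) {k : ℕ}
    {α : Form E X F k} (hα : SmoothFormOn α univ) (y : E) :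
    extDeriv (pullback (E := E) (E' := E) Q α) y = pullback (E := E) (E' := E) Q (extD α) y := by
  obtain ⟨i, hi, hi'⟩ := h.exists_diffAt y
  have hd : ∀ z, HasFDerivAt (fun z => L i z + v i) (L i) z := fun z =>
    (L i).hasFDerivAt.add_const _
  have h0 : DifferentiableAt ℝ (pullback (E := E) (E' := E) Q α) (L i y + v i) :=
    (h.contDiffAt_pullback isOpen_univ hα (mem_univ _)).differentiableAt (by simp)
  have h1 := extDeriv_pullback (f := fun z => L i z + v i) (x := y) (r := 2) h0
    (by fun_prop) (by simp)
  simp only [(hd _).fderiv, h.pullback_deck] at h1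
  rw [pullback, hi', h.extD_apply, hi, ← h1]

/-- The pullback of a closed form along a smooth map from a normed space is differentiable and
closed. -/
theorem IsAffineCover.extDeriv_pullback_map {E E₁ F ι X : Type*} [NormedAddCommGroup E]
    [NormedSpace ℝ E] [NormedAddCommGroup F] [NormedSpace ℝ F] [TopologicalSpace X]
    [NormedAddCommGroup E₁] [NormedSpace ℝ E₁]
    [ChartedSpace E X] {L : ι → E →L[ℝ] E} {v : ι → E} {Q : E → X} (h : IsAffineCover L v Q) {k : ℕ}
    {α : Form E X F k} (hα : SmoothFormOn α univ) (hc : ∀ x, extD α x = 0) {g : E₁ → X} {y : E₁}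
    (hg : ∀ᶠ z in 𝓝 y, ContMDiffAt 𝓘(ℝ, E₁) 𝓘(ℝ, E) ∞ g z) :
    DifferentiableAt ℝ (pullback (E := E₁) (E' := E) g α) y ∧
      extDeriv (pullback (E := E₁) (E' := E) g α) y = 0 := by
  have := h.isManifold
  set c := chartAt E (g y) with hcdef
  have hsrc : ∀ᶠ z in 𝓝 y, g z ∈ c.source :=
    hg.self_of_nhds.continuousAt (c.open_source.mem_nhds (mem_chart_source E (g y)))
  -- near `y` the map `g` lifts to a map `l` into `E`
  set l : E₁ → E := fun z => c (g z) with hl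
  have hlift : ∀ᶠ z in 𝓝 y, ContDiffAt ℝ ∞ l z := by
    filter_upwards [hg, hsrc] with z hz hz'
    exact ((contMDiffAt_of_mem_maximalAtlas
      (h.mem_maximalAtlas (chart_mem_atlas E (g y))) hz').comp z hz).contDiffAt
  have hQl : ∀ᶠ z in 𝓝 y, Q (l z) = g z := by
    filter_upwards [hsrc] with z hz using h.apply_of_mem_atlas (chart_mem_atlas E (g y)) hz
  have heq : pullback (E := E₁) (E' := E) g α =ᶠ[𝓝 y] fun z =>
      (pullback (E := E) (E' := E) Q α (l z)).compContinuousLinearMap (fderiv ℝ l z) := by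
    filter_upwards [hQl.eventually_nhds, hlift] with z hz hlz
    have h1 : diffAt E₁ E g z = (diffAt E E Q (l z)).comp (diffAt E₁ E l z) := by
      rw [← diffAt_comp (h.mdifferentiableAt _)
        (hlz.differentiableAt (by simp)).mdifferentiableAt]
      exact (diffAt_congr hz).symm
    rw [pullback, pullback, h1, diffAt_eq_fderiv, hz.self_of_nhds]
    rfl
  have hα' : DifferentiableAt ℝ (pullback (E := E) (E' := E) Q α) (l y) :=
    (h.contDiffAt_pullback isOpen_univ hα (mem_univ _)).differentiableAt (by simp)
  have hly := hlift.self_of_nhds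
  refine ⟨?_, ?_⟩
  · refine DifferentiableAt.congr_of_eventuallyEq ?_ heq
    exact (hα'.comp y
      (hly.differentiableAt (by simp))).continuousAlternatingMapCompContinuousLinearMap
      ((hly.fderiv_right (m := ∞) (by simp)).differentiableAt (by simp))
  · rw [heq.extDeriv_eq, extDeriv_pullback hα' hly (by simpa using ENat.LEInfty.out),
      h.extDeriv_pullback_cover hα,
      pullback, hc]
    rfl

/-- The lift of a form to `ℝ⁴ × ℂ` is periodic in the fibre directions. -/
theorem pullback_toTotal_add {F : Type*} [NormedAddCommGroup F] [NormedSpace ℝ F] {k : ℕ}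
    (α : Form EX Total F k) (a : E4) (z : ℂ) (n : Fin 4 → ℤ) :
    pullback (E := EX) (E' := EX) toTotal α (a + intVec n, z) =
      pullback (E := EX) (E' := EX) toTotal α (a, z) := by
  have hL : deckLin (n, 0) = .id ℝ EX := by
    ext1 <;> ext1 v <;> simp [shear_zero]
  have hv : deckLin (n, 0) (a, z) + deckVec (n, 0) = (a + intVec n, z) := by
    rw [deck_apply]; simp [shear_zero, gauss]
  have h := totalCover.pullback_deck α (n, 0) (a, z)
  rw [hv, hL] at h
  exact h

theorem diffAt_toTotal_snd (y v : EX) : (diffAt EX EX toTotal y v).2 = v.2 := by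
  obtain ⟨i, -, hi⟩ := totalCover.exists_diffAt y
  rw [hi, deckLin_apply]

/-- A primitive `τ` of the fibrewise class of `dω̃` would make `ω - τ` contradict
`not_closed_of_periodic`. -/
theorem not_isGaussManinFlat : ¬ IsGaussManinFlat ℂ proj 0 totalForm := by
  rintro ⟨τ, hτ, hτ1, hτ2⟩
  have hvert (y v : EX) (hv : v.2 = 0) :
      IsVertical ℂ proj (toTotal y) (diffAt EX EX toTotal y v) :=
    (isVertical_iff _ _).2 ((diffAt_toTotal_snd y v).trans hv)
  set β : EX → EX [⋀^Fin 2]→L[ℝ] ℝ :=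
    fun y => liftForm y - pullback (E := EX) (E' := EX) toTotal τ y with hβ
  have hdτ (y : EX) : DifferentiableAt ℝ (pullback (E := EX) (E' := EX) toTotal τ) y :=
    (totalCover.contDiffAt_pullback isOpen_univ hτ (mem_univ _)).differentiableAt (by simp)
  have hdl (y : EX) : DifferentiableAt ℝ liftForm y := contDiff_liftForm.differentiable (by simp) y
  refine not_closed_of_periodic (β := β) (fun a => (hdl _).sub (hdτ _)) (fun a n => ?_)
    (.of_forall fun z a => ?_) fun a => ?_
  · simp only [hβ, ← pullback_totalForm, pullback_toTotal_add]
  · have h0 : pullback (E := EX) (E' := EX) toTotal τ (a, z)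
        ![(EuclideanSpace.single 0 1, 0), (EuclideanSpace.single 2 1, 0)] = 0 := by
      refine hτ1 _ _ ⟨Finset.univ, by simp, fun i _ => hvert _ _ ?_⟩
      fin_cases i <;> rfl
    rw [hβ, ContinuousAlternatingMap.sub_apply, h0, liftForm_apply]
    simp
  · have h1 : extDeriv β (a, 0) = pullback (E := EX) (E' := EX) toTotal
        (extD totalForm - extD τ) (a, 0) := by
      have h2 : extDeriv β (a, 0) = extDeriv liftForm (a, 0) -
          extDeriv (pullback (E := EX) (E' := EX) toTotal τ) (a, 0) := by
        ext v
        rw [ContinuousAlternatingMap.sub_apply, extDeriv, extDeriv, extDeriv,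
          fderiv_fun_sub (hdl _) (hdτ _)]
        simp [ContinuousAlternatingMap.alternatizeUncurryFin_apply, Finset.sum_sub_distrib,
          smul_sub]
      rw [h2, totalCover.extDeriv_pullback_cover hτ, ← pullback_totalForm,
        totalCover.extDeriv_pullback_cover smoothFormOn_totalForm]
      rfl
    rw [h1]
    refine hτ2 _ _ ⟨{1, 2}, by decide, fun i hi => hvert _ _ ?_⟩
    fin_cases i
    · simp at hi
    · rfl
    · rfl

/-- In a symplectic trivialization around `0 ∈ B`, the pullback of the symplectic form of the model
fibre is closed and agrees with `ω` on the fibres, contradicting `not_closed_of_periodic`. -/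
theorem not_isSymplecticFibreBundle :
    ¬ IsSymplecticFibreBundle (G := E4) ℂ Torus proj totalForm := by
  intro H
  obtain ⟨e, σ, hb, ⟨he, he'⟩, hσ, hΩ⟩ := H (toBase 0)
  set g : EX → Torus := fun y => (e (toTotal y)).2 with hg
  have hsrc (y : EX) (hy : toBase y.2 ∈ e.baseSet) : toTotal y ∈ e.source := by
    rw [e.mem_source, proj_toTotal]; exact hy
  have hh (x : Total) (hx : x ∈ e.source) :
      ContMDiffAt 𝓘(ℝ, EX) 𝓘(ℝ, E4) ∞ (fun x => (e x).2) x :=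
    ((he x hx).contMDiffAt (e.open_source.mem_nhds hx)).snd
  have hgs (y : EX) (hy : toBase y.2 ∈ e.baseSet) : ContMDiffAt 𝓘(ℝ, EX) 𝓘(ℝ, E4) ∞ g y :=
    (hh _ (hsrc y hy)).comp y totalCover.contMDiff.contMDiffAt
  have hopen : IsOpen {y : EX | toBase y.2 ∈ e.baseSet} :=
    e.open_baseSet.preimage (baseCover.continuous.comp continuous_snd)
  have hnear (a : E4) : ∀ᶠ y : EX in 𝓝 (a, 0), toBase y.2 ∈ e.baseSet :=
    hopen.mem_nhds hb
  have key (a : E4) := torusCover.extDeriv_pullback_map hσ.smooth hσ.closed (g := g) (y := (a, 0))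
    ((hnear a).mono hgs)
  refine not_closed_of_periodic (β := pullback (E := EX) (E' := E4) g σ) (fun a => (key a).1)
    (fun a n => ?_) ?_ fun a => ?_
  · have hpb (y : EX) (hy : toBase y.2 ∈ e.baseSet) : pullback (E := EX) (E' := E4) g σ y =
        pullback (E := EX) (E' := EX) toTotal
          (pullback (E := EX) (E' := E4) (fun x => (e x).2) σ) y := by
      have h1 := diffAt_comp (g := fun x => (e x).2) (f := toTotal) (x := y)
        ((hh _ (hsrc y hy)).mdifferentiableAt (by simp)) (totalCover.mdifferentiableAt y)
      change (σ _).compContinuousLinearMap (diffAt EX E4 ((fun x => (e x).2) ∘ toTotal) y) = _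
      rw [h1]
      rfl
    rw [hpb _ hb, hpb _ hb, pullback_toTotal_add]
  · have hz : ∀ᶠ z : ℂ in 𝓝 0, toBase z ∈ e.baseSet :=
      (e.open_baseSet.preimage baseCover.continuous).mem_nhds hb
    filter_upwards [hz] with z hz a
    set ψ : Torus → Total := fun f => e.toOpenPartialHomeomorph.symm (toBase z, f) with hψ
    set j : E4 → EX := fun a => (a, z) with hj
    have hψs (f : Torus) : MDifferentiableAt 𝓘(ℝ, E4) 𝓘(ℝ, EX) ψ f := by
      have hmem : (toBase z, f) ∈ e.target := e.mem_target.2 hz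
      have h1 := (he' _ hmem).contMDiffAt (e.open_target.mem_nhds hmem)
      exact (h1.comp f (contMDiffAt_const.prodMk contMDiffAt_id)).mdifferentiableAt (by simp)
    have hdj : HasFDerivAt j (.inl ℝ E4 ℂ) a := hasFDerivAt_prodMk_left a z
    -- on the slice over `z` the inverse `ψ` of the trivialization recovers the quotient map
    have hcomp : ψ ∘ (g ∘ j) = toTotal ∘ j := by
      funext b
      have hx := hsrc (j b) hz
      have h2 : e (toTotal (j b)) = (toBase z, (e (toTotal (j b))).2) :=
        Prod.ext (by rw [e.coe_fst hx, proj_toTotal]) rfl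
      change e.toOpenPartialHomeomorph.symm (toBase z, (e (toTotal (j b))).2) = _
      rw [← h2]
      exact e.toOpenPartialHomeomorph.left_inv hx
    have hgd : MDifferentiableAt 𝓘(ℝ, EX) 𝓘(ℝ, E4) g (j a) :=
      (hgs (j a) hz).mdifferentiableAt (by simp)
    have hjd : MDifferentiableAt 𝓘(ℝ, E4) 𝓘(ℝ, EX) j a := hdj.differentiableAt.mdifferentiableAt
    have hd1 := diffAt_comp (hψs ((g ∘ j) a)) (hgd.comp a hjd)
    rw [hcomp, diffAt_comp (totalCover.mdifferentiableAt _) hjd, diffAt_comp hgd hjd,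
      diffAt_eq_fderiv, hdj.fderiv] at hd1
    have hd2 (u : E4) : diffAt EX EX toTotal (a, z) (u, 0) =
        diffAt E4 EX ψ (g (a, z)) (diffAt EX E4 g (a, z) (u, 0)) :=
      DFunLike.congr_fun hd1 u
    have hx : ψ (g (a, z)) = toTotal (a, z) := congrFun hcomp a
    have hval : pullback (E := EX) (E' := E4) g σ (a, z)
        ![(EuclideanSpace.single 0 1, 0), (EuclideanSpace.single 2 1, 0)] =
          pullback (E := EX) (E' := EX) toTotal totalForm (a, z)
            ![(EuclideanSpace.single 0 1, 0), (EuclideanSpace.single 2 1, 0)] := by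
      rw [← hΩ _ hz]
      change totalForm (ψ (g (a, z))) _ = totalForm (toTotal (a, z)) _
      rw [hx]
      congr 1
      funext i
      fin_cases i
      · exact (hd2 _).symm
      · exact (hd2 _).symm
    rw [hval, pullback_totalForm, liftForm_apply]
    simp
  · rw [(key a).2]
    rfl

end GenCplx

end

theorem mainTheorem10 :
    ∃ -- the torus `T = ℝ⁴ / ℤ⁴`
      (T : Type) (_ : TopologicalSpace T) (_ : ChartedSpace (EuclideanSpace ℝ (Fin 4)) T)
      (_ : IsManifold 𝓘(ℝ, EuclideanSpace ℝ (Fin 4)) ∞ T) (p : EuclideanSpace ℝ (Fin 4) → T)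
      -- the complex torus `B = ℂ / (ℤ + iℤ)`
      (B : Type) (_ : TopologicalSpace B) (_ : ChartedSpace ℂ B)
      (_ : IsManifold 𝓘(ℂ, ℂ) ∞ B) (r : ℂ → B)
      -- the monodromy
      (lam : Multiplicative (ℤ × ℤ) →* Equiv.Perm T)
      -- the total space `X = (T × ℂ) / (ℤ + iℤ)`
      (X : Type) (_ : TopologicalSpace X)
      (_ : ChartedSpace (EuclideanSpace ℝ (Fin 4) × ℂ) X)
      (_ : IsManifold 𝓘(ℝ, EuclideanSpace ℝ (Fin 4) × ℂ) ∞ X) (q : T × ℂ → X)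
      -- the projection and the form
      (π : X → B) (Ω : GenCplx.Form (EuclideanSpace ℝ (Fin 4) × ℂ) X ℝ 2),
      GenCplx.IsManifoldQuotient 𝓘(ℝ, EuclideanSpace ℝ (Fin 4)) 𝓘(ℝ, EuclideanSpace ℝ (Fin 4)) p
        (fun a a' => ∃ n : Fin 4 → ℤ, ∀ i, a' i = a i + n i) ∧
      GenCplx.IsManifoldQuotient 𝓘(ℂ, ℂ) 𝓘(ℂ, ℂ) r
        (fun z z' => ∃ m n : ℤ, z' = z + m + n * Complex.I) ∧
      (∀ a : EuclideanSpace ℝ (Fin 4), lam (Multiplicative.ofAdd (1, 0)) (p a) =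
        p !₂[a 0, a 1 - a 2, a 2, a 3]) ∧
      lam (Multiplicative.ofAdd (0, 1)) = 1 ∧
      GenCplx.IsManifoldQuotient (𝓘(ℝ, EuclideanSpace ℝ (Fin 4)).prod 𝓘(ℝ, ℂ))
        𝓘(ℝ, EuclideanSpace ℝ (Fin 4) × ℂ) q
        (fun y y' => ∃ m n : ℤ, y'.1 = lam (Multiplicative.ofAdd (m, n)) y.1 ∧
          y'.2 = y.2 + m + n * Complex.I) ∧
      (∀ y : T × ℂ, π (q y) = r y.2) ∧
      -- `Ω` pulls back to `θ₁ ∧ θ₂ + θ₃ ∧ θ₄ + x θ₁ ∧ θ₃` on `ℝ⁴ × ℂ`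
      (∀ (y u v : EuclideanSpace ℝ (Fin 4) × ℂ),
        GenCplx.pullback (fun y : EuclideanSpace ℝ (Fin 4) × ℂ => q (p y.1, y.2)) Ω y ![u, v] =
          (u.1 0 * v.1 1 - u.1 1 * v.1 0) + (u.1 2 * v.1 3 - u.1 3 * v.1 2) +
            y.2.re * (u.1 0 * v.1 2 - u.1 2 * v.1 0)) ∧
      (T2Space T ∧ CompactSpace T ∧ ConnectedSpace T) ∧
      (T2Space B ∧ CompactSpace B ∧ ConnectedSpace B) ∧
      (T2Space X ∧ CompactSpace X ∧ ConnectedSpace X) ∧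
      -- a smooth symplectic family over a complex manifold
      GenCplx.IsSmoothSymplecticFamily (G := EuclideanSpace ℝ (Fin 4)) ℂ T π Ω ∧
      -- generalized complex, and generalized Calabi–Yau through `e^{iΩ} ∧ κ_I`
      GenCplx.IsGeneralizedComplexFamily ℂ π Ω ∧
      (∃ H : GenCplx.Form (EuclideanSpace ℝ (Fin 4) × ℂ) X ℝ 3,
        GenCplx.IsGeneralizedCalabiYau H (GenCplx.standardLine ℂ π Ω) ∧
          GenCplx.Induces ℂ (GenCplx.standardLine ℂ π Ω) π Ω) ∧
      -- the class of the leafwise symplectic form is not flat; not a symplectic fibre bundle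
      ¬ GenCplx.IsGaussManinFlat ℂ π 0 Ω ∧
      ¬ GenCplx.IsSymplecticFibreBundle (G := EuclideanSpace ℝ (Fin 4)) ℂ T π Ω := by
  refine ⟨GenCplx.Torus, inferInstance, inferInstance, GenCplx.torusCover.isManifold,
    GenCplx.toTorus, GenCplx.Base, inferInstance, inferInstance, GenCplx.baseCover.isManifold,
    GenCplx.toBase, GenCplx.monodromy, GenCplx.Total, inferInstance, inferInstance,
    GenCplx.totalCover.isManifold, GenCplx.torusToTotal, GenCplx.proj, GenCplx.totalForm,
    ⟨GenCplx.torusCover.surjective, GenCplx.torusCover.isLocalDiffeomorph, fun a a' => ?_⟩,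
    ⟨GenCplx.baseCover.surjective, GenCplx.baseCover.isLocalDiffeomorph, fun z z' => ?_⟩,
    fun a => ?_, ?_,
    ⟨?_, GenCplx.isLocalDiffeomorph_torusToTotal, GenCplx.torusToTotal_eq_iff⟩,
    GenCplx.proj_torusToTotal, fun y u v => ?_,
    ⟨inferInstance, inferInstance, inferInstance⟩, ⟨inferInstance, inferInstance, inferInstance⟩,
    ⟨inferInstance, inferInstance, inferInstance⟩,
    GenCplx.isSmoothSymplecticFamily,
    ⟨GenCplx.totalCurvature, _, GenCplx.isGeneralizedComplex_standardLine,
      GenCplx.induces_standardLine⟩,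
    ⟨GenCplx.totalCurvature, GenCplx.isGeneralizedCalabiYau_standardLine,
      GenCplx.induces_standardLine⟩,
    GenCplx.not_isGaussManinFlat, GenCplx.not_isSymplecticFibreBundle⟩
  · rw [GenCplx.toTorus_eq_iff]
    refine exists_congr fun n => ⟨fun h i => by rw [h]; rfl, fun h => ?_⟩
    ext i
    exact h i
  · rw [GenCplx.toBase_eq_iff, Prod.exists]
    simp only [GenCplx.gauss, add_assoc]
  · rw [GenCplx.monodromy_toTorus]
    congr 1
    apply GenCplx.E4_ext <;> simp
  · refine Equiv.ext fun t => ?_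
    exact GenCplx.torusShear_zero t
  · intro x
    obtain ⟨y, rfl⟩ := GenCplx.totalCover.surjective x
    exact ⟨(GenCplx.toTorus y.1, y.2), rfl⟩
  · change GenCplx.pullback GenCplx.toTotal GenCplx.totalForm y ![u, v] = _
    rw [GenCplx.pullback_totalForm, GenCplx.liftForm_apply]
    rfl
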